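/- Let $n\ge 0$ be an integer, $c>0$, and let $\gamma_{2n,1},\dots,\gamma_{2n,n}$ be real parameters. Consider the $n^2$ variables $\gamma_{l,j}$, $1\le l\le 2n-1$, $1\le j\le\lceil l/2\rceil$, so that levels $2k-1$ and $2k$ have $k$ entries each, and write $e^{\pm ic\,\partial_{\gamma_{l,j}}}$ for the substitution $\gamma_{l,j}\mapsto\gamma_{l,j}\pm ic$. **Operators.** For $1\le k\le n$ put $$I_{2k+1,2k}=-\frac1{ic}\sum_{j=1}^k\frac{\prod_{r=1}^{k-1}(\gamma_{2k-2,r}+\gamma_{2k-1,j}+\frac{ic}2)\prod_{r=1}^k(\gamma_{2k-1,j}-\gamma_{2k,r}+\frac{ic}2)}{2\prod_{r\ne j}(\gamma_{2k-1,j}-\gamma_{2k-1,r})(\gamma_{2k-1,j}+\gamma_{2k-1,r}+ic)}\,e^{ic\,\partial_{\gamma_{2k-1,j}}}$$ $$\qquad-\frac1{ic}\sum_{j=1}^k\frac{\prod_{r=1}^{k-1}(\gamma_{2k-1,j}-\gamma_{2k-2,r}-\frac{ic}2)\prod_{r=1}^k(\gamma_{2k,r}+\gamma_{2k-1,j}-\frac{ic}2)}{2\prod_{r\ne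 j}(\gamma_{2k-1,j}-\gamma_{2k-1,r})(\gamma_{2k-1,j}+\gamma_{2k-1,r}-ic)}\,e^{-ic\,\partial_{\gamma_{2k-1,j}}},$$ and for $0\le k\le n-1$ put $$iI_{2k+2,2k+1}=\frac1c\sum_{j=1}^k\frac{\prod_{r=1}^{k+1}\big((\gamma_{2k,j}+\frac{ic}2)^2-\gamma_{2k+1,r}^2\big)}{2\gamma_{2k,j}(\gamma_{2k,j}+\frac{ic}2)\prod_{r\ne j}(\gamma_{2k,j}^2-\gamma_{2k,r}^2)}\,e^{ic\,\partial_{\gamma_{2k,j}}}$$ $$\qquad+\frac1c\sum_{j=1}^k\frac{\prod_{r=1}^{k}\big((\gamma_{2k,j}-\frac{ic}2)^2-\gamma_{2k-1,r}^2\big)}{2\gamma_{2k,j}(\gamma_{2k,j}-\frac{ic}2)\prod_{r\ne j}(\gamma_{2k,j}^2-\gamma_{2k,r}^2)}\,e^{-ic\,\partial_{\gamma_{2k,j}}}-\frac1{ic}\,\frac{\prod_{r=1}^k\gamma_{2k-1,r}\prod_{r=1}^{k+1}\gamma_{2k+1,r}}{\prod_{r=1}^k(\gamma_{2k,r}+\frac{ic}2)(\gamma_{2k,r}-\frac{ic}2)}.$$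 For $a-b>1$ let $I_{a,b}=[I_{a,a-1},I_{a-1,b}]$. These are the operators by which the elements $I_{ab}=e_{ab}-e_{ba}$ ($2n+1\ge a>b\ge1$) of $so(2n+1)$ act. For $N\le 2n+1$ and $m=\lfloor N/2\rfloor$ let $f_j=i^j\frac{ie_{2j-1}+e_{2j}}{\sqrt2}$ and $f_{N+1-j}=i^{-j}\frac{-ie_{2j-1}+e_{2j}}{\sqrt2}$ for $1\le j\le m$ and, if $N$ is odd, $f_{m+1}=-i^m e_N$. Let $(f^l)$ be the basis of $\mathbb C^N$ dual to $(f_k)$ for the bilinear form with $(e_a,e_b)=\delta_{ab}$; that is, $f^l=f_{N+1-l}$, except that $f^{m+1}=-i^{-m}e_N$ when $N=2m+1$. The element $F_{kl}$, $1\le k,l\le N$, is the endomorphism $v\mapsto (f^l,v)f_k-(f_k,v)f^l$ of $\mathbb C^N$. It is a complex linear combination $\sum_{a>b}X_{ab}(e_{ab}-e_{ba})$ and acts on functions by $F_{kl}=\sum_{a>b}X_{ab}I_{ab}$. **Pairing.** For real $\gamma$ let $\tilde\mu=\prod_{l=1}^{2n-1}\tilde\mu_l$, where $$\tilde\mu_{2k}=e^{\frac\pi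 c\sum_j\gamma_{2k,j}}\prod_r\Gamma^{-1}\Big(\frac{2\gamma_{2k,r}}{ic}\Big)\Gamma^{-1}\Big(\frac{-2\gamma_{2k,r}}{ic}\Big)\prod_{r\ne s}\Gamma^{-1}\Big(\frac{\gamma_{2k,r}-\gamma_{2k,s}}{ic}\Big)\prod_{r<s}\Gamma^{-1}\Big(\frac{\gamma_{2k,r}+\gamma_{2k,s}}{ic}\Big)\Gamma^{-1}\Big(\frac{-\gamma_{2k,r}-\gamma_{2k,s}}{ic}\Big),$$ $$\tilde\mu_{2k+1}=\prod_{r\ne s}\Gamma^{-1}\Big(\frac{\gamma_{2k+1,r}-\gamma_{2k+1,s}}{ic}\Big)\prod_{r<s}\Gamma^{-1}\Big(1+\frac{\gamma_{2k+1,r}+\gamma_{2k+1,s}}{ic}\Big)\Gamma^{-1}\Big(1-\frac{\gamma_{2k+1,r}+\gamma_{2k+1,s}}{ic}\Big),$$ and let $(f,g)_{2n}=\int_{\mathbb R^{n^2}}\overline{f(\gamma)}\,g(\gamma)\,\tilde\mu(\gamma)\,d\gamma$. **Functions.** Let $\varepsilon_1,\dots,\varepsilon_n\in\{1,-1\}$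 and let $P_\varepsilon(\gamma)=\prod_w(w+\frac{ic}2)(w+\frac{3ic}2)$, where $w$ runs over the forms $\varepsilon_k\gamma_{2k-1,i}+\gamma_{2k,j}$ ($1\le k\le n$, $i,j\le k$) and $-\gamma_{2k,i}+\varepsilon_k\gamma_{2k+1,j}$ ($1\le k\le n-1$, $i\le k$, $j\le k+1$). Let $f$ and $g$ be meromorphic functions on a tube $T_R=\{|\mathrm{Im}\,\gamma_{l,j}|<R \text{ for all } l,j\}$ with $R>c$, such that $\varphi=P_{-\varepsilon}f$ and $\psi=P_\varepsilon g$ are holomorphic on $T_R$ (for instance, $f$ and $g$ themselves holomorphic) and such that for each $M\in\mathbb N$ $$\sup\;|\varphi(x+iy)|\,|\psi(x+iy')|\,e^{\frac\pi c\Theta(x)}(1+\|x\|)^M<\infty,$$ the supremum being over real $x$ and over real $y,y'$ with all $|y_{l,j}|,|y'_{l,j}|<R$, where $$\Theta(x)=\sum_{k=1}^{n-1}\sum_{j=1}^k\big(x_{2k,j}+2|x_{2k,j}|\big)+\sum_{l=1}^{2n-1}\sum_{r<s}\big(|x_{l,r}-x_{l,s}|+|x_{l,r}+x_{l,s}|\big).$$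 **Claim.** For $A=I_{2k+1,2k}$ ($1\le k\le n$), for $A=iI_{2k+2,2k+1}$ ($0\le k\le n-1$), and for $A=F_{kl}$ ($1\le k,l\le N\le 2n+1$), the integrals $(Af,g)_{2n}$ and $(f,Ag)_{2n}$ converge absolutely, and $$(Af,g)_{2n}=-(f,Ag)_{2n}.$$ -/

import Mathlib

open Complex MeasureTheory
open scoped ComplexConjugate

noncomputable section

namespace SoToda

/-- The positions `(l, j)`, `1 ≤ l ≤ 2n-1`, `1 ≤ j ≤ ⌈l/2⌉`, of the integrated entries of a
Gelfand-Tsetlin array of `so(2n+1)`: levels `2k-1` and `2k` both have `k` entries, so that there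
are `n ^ 2` positions. -/
def positions (n : ℕ) : Finset (ℕ × ℕ) :=
  (Finset.Icc 1 (2 * n - 1) ×ˢ Finset.Icc 1 n).filter fun q => q.2 ≤ (q.1 + 1) / 2

/-- The index type of the variables `γ_{l,j}`, `l ≤ 2n-1`. -/
abbrev Idx (n : ℕ) : Type := {q : ℕ × ℕ // q ∈ positions n}

/-- Functions of the `n ^ 2` complex variables `γ_{l,j}`. -/
abbrev Fn (n : ℕ) : Type := (Idx n → ℂ) → ℂ

/-- The entry `γ_{l,j}` of the array whose top row `γ_{2n,1}, …, γ_{2n,n}` is the tuple `p` of real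
parameters and whose lower rows are given by `z`. -/
def entry {n : ℕ} (p : ℕ → ℝ) (z : Idx n → ℂ) (l j : ℕ) : ℂ :=
  if h : (l, j) ∈ positions n then z ⟨(l, j), h⟩ else if l = 2 * n then (p j : ℂ) else 0

/-- The array in which `γ_{l,j}` is replaced by `γ_{l,j} + h`. -/
def shift {n : ℕ} (z : Idx n → ℂ) (l j : ℕ) (h : ℂ) : Idx n → ℂ :=
  fun q => if q.1 = (l, j) then z q + h else z q

/-! ### The operators -/

/-- The operator `I_{2k+1,2k}`, `1 ≤ k ≤ n`. -/
def opOdd (n : ℕ) (c : ℝ) (p : ℕ → ℝ) (k : ℕ) (f : Fn n) : Fn n := fun z =>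
  let γ := entry p z;
  -(1 / (I * c)) * ∑ j ∈ Finset.Icc 1 k,
      ((∏ r ∈ Finset.Icc 1 (k - 1), (γ (2 * k - 2) r + γ (2 * k - 1) j + I * c / 2)) *
        ∏ r ∈ Finset.Icc 1 k, (γ (2 * k - 1) j - γ (2 * k) r + I * c / 2)) /
      (2 * ∏ r ∈ (Finset.Icc 1 k).erase j,
        ((γ (2 * k - 1) j - γ (2 * k - 1) r) * (γ (2 * k - 1) j + γ (2 * k - 1) r + I * c))) *
      f (shift z (2 * k - 1) j (I * c))
  - (1 / (I * c)) * ∑ j ∈ Finset.Icc 1 k,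
      ((∏ r ∈ Finset.Icc 1 (k - 1), (γ (2 * k - 1) j - γ (2 * k - 2) r - I * c / 2)) *
        ∏ r ∈ Finset.Icc 1 k, (γ (2 * k) r + γ (2 * k - 1) j - I * c / 2)) /
      (2 * ∏ r ∈ (Finset.Icc 1 k).erase j,
        ((γ (2 * k - 1) j - γ (2 * k - 1) r) * (γ (2 * k - 1) j + γ (2 * k - 1) r - I * c))) *
      f (shift z (2 * k - 1) j (-(I * c)))

/-- The operator `i I_{2k+2,2k+1}`, `0 ≤ k ≤ n - 1`. -/
def iOpEven (n : ℕ) (c : ℝ) (p : ℕ → ℝ) (k : ℕ) (f : Fn n) : Fn n := fun z =>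
  let γ := entry p z;
  (1 / (c : ℂ)) * ∑ j ∈ Finset.Icc 1 k,
      (∏ r ∈ Finset.Icc 1 (k + 1), ((γ (2 * k) j + I * c / 2) ^ 2 - γ (2 * k + 1) r ^ 2)) /
      (2 * γ (2 * k) j * (γ (2 * k) j + I * c / 2) *
        ∏ r ∈ (Finset.Icc 1 k).erase j, (γ (2 * k) j ^ 2 - γ (2 * k) r ^ 2)) *
      f (shift z (2 * k) j (I * c))
  + (1 / (c : ℂ)) * ∑ j ∈ Finset.Icc 1 k,
      (∏ r ∈ Finset.Icc 1 k, ((γ (2 * k) j - I * c / 2) ^ 2 - γ (2 * k - 1) r ^ 2)) /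
      (2 * γ (2 * k) j * (γ (2 * k) j - I * c / 2) *
        ∏ r ∈ (Finset.Icc 1 k).erase j, (γ (2 * k) j ^ 2 - γ (2 * k) r ^ 2)) *
      f (shift z (2 * k) j (-(I * c)))
  - (1 / (I * c)) *
      (((∏ r ∈ Finset.Icc 1 k, γ (2 * k - 1) r) * ∏ r ∈ Finset.Icc 1 (k + 1), γ (2 * k + 1) r) /
        ∏ r ∈ Finset.Icc 1 k, ((γ (2 * k) r + I * c / 2) * (γ (2 * k) r - I * c / 2))) * f z

/-- The generator `I_{m+1,m}`, `1 ≤ m ≤ 2n`. -/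
def opSimple (n : ℕ) (c : ℝ) (p : ℕ → ℝ) (m : ℕ) (f : Fn n) : Fn n :=
  if m % 2 = 0 then opOdd n c p (m / 2) f else fun z => -I * iOpEven n c p (m / 2) f z

/-- The operator `I_{b+d+1,b}`, obtained from the generators by
`I_{a,b} = [I_{a,a-1}, I_{a-1,b}]` for `a - b > 1`. -/
def opI (n : ℕ) (c : ℝ) (p : ℕ → ℝ) (b : ℕ) : ℕ → Fn n → Fn n
  | 0, f => opSimple n c p b f
  | d + 1, f => fun z =>
      opSimple n c p (b + d + 1) (opI n c p b d f) z -
        opI n c p b d (opSimple n c p (b + d + 1) f) z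

/-- The coordinate along `e_a` of the basis vector `f_k`, `1 ≤ k ≤ N`, of `ℂ^N`. With `m = ⌊N/2⌋`:
`f_j = i^j (i e_{2j-1} + e_{2j}) / √2` and `f_{N+1-j} = i^{-j} (-i e_{2j-1} + e_{2j}) / √2` for
`1 ≤ j ≤ m`, and `f_{m+1} = -i^m e_N` if `N` is odd. -/
def fVec (N k a : ℕ) : ℂ :=
  if k ≤ N / 2 then
    if a = 2 * k - 1 then I ^ k * I / (Real.sqrt 2 : ℂ)
    else if a = 2 * k then I ^ k / (Real.sqrt 2 : ℂ) else 0
  else if N + 1 - k ≤ N / 2 then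
    if a = 2 * (N + 1 - k) - 1 then (-I) ^ (N + 1 - k) * (-I) / (Real.sqrt 2 : ℂ)
    else if a = 2 * (N + 1 - k) then (-I) ^ (N + 1 - k) / (Real.sqrt 2 : ℂ) else 0
  else if a = N then -I ^ (N / 2) else 0

/-- The coordinate along `e_a` of the vector `f^l` dual to `f_l`: `∑_a (f_k)_a (f^l)_a = δ_{kl}`.
Thus `f^l = f_{N+1-l}`, except for the middle vector of an odd `N`, where
`f^{m+1} = -i^{-m} e_N`. -/
def fDual (N l a : ℕ) : ℂ :=
  if l = N + 1 - l then (if a = N then -(-I) ^ (N / 2) else 0) else fVec N (N + 1 - l) a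

/-- The operator `F_{kl}` of `so(N, J)`, `1 ≤ k, l ≤ N ≤ 2n+1`. The endomorphism
`v ↦ (f^l, v) f_k - (f_k, v) f^l` of `ℂ^N` has in the basis `e_1, …, e_N` the antisymmetric matrix
`X_{ab} = (f_k)_a (f^l)_b - (f^l)_a (f_k)_b`; it equals `∑_{a > b} X_{ab} (e_{ab} - e_{ba})`, and
`F_{kl} = ∑_{a > b} X_{ab} I_{ab}`. -/
def opF (n : ℕ) (c : ℝ) (p : ℕ → ℝ) (N k l : ℕ) (f : Fn n) : Fn n := fun z =>
  ∑ a ∈ Finset.Icc 1 N, ∑ b ∈ Finset.Icc 1 (a - 1),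
    (fVec N k a * fDual N l b - fDual N l a * fVec N k b) * opI n c p b (a - b - 1) f z

/-! ### The pairing -/

/-- The density `μ̃` at level `2k`. -/
def muEven (c : ℝ) (γ : ℕ → ℕ → ℂ) (k : ℕ) : ℂ :=
  exp (Real.pi / c * ∑ j ∈ Finset.Icc 1 k, γ (2 * k) j) *
  (∏ r ∈ Finset.Icc 1 k,
    (Gamma (2 * γ (2 * k) r / (I * c)))⁻¹ * (Gamma (-2 * γ (2 * k) r / (I * c)))⁻¹) *
  (∏ r ∈ Finset.Icc 1 k, ∏ s ∈ (Finset.Icc 1 k).erase r,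
    (Gamma ((γ (2 * k) r - γ (2 * k) s) / (I * c)))⁻¹) *
  ∏ r ∈ Finset.Icc 1 k, ∏ s ∈ Finset.Ioc r k,
    (Gamma ((γ (2 * k) r + γ (2 * k) s) / (I * c)))⁻¹ *
      (Gamma ((-γ (2 * k) r - γ (2 * k) s) / (I * c)))⁻¹

/-- The density `μ̃` at level `2k+1`. -/
def muOdd (c : ℝ) (γ : ℕ → ℕ → ℂ) (k : ℕ) : ℂ :=
  (∏ r ∈ Finset.Icc 1 (k + 1), ∏ s ∈ (Finset.Icc 1 (k + 1)).erase r,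
    (Gamma ((γ (2 * k + 1) r - γ (2 * k + 1) s) / (I * c)))⁻¹) *
  ∏ r ∈ Finset.Icc 1 (k + 1), ∏ s ∈ Finset.Ioc r (k + 1),
    (Gamma (1 + (γ (2 * k + 1) r + γ (2 * k + 1) s) / (I * c)))⁻¹ *
      (Gamma (1 - (γ (2 * k + 1) r + γ (2 * k + 1) s) / (I * c)))⁻¹

/-- The density `μ̃` of the pairing, the product over the levels `1, …, 2n-1`. -/
def mu (n : ℕ) (c : ℝ) (p : ℕ → ℝ) (z : Idx n → ℂ) : ℂ :=
  (∏ k ∈ Finset.Icc 1 (n - 1), muEven c (entry p z) k) *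
    ∏ k ∈ Finset.range n, muOdd c (entry p z) k

/-- A real array, as a complex one. -/
def toC {n : ℕ} (x : Idx n → ℝ) : Idx n → ℂ := fun q => (x q : ℂ)

/-- The integrand of the pairing `(f, g)_{2n}`. -/
def integrand (n : ℕ) (c : ℝ) (p : ℕ → ℝ) (f g : Fn n) (x : Idx n → ℝ) : ℂ :=
  conj (f (toC x)) * g (toC x) * mu n c p (toC x)

/-- The pairing `(f, g)_{2n}`. -/
def pairing (n : ℕ) (c : ℝ) (p : ℕ → ℝ) (f g : Fn n) : ℂ :=
  ∫ x : Idx n → ℝ, integrand n c p f g x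

/-- `(A f, g) = -(f, A g)`, both integrals being absolutely convergent. -/
def IsSkewFor (n : ℕ) (c : ℝ) (p : ℕ → ℝ) (A : Fn n → Fn n) (f g : Fn n) : Prop :=
  Integrable (integrand n c p (A f) g) ∧ Integrable (integrand n c p f (A g)) ∧
    pairing n c p (A f) g = -pairing n c p f (A g)

/-! ### The functions that are paired -/

/-- The tube `|Im γ_{l,j}| < R`. -/
def tube (n : ℕ) (R : ℝ) : Set (Idx n → ℂ) := {z | ∀ q, |(z q).im| < R}

/-- The product of the linear forms `w + ic/2` and `w + 3ic/2`, where `w` runs over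
`ε_k γ_{2k-1,i} + γ_{2k,j}` for `1 ≤ k ≤ n` and `-γ_{2k,i} + ε_k γ_{2k+1,j}` for `1 ≤ k ≤ n - 1`:
the first poles of the factors `Γ(w/(ic) + 1/2)` of a Whittaker vector. -/
def poleForm (n : ℕ) (c : ℝ) (p : ℕ → ℝ) (ε : ℕ → ℤˣ) (z : Idx n → ℂ) : ℂ :=
  let γ := entry p z;
  let P : ℂ → ℂ := fun w => (w + I * c / 2) * (w + 3 * I * c / 2);
  (∏ k ∈ Finset.Icc 1 n, ∏ i ∈ Finset.Icc 1 k, ∏ j ∈ Finset.Icc 1 k,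
      P (((ε k : ℤ) : ℂ) * γ (2 * k - 1) i + γ (2 * k) j)) *
  ∏ k ∈ Finset.Icc 1 (n - 1), ∏ i ∈ Finset.Icc 1 k, ∏ j ∈ Finset.Icc 1 (k + 1),
      P (-γ (2 * k) i + ((ε k : ℤ) : ℂ) * γ (2 * k + 1) j)

/-- `f` is meromorphic in the tube of radius `R`, with at most simple poles along the zeros of
`poleForm`, and `φ` is the holomorphic function `poleForm * f`. -/
def IsRegularized (n : ℕ) (c : ℝ) (p : ℕ → ℝ) (ε : ℕ → ℤˣ) (R : ℝ) (f φ : Fn n) : Prop :=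
  DifferentiableOn ℂ φ (tube n R) ∧
    ∀ z ∈ tube n R, poleForm n c p ε z ≠ 0 → φ z = poleForm n c p ε z * f z

/-- The exponent `Θ` of the growth `exp (π Θ / c)` of the density `μ̃`. -/
def growth (n : ℕ) (x : Idx n → ℝ) : ℝ :=
  let γ : ℕ → ℕ → ℝ := fun l j => (entry 0 (toC x) l j).re;
  (∑ k ∈ Finset.Icc 1 (n - 1), ∑ j ∈ Finset.Icc 1 k, (γ (2 * k) j + 2 * |γ (2 * k) j|)) +
    ∑ l ∈ Finset.Icc 1 (2 * n - 1), ∑ r ∈ Finset.Icc 1 ((l + 1) / 2),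
      ∑ s ∈ Finset.Ioc r ((l + 1) / 2), (|γ l r - γ l s| + |γ l r + γ l s|)

/-- The pairs `(f, g)` of functions meromorphic in a neighbourhood of the tube `|Im γ_{l,j}| ≤ c`,
with at most simple poles at the places where a pair of dual Whittaker vectors has poles, whose
product compensates the growth of `μ̃` up to a rapidly decreasing factor. -/
def IsAdmissible (n : ℕ) (c : ℝ) (p : ℕ → ℝ) (ε : ℕ → ℤˣ) (f g : Fn n) : Prop :=
  ∃ R : ℝ, c < R ∧ ∃ φ ψ : Fn n,
    IsRegularized n c p (-ε) R f φ ∧ IsRegularized n c p ε R g ψ ∧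
    ∀ M : ℕ, ∃ C : ℝ, ∀ x y y' : Idx n → ℝ, (∀ q, |y q| < R) → (∀ q, |y' q| < R) →
      ‖φ (toC x + I • toC y)‖ * ‖ψ (toC x + I • toC y')‖ *
        Real.exp (Real.pi / c * growth n x) * (1 + ‖x‖) ^ M ≤ C

end SoToda

end

noncomputable section

namespace SoToda

/-! ### Products over pairs -/

theorem prod_Icc_erase_pairs {M : Type*} [CommMonoid M] (k : ℕ) (g : ℕ → ℕ → M) :
    ∏ r ∈ Finset.Icc 1 k, ∏ s ∈ (Finset.Icc 1 k).erase r, g r s =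
      ∏ r ∈ Finset.Icc 1 k, ∏ s ∈ Finset.Ioc r k, g r s * g s r := by
  induction k with
  | zero => simp
  | succ k ih =>
    have h1 : Finset.Icc 1 (k + 1) = insert (k + 1) (Finset.Icc 1 k) := by ext; simp; omega
    have h2 : ∏ r ∈ Finset.Icc 1 (k + 1), ∏ s ∈ (Finset.Icc 1 (k + 1)).erase r, g r s =
        (∏ s ∈ Finset.Icc 1 k, g (k + 1) s) * ∏ r ∈ Finset.Icc 1 k,
          (g r (k + 1) * ∏ s ∈ (Finset.Icc 1 k).erase r, g r s) := by
      rw [h1, Finset.prod_insert (by simp)]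
      congr 1
      · rw [Finset.erase_insert (by simp)]
      · refine Finset.prod_congr rfl fun r hr => ?_
        rw [Finset.mem_Icc] at hr
        rw [Finset.erase_insert_of_ne (by omega), Finset.prod_insert (by simp)]
    have h3 : ∏ r ∈ Finset.Icc 1 (k + 1), ∏ s ∈ Finset.Ioc r (k + 1), g r s * g s r =
        ∏ r ∈ Finset.Icc 1 k,
          (g r (k + 1) * g (k + 1) r * ∏ s ∈ Finset.Ioc r k, g r s * g s r) := by
      rw [h1, Finset.prod_insert (by simp)]
      simp only [Finset.Ioc_self, Finset.prod_empty, one_mul]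
      refine Finset.prod_congr rfl fun r hr => ?_
      rw [Finset.mem_Icc] at hr
      have : Finset.Ioc r (k + 1) = insert (k + 1) (Finset.Ioc r k) := by ext; simp; omega
      rw [this, Finset.prod_insert (by simp)]
    rw [h2, h3]
    simp only [Finset.prod_mul_distrib] at ih ⊢
    rw [ih]
    simp only [mul_assoc]
    ac_rfl

@[to_additive]
theorem prod_pairs_split {M : Type*} [CommMonoid M] (k j : ℕ) (hj : j ∈ Finset.Icc 1 k)
    (g : ℕ → ℕ → M) (hg : ∀ r s, g r s = g s r) :
    ∏ r ∈ Finset.Icc 1 k, ∏ s ∈ Finset.Ioc r k, g r s =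
      (∏ r ∈ (Finset.Icc 1 k).erase j, g j r) *
        ∏ r ∈ (Finset.Icc 1 k).erase j, ∏ s ∈ (Finset.Ioc r k).erase j, g r s := by
  have hj' := Finset.mem_Icc.1 hj
  rw [← Finset.mul_prod_erase _ _ hj]
  have h1 : ∏ r ∈ (Finset.Icc 1 k).erase j, ∏ s ∈ Finset.Ioc r k, g r s =
      (∏ r ∈ (Finset.Icc 1 k).erase j, if r < j then g j r else 1) *
        ∏ r ∈ (Finset.Icc 1 k).erase j, ∏ s ∈ (Finset.Ioc r k).erase j, g r s := by
    rw [← Finset.prod_mul_distrib]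
    refine Finset.prod_congr rfl fun r _ => ?_
    split_ifs with h
    · rw [hg j r, Finset.mul_prod_erase _ _ (by simp; omega)]
    · rw [one_mul, Finset.erase_eq_of_notMem (by simp; omega)]
  rw [h1, ← mul_assoc]
  congr 1
  have h2 : Finset.Ioc j k = ((Finset.Icc 1 k).erase j).filter fun r => ¬ r < j := by
    ext r; simp; omega
  rw [h2, ← Finset.prod_filter, mul_comm, Finset.prod_filter_mul_prod_filter_not]

/-! ### Reciprocal Gamma factors -/

/-- The entire function `1 / (Γ(s) Γ(-s))`. -/
def gammaE (s : ℂ) : ℂ := (Gamma s)⁻¹ * (Gamma (-s))⁻¹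

/-- The entire function `1 / (Γ(1+s) Γ(1-s)) = sin(π s) / (π s)`. -/
def gammaS (s : ℂ) : ℂ := (Gamma (1 + s))⁻¹ * (Gamma (1 - s))⁻¹

theorem gammaS_mul (s : ℂ) : gammaS s * s = sin (Real.pi * s) / Real.pi := by
  have h := Gamma_mul_Gamma_one_sub s
  by_cases hs : s = 0
  · simp [hs]
  · unfold gammaS
    have hpi : (Real.pi : ℂ) ≠ 0 := by exact_mod_cast Real.pi_ne_zero
    rw [add_comm, Gamma_add_one s hs, ← inv_inv (sin _ / _), inv_div, ← h]
    rw [mul_inv, mul_inv]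
    field_simp

theorem gammaE_eq (s : ℂ) : gammaE s = -s * sin (Real.pi * s) / Real.pi := by
  by_cases hs : s = 0
  · simp [hs, gammaE]
  · have h := Gamma_mul_Gamma_one_sub s
    have h1 : Gamma (1 - s) = -s * Gamma (-s) := by
      rw [← Gamma_add_one _ (neg_ne_zero.2 hs)]; congr 1; ring
    have hpi : (Real.pi : ℂ) ≠ 0 := by exact_mod_cast Real.pi_ne_zero
    rw [h1] at h
    have : sin (Real.pi * s) / Real.pi = (Gamma s * (-s * Gamma (-s)))⁻¹ := by
      rw [h, inv_div]
    rw [mul_div_assoc, this, gammaE, mul_inv, mul_inv]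
    field_simp

theorem differentiable_gammaS : Differentiable ℂ gammaS :=
  (differentiable_one_div_Gamma.comp (differentiable_id.const_add 1)).mul
    (differentiable_one_div_Gamma.comp (differentiable_id.const_sub 1))

theorem norm_sin_pi_le (s : ℂ) : ‖sin (Real.pi * s)‖ ≤ Real.exp (Real.pi * |s.im|) := by
  have h1 : ∀ w : ℂ, ‖sin w‖ ≤ Real.exp |w.im| := by
    intro w
    rw [sin]
    have e1 : ‖exp (-w * I)‖ ≤ Real.exp |w.im| := by
      rw [norm_exp]; apply Real.exp_le_exp.2; simp [le_abs_self]
    have e2 : ‖exp (w * I)‖ ≤ Real.exp |w.im| := by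
      rw [norm_exp]; apply Real.exp_le_exp.2; simp [neg_le_abs]
    rw [norm_div, norm_mul, norm_I, mul_one]
    have := norm_sub_le (exp (-w * I)) (exp (w * I))
    have h2 : ‖(2 : ℂ)‖ = 2 := by simp
    rw [h2]; linarith
  have := h1 (Real.pi * s)
  simpa [abs_mul, abs_of_pos Real.pi_pos] using this

theorem exists_norm_gammaS_le :
    ∃ C : ℝ, 0 < C ∧ ∀ s, ‖gammaS s‖ ≤ C * Real.exp (Real.pi * |s.im|) := by
  obtain ⟨C, hC⟩ := (isCompact_closedBall (0 : ℂ) 1).exists_bound_of_continuousOn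
    differentiable_gammaS.continuous.continuousOn
  refine ⟨max C 1, by positivity, fun s => ?_⟩
  have h1 : 1 ≤ Real.exp (Real.pi * |s.im|) := Real.one_le_exp (by positivity)
  by_cases hs : ‖s‖ ≤ 1
  · calc ‖gammaS s‖ ≤ C := hC s (by simpa using hs)
      _ ≤ max C 1 * 1 := by simp
      _ ≤ _ := by gcongr
  · push Not at hs
    have h := congrArg norm (gammaS_mul s)
    rw [norm_mul, norm_div] at h
    have h2 : ‖(Real.pi : ℂ)‖ = Real.pi := by simp [abs_of_pos Real.pi_pos]
    rw [h2] at h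
    have h3 := norm_sin_pi_le s
    have h4 : ‖sin (Real.pi * s)‖ / Real.pi ≤ ‖sin (Real.pi * s)‖ :=
      div_le_self (norm_nonneg _) (by linarith [Real.pi_gt_three])
    calc ‖gammaS s‖ ≤ ‖gammaS s‖ * ‖s‖ := le_mul_of_one_le_right (norm_nonneg _) hs.le
      _ ≤ 1 * Real.exp (Real.pi * |s.im|) := by linarith
      _ ≤ _ := by gcongr; exact le_max_right _ _

theorem norm_Gamma_div_le (s : ℂ) (hs : 1 / 2 ≤ s.re) (k : ℕ) :
    ‖Gamma s / Gamma (s + k)‖ ≤ 2 ^ k := by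
  induction k with
  | zero =>
    have : Gamma s ≠ 0 := Gamma_ne_zero_of_re_pos (by linarith)
    simp [this]
  | succ k ih =>
    have hre : 1 / 2 ≤ (s + k).re := by simp; linarith [Nat.cast_nonneg (α := ℝ) k]
    have h0 : s + k ≠ 0 := fun h => by rw [h] at hre; norm_num at hre
    have hn : 1 / 2 ≤ ‖s + k‖ := hre.trans (re_le_norm _)
    push_cast
    rw [← add_assoc, Gamma_add_one _ h0, mul_comm, ← div_div, norm_div, pow_succ]
    rw [div_le_iff₀ (by linarith)]
    have : (0 : ℝ) ≤ 2 ^ k := by positivity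
    nlinarith

theorem measurable_Gamma : Measurable Gamma := by
  have h : Measurable fun s : ℂ => ((Gamma s)⁻¹)⁻¹ :=
    differentiable_one_div_Gamma.continuous.measurable.inv
  simpa using h

/-! ### Shifting the contour in one of several variables -/

theorem integral_eq_of_differentiable_strip (b C : ℝ) (h : ℂ → ℂ)
    (hd : ∀ ζ : ℂ, ζ.im ∈ Set.uIcc 0 b → DifferentiableAt ℂ h ζ)
    (hb : ∀ x y : ℝ, y ∈ Set.uIcc 0 b → (1 + |x|) ^ 2 * ‖h (x + y * I)‖ ≤ C) :
    ∫ x : ℝ, h x = ∫ x : ℝ, h (x + b * I) := by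
  have hint : ∀ y ∈ Set.uIcc 0 b, Integrable fun x : ℝ => h (x + y * I) := by
    intro y hy
    have hcont : Continuous fun x : ℝ => h (x + y * I) := by
      rw [continuous_iff_continuousAt]
      intro x
      have := (hd (x + y * I) (by simpa using hy)).continuousAt
      exact ContinuousAt.comp (f := fun x : ℝ => (x : ℂ) + y * I) this (by fun_prop)
    refine (((integrable_inv_one_add_sq).const_mul C).mono' hcont.aestronglyMeasurable
      (Filter.Eventually.of_forall fun x => ?_))
    have h1 := hb x y hy
    have h2 : 1 + x ^ 2 ≤ (1 + |x|) ^ 2 := by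
      rw [← sq_abs x]; nlinarith [abs_nonneg x]
    rw [← div_eq_mul_inv, le_div_iff₀ (by positivity)]
    calc _ ≤ ‖h (x + y * I)‖ * (1 + |x|) ^ 2 := by gcongr
      _ ≤ C := by rw [mul_comm]; exact h1
  have hrect : ∀ T : ℝ, (∫ x in (-T)..T, h x) - (∫ x in (-T)..T, h (x + b * I)) =
      -(I * ∫ y in (0 : ℝ)..b, h (T + y * I)) + I * ∫ y in (0 : ℝ)..b, h (-T + y * I) := by
    intro T
    have := Complex.integral_boundary_rect_eq_zero_of_differentiableOn h (-T : ℂ) (T + b * I) (by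
      intro ζ hζ
      refine (hd ζ ?_).differentiableWithinAt
      have := hζ.2
      simpa using this)
    simp at this
    linear_combination this
  have hC : 0 ≤ C := le_trans (by positivity) (hb 0 0 (by simp))
  have hside : ∀ T : ℝ, ‖-(I * ∫ y in (0 : ℝ)..b, h (T + y * I)) +
      I * ∫ y in (0 : ℝ)..b, h (-T + y * I)‖ ≤ 2 * (C / (1 + |T|) ^ 2 * |b|) := by
    intro T
    have hT : ∀ T : ℝ, ‖∫ y in (0 : ℝ)..b, h (T + y * I)‖ ≤ C / (1 + |T|) ^ 2 * |b| := by
      intro T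
      have := intervalIntegral.norm_integral_le_of_norm_le_const (a := (0 : ℝ)) (b := b)
        (f := fun y : ℝ => h (T + y * I)) (C := C / (1 + |T|) ^ 2) (by
          intro y hy
          rw [le_div_iff₀ (by positivity), mul_comm]
          exact hb T y (Set.uIoc_subset_uIcc hy))
      simpa using this
    have h1 := hT T
    have h2 := hT (-T)
    rw [abs_neg] at h2
    push_cast at h2
    refine (norm_add_le _ _).trans ?_
    rw [norm_neg, norm_mul, norm_mul, norm_I, one_mul, one_mul]
    linarith
  have hlim : Filter.Tendsto (fun T : ℝ => 2 * (C / (1 + |T|) ^ 2 * |b|)) Filter.atTop (nhds 0) := by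
    have h1 : Filter.Tendsto (fun T : ℝ => (1 + |T|) ^ 2) Filter.atTop Filter.atTop := by
      refine Filter.tendsto_atTop_mono (f := fun T : ℝ => T) (fun T => ?_) Filter.tendsto_id
      nlinarith [le_abs_self T, abs_nonneg T]
    have := ((h1.const_div_atTop C).mul_const |b|).const_mul 2
    simpa using this
  have hz : Filter.Tendsto (fun T : ℝ => (∫ x in (-T)..T, h x) - ∫ x in (-T)..T, h (x + b * I))
      Filter.atTop (nhds 0) := by
    refine squeeze_zero_norm (fun T => ?_) hlim
    rw [hrect T]
    exact hside T
  have h0 := hint 0 (by simp)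
  simp only [ofReal_zero, zero_mul, add_zero] at h0
  have l1 := intervalIntegral_tendsto_integral h0 Filter.tendsto_neg_atTop_atBot Filter.tendsto_id
  have l2 := intervalIntegral_tendsto_integral (hint b (by simp)) Filter.tendsto_neg_atTop_atBot
    Filter.tendsto_id
  exact sub_eq_zero.1 (tendsto_nhds_unique (l1.sub l2) hz)

theorem integral_eq_of_integral_update_eq {ι : Type*} [Fintype ι] [DecidableEq ι] (q : ι)
    (f g : (ι → ℝ) → ℂ) (hf : Integrable f) (hg : Integrable g)
    (h : ∀ x, ∫ t : ℝ, f (Function.update x q t) = ∫ t : ℝ, g (Function.update x q t)) :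
    ∫ x, f x = ∫ x, g x := by
  let e := MeasurableEquiv.piEquivPiSubtypeProd (fun _ : ι => ℝ) (fun i => i = q)
  have he : MeasurePreserving e.symm :=
    by convert (volume_preserving_piEquivPiSubtypeProd (fun _ : ι => ℝ) (fun i => i = q)).symm e
  let u := MeasurableEquiv.funUnique {i // i = q} ℝ
  have hu : MeasurePreserving u.symm := (volume_preserving_funUnique {i // i = q} ℝ).symm u
  have key : ∀ F : (ι → ℝ) → ℂ, Integrable F →
      ∫ x, F x = ∫ y : {i // ¬ i = q} → ℝ, ∫ t : ℝ, F (e.symm (u.symm t, y)) := by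
    intro F hF
    have h1 : Integrable (fun z => F (e.symm z)) := (he.integrable_comp_emb e.symm.measurableEmbedding).2 hF
    rw [← he.integral_comp e.symm.measurableEmbedding F]
    rw [Measure.volume_eq_prod, integral_prod_symm _ h1]
    congr 1
    ext y
    exact (hu.integral_comp u.symm.measurableEmbedding (fun s => F (e.symm (s, y)))).symm
  rw [key f hf, key g hg]
  congr 1
  ext y
  have hup : ∀ t : ℝ, e.symm (u.symm t, y) = Function.update (e.symm (u.symm 0, y)) q t := by
    intro t
    have hs : ∀ (t : ℝ) (i : ι), e.symm (u.symm t, y) i = if h : i = q then t else y ⟨i, h⟩ :=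
      fun _ _ => rfl
    ext i
    by_cases hi : i = q
    · subst hi
      rw [hs, Function.update_self, dif_pos rfl]
    · rw [hs, Function.update_of_ne hi, hs, dif_neg hi, dif_neg hi]
  have hF : ∀ F : (ι → ℝ) → ℂ, ∫ t : ℝ, F (e.symm (u.symm t, y)) =
      ∫ t : ℝ, F (Function.update (e.symm (u.symm 0, y)) q t) := fun F =>
    congrArg (fun φ : ℝ → ℂ => ∫ t, φ t) (funext fun t => congrArg F (hup t))
  change ∫ t : ℝ, f (e.symm (u.symm t, y)) = ∫ t : ℝ, g (e.symm (u.symm t, y))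
  rw [hF f, hF g]
  exact h _

theorem integrable_of_rapid_decay {ι : Type*} [Fintype ι] (f : (ι → ℝ) → ℂ)
    (hf : AEStronglyMeasurable f) (C : ℝ)
    (hb : ∀ᵐ x, (1 + ‖x‖) ^ (Fintype.card ι + 1) * ‖f x‖ ≤ C) : Integrable f := by
  have h1 : Integrable fun x : ι → ℝ => C * (1 + ‖x‖) ^ (-((Fintype.card ι : ℝ) + 1)) :=
    (integrable_one_add_norm (by simp)).const_mul C
  refine h1.mono' hf (hb.mono fun x hx => ?_)
  have h2 : (0 : ℝ) < 1 + ‖x‖ := by positivity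
  have h3 : (1 + ‖x‖) ^ ((Fintype.card ι : ℝ) + 1) = (1 + ‖x‖) ^ (Fintype.card ι + 1) := by
    exact_mod_cast Real.rpow_natCast (1 + ‖x‖) (Fintype.card ι + 1)
  rw [Real.rpow_neg h2.le, h3, ← div_eq_mul_inv, le_div_iff₀ (by positivity), mul_comm]
  exact hx

/-- The contour of one of the variables is moved from `Im = 0` to `Im = b`. -/
theorem integral_eq_integral_shift {ι : Type*} [Fintype ι] [DecidableEq ι] (q : ι) (b C : ℝ)
    (H : (ι → ℂ) → ℂ)
    (hd : ∀ (x : ι → ℝ) (ζ : ℂ), ζ.im ∈ Set.uIcc 0 b →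
      DifferentiableAt ℂ (fun ζ => H (Function.update (fun i => (x i : ℂ)) q ζ)) ζ)
    (hb : ∀ (x : ι → ℝ) (y : ℝ), y ∈ Set.uIcc 0 b →
      (1 + ‖x‖) ^ (Fintype.card ι + 1) *
        ‖H (Function.update (fun i => (x i : ℂ)) q (x q + y * I))‖ ≤ C)
    (hm : ∀ y ∈ Set.uIcc 0 b, AEStronglyMeasurable fun x : ι → ℝ =>
      H (Function.update (fun i => (x i : ℂ)) q (x q + y * I))) :
    ∫ x : ι → ℝ, H (fun i => (x i : ℂ)) =
      ∫ x : ι → ℝ, H (Function.update (fun i => (x i : ℂ)) q (x q + b * I)) := by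
  have hup : ∀ x : ι → ℝ, Function.update (fun i => (x i : ℂ)) q (x q + (0 : ℝ) * I) =
      fun i => (x i : ℂ) := by
    intro x; ext i; by_cases hi : i = q
    · subst hi; simp
    · simp [hi]
  have hint : ∀ y ∈ Set.uIcc 0 b, Integrable fun x : ι → ℝ =>
      H (Function.update (fun i => (x i : ℂ)) q (x q + y * I)) := fun y hy =>
    integrable_of_rapid_decay _ (hm y hy) C (Filter.Eventually.of_forall fun x => hb x y hy)
  have h0 := hint 0 (by simp)
  simp only [hup] at h0
  refine integral_eq_of_integral_update_eq q _ _ h0 (hint b (by simp)) fun x => ?_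
  have h2 : ∀ (t : ℝ) (ζ : ℂ), Function.update (fun i => ((Function.update x q t i : ℝ) : ℂ)) q ζ =
      Function.update (fun i => (x i : ℂ)) q ζ := by
    intro t ζ; ext i; by_cases hi : i = q
    · subst hi; simp
    · simp [hi]
  have h3 := integral_eq_of_differentiable_strip b C
    (fun ζ => H (Function.update (fun i => (x i : ℂ)) q ζ)) (hd x) (fun t y hy => by
      have := hb (Function.update x q t) y hy
      rw [h2, Function.update_self] at this
      refine le_trans ?_ this
      have h4 : |t| ≤ ‖Function.update x q t‖ := by
        simpa using norm_le_pi_norm (Function.update x q t) q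
      have h5 : 2 ≤ Fintype.card ι + 1 := by
        have := Fintype.card_pos_iff.2 ⟨q⟩; omega
      gcongr ?_ * _
      calc (1 + |t|) ^ 2 ≤ (1 + ‖Function.update x q t‖) ^ 2 := by gcongr
        _ ≤ _ := pow_le_pow_right₀ (by linarith [norm_nonneg (Function.update x q t)]) h5)
  have h4 : ∀ t : ℝ, (fun i => ((Function.update x q t i : ℝ) : ℂ)) =
      Function.update (fun i => (x i : ℂ)) q t := by
    intro t; ext i; by_cases hi : i = q
    · subst hi; simp
    · simp [hi]
  simp only [Function.update_self, h4, Function.update_idem]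
  exact h3

end SoToda

end

noncomputable section

namespace SoToda

/-! ### Arrays -/

section Arrays

variable {n : ℕ}

theorem mem_positions {l j : ℕ} :
    (l, j) ∈ positions n ↔ 1 ≤ l ∧ l ≤ 2 * n - 1 ∧ 1 ≤ j ∧ j ≤ (l + 1) / 2 := by
  simp only [positions, Finset.mem_filter, Finset.mem_product, Finset.mem_Icc]
  omega

/-- The array `z` translated by `ic` times an integral array. -/
def tr (c : ℝ) (z : Idx n → ℂ) (m : Idx n → ℤ) : Idx n → ℂ := fun q => z q + I * c * (m q : ℂ)

/-- The array whose real part is `x` and whose imaginary part is `c * m`. -/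
def pt (c : ℝ) (x : Idx n → ℝ) (m : Idx n → ℤ) : Idx n → ℂ := tr c (toC x) m

/-- The entries of an integral array, `0` outside of the positions. -/
def entZ (m : Idx n → ℤ) (q : ℕ × ℕ) : ℤ := if h : q ∈ positions n then m ⟨q, h⟩ else 0

/-- Complex conjugation of arrays. -/
def cj (z : Idx n → ℂ) : Idx n → ℂ := fun q => conj (z q)

/-- The real part of an array. -/
def rePart (z : Idx n → ℂ) : Idx n → ℝ := fun q => (z q).re

theorem tr_tr (c : ℝ) (z : Idx n → ℂ) (m m' : Idx n → ℤ) :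
    tr c (tr c z m) m' = tr c z (m + m') := by
  ext q; simp [tr]; ring

theorem tr_zero (c : ℝ) (z : Idx n → ℂ) : tr c z 0 = z := by ext q; simp [tr]

theorem cj_tr (c : ℝ) (z : Idx n → ℂ) (m : Idx n → ℤ) : cj (tr c z m) = tr c (cj z) (-m) := by
  ext q; simp [tr, cj]

theorem cj_toC (x : Idx n → ℝ) : cj (toC x) = toC x := by ext q; simp [toC, cj]

theorem pt_zero (c : ℝ) (x : Idx n → ℝ) : pt c x 0 = toC x := tr_zero c _

theorem tr_pt (c : ℝ) (x : Idx n → ℝ) (m m' : Idx n → ℤ) :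
    tr c (pt c x m) m' = pt c x (m + m') := tr_tr c _ m m'

theorem cj_pt (c : ℝ) (x : Idx n → ℝ) (m : Idx n → ℤ) : cj (pt c x m) = pt c x (-m) := by
  rw [pt, cj_tr, cj_toC, pt]

theorem entry_tr (c : ℝ) (p : ℕ → ℝ) (z : Idx n → ℂ) (m : Idx n → ℤ) (l j : ℕ) :
    entry p (tr c z m) l j = entry p z l j + I * c * (entZ m (l, j) : ℂ) := by
  unfold entry entZ
  split_ifs <;> simp [tr]

theorem conj_entry (p : ℕ → ℝ) (z : Idx n → ℂ) (l j : ℕ) :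
    conj (entry p z l j) = entry p (cj z) l j := by
  unfold entry
  split_ifs <;> simp [cj]

theorem entry_of_mem (p : ℕ → ℝ) (z : Idx n → ℂ) {l j : ℕ} (h : (l, j) ∈ positions n) :
    entry p z l j = z ⟨(l, j), h⟩ := by
  unfold entry; rw [dif_pos h]

theorem shift_eq_tr (c : ℝ) (z : Idx n → ℂ) {l j : ℕ} (h : (l, j) ∈ positions n) (σ : ℤ) :
    shift z l j (σ * (I * c)) = tr c z (Pi.single ⟨(l, j), h⟩ σ) := by
  ext q
  by_cases hq : q = ⟨(l, j), h⟩
  · subst hq; simp [shift, tr]; ring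
  · have : q.1 ≠ (l, j) := fun h' => hq (Subtype.ext h')
    simp [shift, tr, hq, this]

/-- The arrays for which no denominator of the operators vanishes. -/
def Generic (x : Idx n → ℝ) : Prop :=
  (∀ q, x q ≠ 0) ∧ ∀ q q', q ≠ q' → x q ≠ x q' ∧ x q ≠ -x q'

theorem ae_ne_zero_of_linearMap {ι : Type*} [Fintype ι] (φ : (ι → ℝ) →ₗ[ℝ] ℝ) (y : ι → ℝ)
    (hy : φ y ≠ 0) : ∀ᵐ x : ι → ℝ, φ x ≠ 0 := by
  have h := Measure.addHaar_submodule (volume : Measure (ι → ℝ)) (LinearMap.ker φ) (by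
    intro h
    have : y ∈ LinearMap.ker φ := h ▸ Submodule.mem_top
    exact hy (LinearMap.mem_ker.1 this))
  rw [ae_iff]
  convert h using 2
  ext x
  simp

theorem ae_generic : ∀ᵐ x : Idx n → ℝ, Generic x := by
  refine Filter.Eventually.and ?_ ?_
  · rw [Filter.eventually_all]
    intro q
    exact ae_ne_zero_of_linearMap (LinearMap.proj q) (Pi.single q 1) (by simp)
  · rw [Filter.eventually_all]
    intro q
    rw [Filter.eventually_all]
    intro q'
    by_cases hq : q = q'
    · exact Filter.Eventually.of_forall fun x h => absurd hq h
    · have h1 := ae_ne_zero_of_linearMap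
        (LinearMap.proj (R := ℝ) (φ := fun _ : Idx n => ℝ) q - LinearMap.proj q')
        (Pi.single q 1) (by simp [Ne.symm hq])
      have h2 := ae_ne_zero_of_linearMap
        (LinearMap.proj (R := ℝ) (φ := fun _ : Idx n => ℝ) q + LinearMap.proj q')
        (Pi.single q 1) (by simp [Ne.symm hq])
      filter_upwards [h1, h2] with x hx1 hx2 _
      exact ⟨fun h => hx1 (by simp [h]), fun h => hx2 (by simp [h])⟩

end Arrays

/-! ### Polynomial functions -/

section Poly

variable {n : ℕ}

/-- Polynomial functions of the variables. -/
inductive PolyFn : Fn n → Prop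
  | const (a : ℂ) : PolyFn fun _ => a
  | coord (q : Idx n) : PolyFn fun z => z q
  | add {f g : Fn n} : PolyFn f → PolyFn g → PolyFn fun z => f z + g z
  | mul {f g : Fn n} : PolyFn f → PolyFn g → PolyFn fun z => f z * g z

theorem PolyFn.entry (p : ℕ → ℝ) (l j : ℕ) : PolyFn fun z : Idx n → ℂ => entry p z l j := by
  unfold SoToda.entry
  split_ifs
  · exact .coord _
  · exact .const _
  · exact .const _

theorem PolyFn.sub {f g : Fn n} (hf : PolyFn f) (hg : PolyFn g) : PolyFn fun z => f z - g z := by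
  simpa [sub_eq_add_neg] using hf.add ((PolyFn.const (-1)).mul hg)

theorem PolyFn.pow {f : Fn n} (hf : PolyFn f) (k : ℕ) : PolyFn fun z => f z ^ k := by
  induction k with
  | zero => simpa using PolyFn.const 1
  | succ k ih => simpa [pow_succ] using ih.mul hf

theorem PolyFn.prod {ι : Type*} (s : Finset ι) (f : ι → Fn n) (hf : ∀ i ∈ s, PolyFn (f i)) :
    PolyFn fun z => ∏ i ∈ s, f i z := by
  classical
  induction s using Finset.induction_on with
  | empty => simpa using PolyFn.const 1
  | insert i s hi ih =>
    simp only [Finset.prod_insert hi]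
    exact (hf i (Finset.mem_insert_self _ _)).mul
      (ih fun j hj => hf j (Finset.mem_insert_of_mem hj))

theorem PolyFn.tr {f : Fn n} (hf : PolyFn f) (c : ℝ) (m : Idx n → ℤ) :
    PolyFn fun z => f (tr c z m) := by
  induction hf with
  | const a => exact .const a
  | coord q => exact (PolyFn.coord q).add (.const _)
  | add _ _ h1 h2 => exact h1.add h2
  | mul _ _ h1 h2 => exact h1.mul h2

theorem PolyFn.star {f : Fn n} (hf : PolyFn f) : PolyFn fun z => conj (f (cj z)) := by
  induction hf with
  | const a => exact .const _
  | coord q => simpa [cj] using PolyFn.coord q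
  | add _ _ h1 h2 => simpa using h1.add h2
  | mul _ _ h1 h2 => simpa using h1.mul h2

theorem PolyFn.differentiable {f : Fn n} (hf : PolyFn f) : Differentiable ℂ f := by
  induction hf with
  | const a => exact differentiable_const _
  | coord q => exact differentiable_apply q
  | add _ _ h1 h2 => exact h1.add h2
  | mul _ _ h1 h2 => exact h1.mul h2

/-! ### Functions of exponential type -/

/-- `h` is bounded on `Ω` by `exp θ` up to a polynomial factor. -/
def Tempered (Ω : Set (Idx n → ℂ)) (θ : (Idx n → ℝ) → ℝ) (h : Fn n) : Prop :=
  ∃ C : ℝ, ∃ K : ℕ, 0 ≤ C ∧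
    ∀ z ∈ Ω, ‖h z‖ ≤ C * (1 + ‖rePart z‖) ^ K * Real.exp (θ (rePart z))

theorem Tempered.mul {Ω : Set (Idx n → ℂ)} {θ₁ θ₂ : (Idx n → ℝ) → ℝ} {f g : Fn n}
    (hf : Tempered Ω θ₁ f) (hg : Tempered Ω θ₂ g) :
    Tempered Ω (fun x => θ₁ x + θ₂ x) fun z => f z * g z := by
  obtain ⟨C, K, hC, h1⟩ := hf
  obtain ⟨C', K', hC', h2⟩ := hg
  refine ⟨C * C', K + K', by positivity, fun z hz => ?_⟩
  rw [norm_mul, pow_add, Real.exp_add]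
  calc _ ≤ (C * (1 + ‖rePart z‖) ^ K * Real.exp (θ₁ (rePart z))) *
        (C' * (1 + ‖rePart z‖) ^ K' * Real.exp (θ₂ (rePart z))) :=
        mul_le_mul (h1 z hz) (h2 z hz) (norm_nonneg _) (by positivity)
    _ = _ := by ring

theorem Tempered.of_bound {Ω : Set (Idx n → ℂ)} {f : Fn n} (C : ℝ) (hf : ∀ z ∈ Ω, ‖f z‖ ≤ C) :
    Tempered Ω (fun _ => 0) f :=
  ⟨max C 0, 0, le_max_right _ _, fun z hz => by simpa using Or.inl (hf z hz)⟩

theorem Tempered.mono {Ω : Set (Idx n → ℂ)} {θ₁ θ₂ : (Idx n → ℝ) → ℝ} {f : Fn n}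
    (hf : Tempered Ω θ₁ f) (h : ∀ x, θ₁ x ≤ θ₂ x) : Tempered Ω θ₂ f := by
  obtain ⟨C, K, hC, h1⟩ := hf
  refine ⟨C, K, hC, fun z hz => (h1 z hz).trans ?_⟩
  gcongr
  exact h _

theorem Tempered.prod {ι : Type*} {Ω : Set (Idx n → ℂ)} (s : Finset ι)
    {θ : ι → (Idx n → ℝ) → ℝ} {f : ι → Fn n} (hf : ∀ i ∈ s, Tempered Ω (θ i) (f i)) :
    Tempered Ω (fun x => ∑ i ∈ s, θ i x) fun z => ∏ i ∈ s, f i z := by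
  classical
  induction s using Finset.induction_on with
  | empty => simpa using Tempered.of_bound (f := fun _ => 1) 1 (by simp)
  | insert i s hi ih =>
    simp only [Finset.prod_insert hi, Finset.sum_insert hi]
    exact (hf i (Finset.mem_insert_self _ _)).mul
      (ih fun j hj => hf j (Finset.mem_insert_of_mem hj))

theorem Tempered.add_zero {Ω : Set (Idx n → ℂ)} {f g : Fn n}
    (hf : Tempered Ω (fun _ => 0) f) (hg : Tempered Ω (fun _ => 0) g) :
    Tempered Ω (fun _ => 0) fun z => f z + g z := by
  obtain ⟨C, K, hC, h1⟩ := hf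
  obtain ⟨C', K', hC', h2⟩ := hg
  refine ⟨C + C', K + K', by positivity, fun z hz => ?_⟩
  have e1 := h1 z hz
  have e2 := h2 z hz
  simp only [Real.exp_zero, mul_one] at e1 e2 ⊢
  have a1 : (1 + ‖rePart z‖) ^ K ≤ (1 + ‖rePart z‖) ^ (K + K') :=
    pow_le_pow_right₀ (by linarith [norm_nonneg (rePart z)]) (by omega)
  have a2 : (1 + ‖rePart z‖) ^ K' ≤ (1 + ‖rePart z‖) ^ (K + K') :=
    pow_le_pow_right₀ (by linarith [norm_nonneg (rePart z)]) (by omega)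
  calc _ ≤ ‖f z‖ + ‖g z‖ := norm_add_le _ _
    _ ≤ C * (1 + ‖rePart z‖) ^ (K + K') + C' * (1 + ‖rePart z‖) ^ (K + K') := by
      gcongr
      · exact e1.trans (by gcongr)
      · exact e2.trans (by gcongr)
    _ = _ := by ring

theorem PolyFn.tempered {f : Fn n} (hf : PolyFn f) {Ω : Set (Idx n → ℂ)} {B : ℝ}
    (hΩ : ∀ z ∈ Ω, ∀ q, |(z q).im| ≤ B) : Tempered Ω (fun _ => 0) f := by
  induction hf with
  | const a => exact .of_bound ‖a‖ fun _ _ => le_rfl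
  | coord q =>
    refine ⟨max 1 B, 1, by positivity, fun z hz => ?_⟩
    have h1 : |(z q).re| ≤ ‖rePart z‖ := by simpa [rePart] using norm_le_pi_norm (rePart z) q
    have h2 := hΩ z hz q
    have h3 := Complex.norm_le_abs_re_add_abs_im (z q)
    have h4 : ‖rePart z‖ ≤ max 1 B * ‖rePart z‖ :=
      le_mul_of_one_le_left (norm_nonneg _) (le_max_left _ _)
    simp only [pow_one, Real.exp_zero, mul_one]
    nlinarith [le_max_right 1 B]
  | add _ _ h1 h2 => exact h1.add_zero h2
  | mul _ _ h1 h2 => simpa using h1.mul h2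

end Poly

end SoToda

end

noncomputable section

namespace SoToda

/-! ### Links between adjacent levels -/

/-- The pairs of entries at adjacent levels: `inl (k, i, j)` links `γ_{2k-1,i}` and `γ_{2k,j}`,
and `inr (k, i, j)` links `γ_{2k,i}` and `γ_{2k+1,j}`. -/
abbrev Link : Type := (Σ _ : ℕ, ℕ × ℕ) ⊕ (Σ _ : ℕ, ℕ × ℕ)

/-- The end of a link at an odd level. -/
def Link.oddEnd : Link → ℕ × ℕ
  | .inl t => (2 * t.1 - 1, t.2.1)
  | .inr t => (2 * t.1 + 1, t.2.2)

/-- The end of a link at an even level. -/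
def Link.evenEnd : Link → ℕ × ℕ
  | .inl t => (2 * t.1, t.2.2)
  | .inr t => (2 * t.1, t.2.1)

/-- The sign of the even end in the linear form of a link. -/
def Link.sgn : Link → ℤ
  | .inl _ => 1
  | .inr _ => -1

/-- Half the level of the even end of a link. -/
def Link.level : Link → ℕ
  | .inl t => t.1
  | .inr t => t.1

/-- The links that occur in `poleForm`. -/
def links (n : ℕ) : Finset Link :=
  ((Finset.Icc 1 n).sigma fun k => Finset.Icc 1 k ×ˢ Finset.Icc 1 k).disjSum
    ((Finset.Icc 1 (n - 1)).sigma fun k => Finset.Icc 1 k ×ˢ Finset.Icc 1 (k + 1))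

theorem prod_links {M : Type*} [CommMonoid M] (n : ℕ) (F : Link → M) :
    ∏ t ∈ links n, F t =
      (∏ k ∈ Finset.Icc 1 n, ∏ i ∈ Finset.Icc 1 k, ∏ j ∈ Finset.Icc 1 k, F (.inl ⟨k, i, j⟩)) *
      ∏ k ∈ Finset.Icc 1 (n - 1), ∏ i ∈ Finset.Icc 1 k, ∏ j ∈ Finset.Icc 1 (k + 1),
        F (.inr ⟨k, i, j⟩) := by
  rw [links, Finset.prod_disjSum, Finset.prod_sigma, Finset.prod_sigma]
  simp only [Finset.prod_product]

theorem prod_links_oddEnd {M : Type*} [CommMonoid M] {n k j : ℕ} (hk : k ∈ Finset.Icc 1 n)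
    (hj : j ∈ Finset.Icc 1 k) (F : Link → M)
    (hF : ∀ t ∈ links n, t.oddEnd ≠ (2 * k - 1, j) → F t = 1) :
    ∏ t ∈ links n, F t = (∏ r ∈ Finset.Icc 1 (k - 1), F (.inr ⟨k - 1, r, j⟩)) *
      ∏ r ∈ Finset.Icc 1 k, F (.inl ⟨k, j, r⟩) := by
  have hk' := Finset.mem_Icc.1 hk
  have hl : ∀ k' ∈ Finset.Icc 1 n, ∀ i ∈ Finset.Icc 1 k', ∀ r ∈ Finset.Icc 1 k',
      (k', i) ≠ (k, j) → F (.inl ⟨k', i, r⟩) = 1 := by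
    intro k' hk' i hi r hr h
    rw [Finset.mem_Icc] at hk'
    refine hF _ ?_ fun h' => h ?_
    · simp only [links, Finset.inl_mem_disjSum, Finset.mem_sigma, Finset.mem_product]
      exact ⟨Finset.mem_Icc.2 hk', hi, hr⟩
    · simp only [Link.oddEnd, Prod.mk.injEq] at h' ⊢
      omega
  have hr : ∀ k' ∈ Finset.Icc 1 (n - 1), ∀ i ∈ Finset.Icc 1 k', ∀ r ∈ Finset.Icc 1 (k' + 1),
      (k' + 1, r) ≠ (k, j) → F (.inr ⟨k', i, r⟩) = 1 := by
    intro k' hk' i hi r hr h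
    rw [Finset.mem_Icc] at hk'
    refine hF _ ?_ fun h' => h ?_
    · simp only [links, Finset.inr_mem_disjSum, Finset.mem_sigma, Finset.mem_product]
      exact ⟨Finset.mem_Icc.2 hk', hi, hr⟩
    · simp only [Link.oddEnd, Prod.mk.injEq] at h' ⊢
      omega
  rw [prod_links, mul_comm]
  congr 1
  · by_cases h1 : k = 1
    · subst h1
      simp only [le_refl, tsub_eq_zero_of_le, Finset.Icc_eq_empty_of_lt zero_lt_one,
        Finset.prod_empty]
      refine Finset.prod_eq_one fun k' hk' => Finset.prod_eq_one fun i hi =>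
        Finset.prod_eq_one fun r hr' => hr k' hk' i hi r hr' ?_
      rw [Finset.mem_Icc] at hk'
      intro h; simp only [Prod.mk.injEq] at h; omega
    · rw [Finset.prod_eq_single (k - 1)]
      · refine Finset.prod_congr rfl fun i hi => ?_
        rw [Finset.prod_eq_single j]
        · intro r hr' hrj
          refine hr (k - 1) ?_ i hi r hr' ?_
          · rw [Finset.mem_Icc]; omega
          · intro h; simp only [Prod.mk.injEq] at h; exact hrj h.2
        · intro h
          rw [show k - 1 + 1 = k by omega] at h
          exact absurd hj h
      · intro k' hk' hne
        refine Finset.prod_eq_one fun i hi => Finset.prod_eq_one fun r hr' =>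
          hr k' hk' i hi r hr' ?_
        intro h; simp only [Prod.mk.injEq] at h; omega
      · intro h
        exact absurd (by rw [Finset.mem_Icc]; omega) h
  · rw [Finset.prod_eq_single k]
    · rw [Finset.prod_eq_single j]
      · intro i hi hij
        refine Finset.prod_eq_one fun r hr' => hl k hk i hi r hr' ?_
        intro h; simp only [Prod.mk.injEq] at h; exact hij h.2
      · intro h; exact absurd hj h
    · intro k' hk' hne
      refine Finset.prod_eq_one fun i hi => Finset.prod_eq_one fun r hr' =>
        hl k' hk' i hi r hr' ?_
      intro h; simp only [Prod.mk.injEq] at h; exact hne h.1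
    · intro h; exact absurd hk h

theorem prod_links_evenEnd {M : Type*} [CommMonoid M] {n k j : ℕ}
    (hk : k ∈ Finset.Icc 1 (n - 1)) (hj : j ∈ Finset.Icc 1 k) (F : Link → M)
    (hF : ∀ t ∈ links n, t.evenEnd ≠ (2 * k, j) → F t = 1) :
    ∏ t ∈ links n, F t = (∏ r ∈ Finset.Icc 1 k, F (.inl ⟨k, r, j⟩)) *
      ∏ r ∈ Finset.Icc 1 (k + 1), F (.inr ⟨k, j, r⟩) := by
  have hkn : k ∈ Finset.Icc 1 n := by rw [Finset.mem_Icc] at hk ⊢; omega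
  have hl : ∀ k' ∈ Finset.Icc 1 n, ∀ i ∈ Finset.Icc 1 k', ∀ r ∈ Finset.Icc 1 k',
      (k', r) ≠ (k, j) → F (.inl ⟨k', i, r⟩) = 1 := by
    intro k' hk' i hi r hr h
    refine hF _ ?_ fun h' => h ?_
    · simp only [links, Finset.inl_mem_disjSum, Finset.mem_sigma, Finset.mem_product]
      exact ⟨hk', hi, hr⟩
    · simp only [Link.evenEnd, Prod.mk.injEq] at h' ⊢
      omega
  have hr : ∀ k' ∈ Finset.Icc 1 (n - 1), ∀ i ∈ Finset.Icc 1 k', ∀ r ∈ Finset.Icc 1 (k' + 1),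
      (k', i) ≠ (k, j) → F (.inr ⟨k', i, r⟩) = 1 := by
    intro k' hk' i hi r hr h
    refine hF _ ?_ fun h' => h ?_
    · simp only [links, Finset.inr_mem_disjSum, Finset.mem_sigma, Finset.mem_product]
      exact ⟨hk', hi, hr⟩
    · simp only [Link.evenEnd, Prod.mk.injEq] at h' ⊢
      omega
  rw [prod_links]
  congr 1
  · rw [Finset.prod_eq_single k]
    · refine Finset.prod_congr rfl fun i hi => ?_
      rw [Finset.prod_eq_single j]
      · intro r hr' hrj
        refine hl k hkn i hi r hr' ?_
        intro h; simp only [Prod.mk.injEq] at h; exact hrj h.2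
      · intro h; exact absurd hj h
    · intro k' hk' hne
      refine Finset.prod_eq_one fun i hi => Finset.prod_eq_one fun r hr' =>
        hl k' hk' i hi r hr' ?_
      intro h; simp only [Prod.mk.injEq] at h; exact hne h.1
    · intro h; exact absurd hkn h
  · rw [Finset.prod_eq_single k]
    · rw [Finset.prod_eq_single j]
      · intro i hi hij
        refine Finset.prod_eq_one fun r hr' => hr k hk i hi r hr' ?_
        intro h; simp only [Prod.mk.injEq] at h; exact hij h.2
      · intro h; exact absurd hj h
    · intro k' hk' hne
      refine Finset.prod_eq_one fun i hi => Finset.prod_eq_one fun r hr' =>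
        hr k' hk' i hi r hr' ?_
      intro h; simp only [Prod.mk.injEq] at h; exact hne h.1
    · intro h; exact absurd hk h

variable {n : ℕ}

/-- The linear form of a link, divided by `ic`. -/
def lform (c : ℝ) (p : ℕ → ℝ) (ε : ℕ → ℤˣ) (t : Link) (z : Idx n → ℂ) : ℂ :=
  (((ε t.level : ℤ) : ℂ) * entry p z t.oddEnd.1 t.oddEnd.2 +
    (t.sgn : ℂ) * entry p z t.evenEnd.1 t.evenEnd.2) / (I * c)

/-- The increment of `lform` under `tr`. -/
def lincr (ε : ℕ → ℤˣ) (t : Link) (m : Idx n → ℤ) : ℤ :=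
  (ε t.level : ℤ) * entZ m t.oddEnd + t.sgn * entZ m t.evenEnd

theorem poleForm_eq {c : ℝ} (hc : 0 < c) (p : ℕ → ℝ) (ε : ℕ → ℤˣ) (z : Idx n → ℂ) :
    poleForm n c p ε z = ∏ t ∈ links n,
      (I * c) ^ 2 * ((lform c p ε t z + 1 / 2) * (lform c p ε t z + 3 / 2)) := by
  have hc' : (c : ℂ) ≠ 0 := by exact_mod_cast hc.ne'
  have hI := I_ne_zero
  rw [prod_links, poleForm]
  simp only [lform, Link.level, Link.sgn, Link.oddEnd, Link.evenEnd]
  congr 1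
  · refine Finset.prod_congr rfl fun k _ => Finset.prod_congr rfl fun i _ =>
      Finset.prod_congr rfl fun j _ => ?_
    push_cast
    field_simp
  · refine Finset.prod_congr rfl fun k _ => Finset.prod_congr rfl fun i _ =>
      Finset.prod_congr rfl fun j _ => ?_
    push_cast
    field_simp
    ring

theorem lform_tr {c : ℝ} (hc : 0 < c) (p : ℕ → ℝ) (ε : ℕ → ℤˣ) (t : Link) (z : Idx n → ℂ)
    (m : Idx n → ℤ) : lform c p ε t (tr c z m) = lform c p ε t z + (lincr ε t m : ℂ) := by
  have hc' : (c : ℂ) ≠ 0 := by exact_mod_cast hc.ne'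
  have hI := I_ne_zero
  simp only [lform, lincr, entry_tr]
  push_cast
  field_simp
  ring

theorem conj_lform (c : ℝ) (p : ℕ → ℝ) (ε : ℕ → ℤˣ) (t : Link) (z : Idx n → ℂ) :
    conj (lform c p ε t z) = -lform c p ε t (cj z) := by
  simp only [lform, map_div₀, map_add, map_mul, conj_entry, conj_I, conj_ofReal, map_intCast]
  rw [neg_mul, div_neg]

theorem lincr_zero (ε : ℕ → ℤˣ) (t : Link) : lincr ε t (0 : Idx n → ℤ) = 0 := by
  have h : ∀ q, entZ (0 : Idx n → ℤ) q = 0 := by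
    intro q; unfold entZ; split_ifs <;> simp
  simp [lincr, h]

theorem lform_toC_re (c : ℝ) (p : ℕ → ℝ) (ε : ℕ → ℤˣ) (t : Link) (x : Idx n → ℝ) :
    (lform c p ε t (toC x)).re = 0 := by
  have h := congrArg re (conj_lform c p ε t (toC x))
  rw [cj_toC, conj_re, neg_re] at h
  linarith

theorem lform_pt {c : ℝ} (hc : 0 < c) (p : ℕ → ℝ) (ε : ℕ → ℤˣ) (t : Link) (x : Idx n → ℝ)
    (m : Idx n → ℤ) : lform c p ε t (pt c x m) = lform c p ε t (toC x) + (lincr ε t m : ℂ) :=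
  lform_tr hc p ε t _ m

theorem lform_pt_re {c : ℝ} (hc : 0 < c) (p : ℕ → ℝ) (ε : ℕ → ℤˣ) (t : Link) (x : Idx n → ℝ)
    (m : Idx n → ℤ) : (lform c p ε t (pt c x m)).re = lincr ε t m := by
  rw [lform_pt hc, add_re, lform_toC_re, zero_add, intCast_re]

/-- At a lattice point, the linear form of a link avoids the half-integers. -/
theorem lform_pt_ne {c : ℝ} (hc : 0 < c) (p : ℕ → ℝ) (ε : ℕ → ℤˣ) (t : Link) (x : Idx n → ℝ)
    (m : Idx n → ℤ) (a : ℤ) : lform c p ε t (pt c x m) + 1 / 2 + a ≠ 0 := by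
  intro h
  have h1 := congrArg re h
  rw [add_re, add_re, lform_pt_re hc] at h1
  norm_num at h1
  have h2 : (2 * (lincr ε t m + a) + 1 : ℤ) = 0 := by
    have : (2 * ((lincr ε t m : ℝ) + a) + 1) = 0 := by linarith
    exact_mod_cast this
  omega

theorem Gamma_ne_zero_pt {c : ℝ} (hc : 0 < c) (p : ℕ → ℝ) (ε : ℕ → ℤˣ) (t : Link)
    (x : Idx n → ℝ) (m : Idx n → ℤ) (a : ℤ) :
    Gamma (lform c p ε t (pt c x m) + 1 / 2 + a) ≠ 0 := by
  refine Gamma_ne_zero fun k h => lform_pt_ne hc p ε t x m (a + k) ?_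
  push_cast
  linear_combination h

theorem PolyFn.lform (c : ℝ) (p : ℕ → ℝ) (ε : ℕ → ℤˣ) (t : Link) :
    PolyFn fun z : Idx n → ℂ => lform c p ε t z := by
  simp only [SoToda.lform, div_eq_mul_inv]
  exact (((PolyFn.const _).mul (.entry _ _ _)).add ((PolyFn.const _).mul (.entry _ _ _))).mul
    (.const _)

/-- The product of the Gamma factors `Γ(w/(ic) + 1/2)` of a Whittaker vector. -/
def gauge (c : ℝ) (p : ℕ → ℝ) (ε : ℕ → ℤˣ) (z : Idx n → ℂ) : ℂ :=
  ∏ t ∈ links n, Gamma (lform c p ε t z + 1 / 2)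

theorem gauge_pt_ne_zero {c : ℝ} (hc : 0 < c) (p : ℕ → ℝ) (ε : ℕ → ℤˣ) (x : Idx n → ℝ)
    (m : Idx n → ℤ) : gauge c p ε (pt c x m) ≠ 0 := by
  refine Finset.prod_ne_zero_iff.2 fun t _ => ?_
  simpa using Gamma_ne_zero_pt hc p ε t x m 0

theorem poleForm_pt_ne_zero {c : ℝ} (hc : 0 < c) (p : ℕ → ℝ) (ε : ℕ → ℤˣ) (x : Idx n → ℝ)
    (m : Idx n → ℤ) : poleForm n c p ε (pt c x m) ≠ 0 := by
  have hc' : (c : ℂ) ≠ 0 := by exact_mod_cast hc.ne'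
  rw [poleForm_eq hc]
  refine Finset.prod_ne_zero_iff.2 fun t _ => ?_
  refine mul_ne_zero (pow_ne_zero 2 (mul_ne_zero I_ne_zero hc')) (mul_ne_zero ?_ ?_)
  · simpa using lform_pt_ne hc p ε t x m 0
  · have := lform_pt_ne hc p ε t x m 1
    intro h; apply this; push_cast; linear_combination h

/-- The linear factor by which a coefficient cancels the pole that the translation by `ic * m`
moves across the real locus. -/
def cancel (c : ℝ) (p : ℕ → ℝ) (ε : ℕ → ℤˣ) (m : Idx n → ℤ) (t : Link) (z : Idx n → ℂ) : ℂ :=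
  if lincr ε t m = -1 then lform c p ε t z - 1 / 2 else 1

/-- The integral arrays that move at most one end of every link, by at most one step. -/
def IsStep (m : Idx n → ℤ) : Prop :=
  (∀ q, |m q| ≤ 1) ∧ ∀ t ∈ links n, entZ m t.oddEnd = 0 ∨ entZ m t.evenEnd = 0

theorem abs_entZ_le {m : Idx n → ℤ} (hm : ∀ q, |m q| ≤ 1) (q : ℕ × ℕ) : |entZ m q| ≤ 1 := by
  unfold entZ; split_ifs
  · exact hm _
  · simp

theorem Link.sgn_cases (t : Link) : t.sgn = 1 ∨ t.sgn = -1 := by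
  cases t <;> simp [Link.sgn]

theorem unit_cases (u : ℤˣ) : (u : ℤ) = 1 ∨ (u : ℤ) = -1 := by
  rcases Int.units_eq_one_or u with h | h <;> simp [h]

theorem IsStep.abs_lincr_le {m : Idx n → ℤ} (hm : IsStep m) (ε : ℕ → ℤˣ) {t : Link}
    (ht : t ∈ links n) : |lincr ε t m| ≤ 1 := by
  have h1 := abs_le.1 (abs_entZ_le hm.1 t.oddEnd)
  have h2 := abs_le.1 (abs_entZ_le hm.1 t.evenEnd)
  unfold lincr
  rw [abs_le]
  rcases hm.2 t ht with h | h <;> rw [h] <;> rcases unit_cases (ε t.level) with h' | h' <;>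
    rcases t.sgn_cases with h'' | h'' <;> rw [h', h''] <;> constructor <;> omega

theorem cancel_mul_gauge {c : ℝ} (hc : 0 < c) (p : ℕ → ℝ) (ε : ℕ → ℤˣ) {m₀ : Idx n → ℤ}
    (hm₀ : IsStep m₀) (x : Idx n → ℝ) (m : Idx n → ℤ) :
    (∏ t ∈ links n, cancel c p ε m₀ t (pt c x m)) * gauge c p ε (pt c x (m + m₀)) =
      gauge c p ε (pt c x m) * ∏ t ∈ links n,
        if lincr ε t m₀ = 1 then lform c p ε t (pt c x m) + 1 / 2 else 1 := by
  rw [gauge, gauge, ← Finset.prod_mul_distrib, ← Finset.prod_mul_distrib]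
  refine Finset.prod_congr rfl fun t ht => ?_
  have h1 := abs_le.1 (hm₀.abs_lincr_le ε ht)
  rw [← tr_pt, lform_tr hc]
  have h0 := lform_pt_ne hc p ε t x m 0
  have h2 := lform_pt_ne hc p ε t x m (-1)
  unfold cancel
  rcases (by omega : lincr ε t m₀ = -1 ∨ lincr ε t m₀ = 0 ∨ lincr ε t m₀ = 1) with h | h | h
  · rw [if_pos h, if_neg (by omega), h]
    have e : lform c p ε t (pt c x m) + 1 / 2 =
      (lform c p ε t (pt c x m) + ((-1 : ℤ) : ℂ) + 1 / 2) + 1 := by push_cast; ring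
    have e2 : lform c p ε t (pt c x m) + ((-1 : ℤ) : ℂ) + 1 / 2 =
      lform c p ε t (pt c x m) - 1 / 2 := by push_cast; ring
    rw [e, Gamma_add_one _ (by intro h'; apply h2; linear_combination h'), e2, mul_one]
  · rw [if_neg (by omega), if_neg (by omega), h]
    push_cast; simp
  · rw [if_neg (by omega), if_pos h, h]
    have e : lform c p ε t (pt c x m) + ((1 : ℤ) : ℂ) + 1 / 2 =
      (lform c p ε t (pt c x m) + 1 / 2) + 1 := by push_cast; ring
    rw [e, Gamma_add_one _ (by intro h'; apply h0; simpa using h')]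
    ring

/-! ### Numerators of the coefficients -/

theorem entZ_single (q : Idx n) (σ : ℤ) (q' : ℕ × ℕ) :
    entZ (Pi.single q σ) q' = if q' = q.1 then σ else 0 := by
  unfold entZ
  split_ifs with h1 h2 h2
  · subst h2; simp
  · rw [Pi.single_eq_of_ne]; exact fun h => h2 (by rw [← h])
  · exact absurd (h2 ▸ q.2) h1
  · rfl

theorem Link.oddEnd_mod (t : Link) (ht : t ∈ links n) : t.oddEnd.1 % 2 = 1 := by
  rcases t with t | t
  · simp only [links, Finset.inl_mem_disjSum, Finset.mem_sigma, Finset.mem_Icc] at ht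
    simp only [Link.oddEnd]; omega
  · simp only [Link.oddEnd]; omega

theorem Link.evenEnd_mod (t : Link) : t.evenEnd.1 % 2 = 0 := by
  rcases t with t | t <;> simp [Link.evenEnd]

theorem isStep_single (q : Idx n) {σ : ℤ} (hσ : |σ| ≤ 1) : IsStep (Pi.single q σ) := by
  refine ⟨fun q' => ?_, fun t ht => ?_⟩
  · by_cases h : q' = q
    · subst h; simpa using hσ
    · simp [h]
  · rw [entZ_single, entZ_single]
    by_contra! h
    have h1 : t.oddEnd = q.1 := by by_contra h'; simp [h'] at h
    have h2 : t.evenEnd = q.1 := by by_contra h'; simp [h'] at h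
    have h3 := t.oddEnd_mod ht
    have h4 := t.evenEnd_mod
    rw [h1] at h3; rw [h2] at h4; omega

theorem isStep_zero : IsStep (0 : Idx n → ℤ) := by
  have h : ∀ q, entZ (0 : Idx n → ℤ) q = 0 := by
    intro q; unfold entZ; split_ifs <;> simp
  exact ⟨by simp, fun t _ => Or.inl (h _)⟩

theorem cancel_mul_cancel_of_oddEnd {c : ℝ} (hc : 0 < c) (p : ℕ → ℝ) (ε : ℕ → ℤˣ) (q : Idx n)
    {σ : ℤ} (hσ : σ = 1 ∨ σ = -1) {t : Link} (ht : t ∈ links n) (h : t.oddEnd = q.1)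
    (z : Idx n → ℂ) :
    cancel c p ε (Pi.single q σ) t z * cancel c p (-ε) (Pi.single q σ) t z =
      -σ / (I * c) * (entry p z q.1.1 q.1.2 -
        σ * t.sgn * entry p z t.evenEnd.1 t.evenEnd.2 + σ * (I * c / 2)) := by
  have hc' : (c : ℂ) ≠ 0 := by exact_mod_cast hc.ne'
  have hI := I_ne_zero
  have h2 : t.evenEnd ≠ q.1 := by
    intro h2
    have h3 := t.oddEnd_mod ht
    have h4 := t.evenEnd_mod
    rw [h] at h3; rw [h2] at h4; omega
  simp only [cancel, lincr, entZ_single, h, h2, if_true, if_false, mul_zero, add_zero, lform,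
    Pi.neg_apply, Units.val_neg]
  rcases unit_cases (ε t.level) with h' | h' <;> rcases hσ with rfl | rfl <;> rw [h'] <;>
    norm_num [-inv_I, -mul_inv_rev] <;> field_simp <;> ring

theorem cancel_mul_cancel_of_evenEnd {c : ℝ} (hc : 0 < c) (p : ℕ → ℝ) (ε : ℕ → ℤˣ) (q : Idx n)
    {σ : ℤ} (hσ : σ = 1 ∨ σ = -1) {t : Link} (ht : t ∈ links n) (h : t.evenEnd = q.1)
    (z : Idx n → ℂ) :
    cancel c p ε (Pi.single q σ) t z * cancel c p (-ε) (Pi.single q σ) t z =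
      if t.sgn = -σ then 1 / (I * c) ^ 2 * ((entry p z q.1.1 q.1.2 + σ * (I * c / 2)) ^ 2 -
        entry p z t.oddEnd.1 t.oddEnd.2 ^ 2) else 1 := by
  have hc' : (c : ℂ) ≠ 0 := by exact_mod_cast hc.ne'
  have hI := I_ne_zero
  have h2 : t.oddEnd ≠ q.1 := by
    intro h2
    have h3 := t.oddEnd_mod ht
    have h4 := t.evenEnd_mod
    rw [h2] at h3; rw [h] at h4; omega
  simp only [cancel, lincr, entZ_single, h, h2, if_true, if_false, mul_zero, zero_add, lform,
    Pi.neg_apply, Units.val_neg]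
  rcases unit_cases (ε t.level) with h' | h' <;> rcases hσ with rfl | rfl <;> rw [h'] <;>
    rcases t.sgn_cases with h'' | h'' <;> rw [h''] <;> norm_num <;> field_simp <;> ring

theorem cancel_eq_one (c : ℝ) (p : ℕ → ℝ) (ε : ℕ → ℤˣ) (q : Idx n) (σ : ℤ) {t : Link}
    (h1 : t.oddEnd ≠ q.1) (h2 : t.evenEnd ≠ q.1) (z : Idx n → ℂ) :
    cancel c p ε (Pi.single q σ) t z = 1 := by
  simp [cancel, lincr, entZ_single, h1, h2]

/-- The numerator of the coefficients of `opOdd`. -/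
def numOdd (c : ℝ) (p : ℕ → ℝ) (k j : ℕ) (σ : ℤ) (z : Idx n → ℂ) : ℂ :=
  (∏ r ∈ Finset.Icc 1 (k - 1),
    (entry p z (2 * k - 1) j + σ * entry p z (2 * k - 2) r + σ * (I * c / 2))) *
  ∏ r ∈ Finset.Icc 1 k, (entry p z (2 * k - 1) j - σ * entry p z (2 * k) r + σ * (I * c / 2))

/-- The numerator of the coefficients of `iOpEven`. -/
def numEven (c : ℝ) (p : ℕ → ℝ) (k j : ℕ) (σ : ℤ) (z : Idx n → ℂ) : ℂ :=
  if σ = 1 then ∏ r ∈ Finset.Icc 1 (k + 1),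
    ((entry p z (2 * k) j + σ * (I * c / 2)) ^ 2 - entry p z (2 * k + 1) r ^ 2)
  else ∏ r ∈ Finset.Icc 1 k,
    ((entry p z (2 * k) j + σ * (I * c / 2)) ^ 2 - entry p z (2 * k - 1) r ^ 2)

theorem numOdd_eq {c : ℝ} (hc : 0 < c) (p : ℕ → ℝ) (ε : ℕ → ℤˣ) {k j : ℕ}
    (hk : k ∈ Finset.Icc 1 n) (hj : j ∈ Finset.Icc 1 k) (h : (2 * k - 1, j) ∈ positions n)
    {σ : ℤ} (hσ : σ = 1 ∨ σ = -1) :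
    ∃ K : ℂ, ∀ z : Idx n → ℂ, numOdd c p k j σ z = K * ∏ t ∈ links n,
      (cancel c p ε (Pi.single ⟨_, h⟩ σ) t z * cancel c p (-ε) (Pi.single ⟨_, h⟩ σ) t z) := by
  have hc' : (c : ℂ) ≠ 0 := by exact_mod_cast hc.ne'
  have hI := I_ne_zero
  have hσ' : (σ : ℂ) ≠ 0 := by rcases hσ with rfl | rfl <;> norm_num
  have hk' := Finset.mem_Icc.1 hk
  have hj' := Finset.mem_Icc.1 hj
  refine ⟨(-σ / (I * c))⁻¹ ^ (k - 1) * (-σ / (I * c))⁻¹ ^ k, fun z => ?_⟩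
  rw [prod_links_oddEnd hk hj]
  · have e1 : ∀ r ∈ Finset.Icc 1 (k - 1), (.inr ⟨k - 1, r, j⟩ : Link) ∈ links n := by
      intro r hr
      rw [Finset.mem_Icc] at hr
      simp only [links, Finset.inr_mem_disjSum, Finset.mem_sigma, Finset.mem_product,
        Finset.mem_Icc]
      omega
    have e2 : ∀ r ∈ Finset.Icc 1 k, (.inl ⟨k, j, r⟩ : Link) ∈ links n := by
      intro r hr
      simp only [links, Finset.inl_mem_disjSum, Finset.mem_sigma, Finset.mem_product]
      exact ⟨hk, hj, hr⟩
    have f1 : ∀ r ∈ Finset.Icc 1 (k - 1), _ := fun r hr =>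
      cancel_mul_cancel_of_oddEnd hc p ε ⟨_, h⟩ hσ (e1 r hr)
        (by
          rw [Finset.mem_Icc] at hr
          change (2 * (k - 1) + 1, j) = (2 * k - 1, j)
          rw [show 2 * (k - 1) + 1 = 2 * k - 1 by omega]) z
    have f2 : ∀ r ∈ Finset.Icc 1 k, _ := fun r hr =>
      cancel_mul_cancel_of_oddEnd hc p ε ⟨_, h⟩ hσ (e2 r hr) rfl z
    rw [Finset.prod_congr rfl f1, Finset.prod_congr rfl f2, Finset.prod_mul_distrib,
      Finset.prod_mul_distrib, Finset.prod_const, Finset.prod_const, Nat.card_Icc, Nat.card_Icc,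
      numOdd]
    simp only [Link.evenEnd, Link.sgn]
    have g1 : (-σ / (I * c) : ℂ) ≠ 0 :=
      div_ne_zero (neg_ne_zero.2 hσ') (mul_ne_zero hI hc')
    have e3 : 2 * (k - 1) = 2 * k - 2 := by omega
    have g2 := pow_ne_zero (k - 1) g1
    have g3 := pow_ne_zero k g1
    simp only [e3, Nat.add_sub_cancel, inv_pow]
    push_cast
    simp only [mul_neg, mul_one, neg_mul, sub_neg_eq_add]
    generalize (-(σ : ℂ) / (I * c)) ^ (k - 1) = A at g2 ⊢
    generalize (-(σ : ℂ) / (I * c)) ^ k = B at g3 ⊢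
    rw [mul_mul_mul_comm, inv_mul_cancel_left₀ g2, inv_mul_cancel_left₀ g3]
  · intro t ht ht'
    have : t.evenEnd ≠ (2 * k - 1, j) := by
      intro h'; have := t.evenEnd_mod; rw [h'] at this; simp only at this; omega
    rw [cancel_eq_one _ _ _ _ _ ht' this, cancel_eq_one _ _ _ _ _ ht' this, mul_one]

theorem numEven_eq {c : ℝ} (hc : 0 < c) (p : ℕ → ℝ) (ε : ℕ → ℤˣ) {k j : ℕ}
    (hk : k ∈ Finset.Icc 1 (n - 1)) (hj : j ∈ Finset.Icc 1 k) (h : (2 * k, j) ∈ positions n)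
    {σ : ℤ} (hσ : σ = 1 ∨ σ = -1) :
    ∃ K : ℂ, ∀ z : Idx n → ℂ, numEven c p k j σ z = K * ∏ t ∈ links n,
      (cancel c p ε (Pi.single ⟨_, h⟩ σ) t z * cancel c p (-ε) (Pi.single ⟨_, h⟩ σ) t z) := by
  have hc' : (c : ℂ) ≠ 0 := by exact_mod_cast hc.ne'
  have hI := I_ne_zero
  have hk' := Finset.mem_Icc.1 hk
  have hj' := Finset.mem_Icc.1 hj
  refine ⟨((I * c) ^ 2) ^ (if σ = 1 then k + 1 else k), fun z => ?_⟩
  rw [prod_links_evenEnd hk hj]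
  · have e1 : ∀ r ∈ Finset.Icc 1 k, (.inl ⟨k, r, j⟩ : Link) ∈ links n := by
      intro r hr
      rw [Finset.mem_Icc] at hr
      simp only [links, Finset.inl_mem_disjSum, Finset.mem_sigma, Finset.mem_product,
        Finset.mem_Icc]
      omega
    have e2 : ∀ r ∈ Finset.Icc 1 (k + 1), (.inr ⟨k, j, r⟩ : Link) ∈ links n := by
      intro r hr
      simp only [links, Finset.inr_mem_disjSum, Finset.mem_sigma, Finset.mem_product]
      exact ⟨hk, hj, hr⟩
    have f1 : ∀ r ∈ Finset.Icc 1 k, _ := fun r hr =>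
      cancel_mul_cancel_of_evenEnd hc p ε ⟨_, h⟩ hσ (e1 r hr) rfl z
    have f2 : ∀ r ∈ Finset.Icc 1 (k + 1), _ := fun r hr =>
      cancel_mul_cancel_of_evenEnd hc p ε ⟨_, h⟩ hσ (e2 r hr) rfl z
    have g1 : ((I * c) ^ 2 : ℂ) ≠ 0 := pow_ne_zero 2 (mul_ne_zero hI hc')
    rw [Finset.prod_congr rfl f1, Finset.prod_congr rfl f2, numEven]
    simp only [Link.oddEnd, Link.sgn]
    rcases hσ with rfl | rfl
    · have g2 := pow_ne_zero (k + 1) g1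
      norm_num [Finset.prod_mul_distrib]
      generalize ((I * c) ^ 2 : ℂ) ^ (k + 1) = A at g2 ⊢
      field_simp
    · have g2 := pow_ne_zero k g1
      norm_num [Finset.prod_mul_distrib]
      generalize ((I * c) ^ 2 : ℂ) ^ k = A at g2 ⊢
      field_simp
  · intro t ht ht'
    have : t.oddEnd ≠ (2 * k, j) := by
      intro h'; have := t.oddEnd_mod ht; rw [h'] at this; simp only at this; omega
    rw [cancel_eq_one _ _ _ _ _ this ht', cancel_eq_one _ _ _ _ _ this ht', mul_one]

end SoToda

end

noncomputable section

namespace SoToda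

/-! ### The factors of the density and of the denominators -/

theorem gammaE_eq_gammaS (s : ℂ) : gammaE s = -s ^ 2 * gammaS s := by
  rw [gammaE_eq, mul_div_assoc, ← gammaS_mul]; ring

theorem sin_pi_add (s : ℂ) {τ : ℤ} (hτ : τ = 1 ∨ τ = -1) :
    sin (Real.pi * (s + τ)) = -sin (Real.pi * s) := by
  rcases hτ with rfl | rfl
  · push_cast; rw [mul_add, mul_one, sin_add_pi]
  · push_cast; rw [mul_add, mul_neg, mul_one, ← sub_eq_add_neg, sin_sub_pi]

theorem gammaS_add_mul (s : ℂ) {τ : ℤ} (hτ : τ = 1 ∨ τ = -1) :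
    gammaS (s + τ) * (s + τ) = -(gammaS s * s) := by
  rw [gammaS_mul, gammaS_mul, sin_pi_add s hτ, neg_div]

theorem gammaS_neg (s : ℂ) : gammaS (-s) = gammaS s := by
  unfold gammaS; rw [← sub_eq_add_neg, sub_neg_eq_add, mul_comm]

/-- The factor of the density at level `l` that contains one entry. -/
def singleM (c : ℝ) (l : ℕ) (x : ℂ) : ℂ :=
  if l % 2 = 0 then exp (Real.pi / c * x) * gammaE (2 * x / (I * c)) else 1

/-- The factor of the density at level `l` that contains two entries. -/
def pairM (c : ℝ) (l : ℕ) (x y : ℂ) : ℂ :=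
  if l % 2 = 0 then gammaE ((x - y) / (I * c)) * gammaE ((x + y) / (I * c))
  else gammaE ((x - y) / (I * c)) * gammaS ((x + y) / (I * c))

/-- A common multiple of the factors of the denominators that contain one entry. -/
def singleD (c : ℝ) (l : ℕ) (x : ℂ) : ℂ :=
  if l % 2 = 0 then x * (x ^ 2 + c ^ 2 / 4) else 1

/-- A common multiple of the factors of the denominators that contain two entries. -/
def pairD (c : ℝ) (l : ℕ) (x y : ℂ) : ℂ :=
  if l % 2 = 0 then ((x - y) * (x + y)) ^ 2 else (x - y) ^ 2 * ((x + y) ^ 2 + c ^ 2)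

/-- The factor of a denominator that contains only the translated entry. -/
def singleDen (c : ℝ) (l : ℕ) (τ : ℤ) (x : ℂ) : ℂ :=
  if l % 2 = 0 then x * (x + τ * (I * c / 2)) else 1

/-- The factor of a denominator that contains the translated entry `x` and `y`. -/
def pairDen (c : ℝ) (l : ℕ) (τ : ℤ) (x y : ℂ) : ℂ :=
  if l % 2 = 0 then (x - y) * (x + y) else (x - y) * (x + y + τ * (I * c))

/-- The entire function `singleM / singleDen`. -/
def singleX (c : ℝ) (l : ℕ) (τ : ℤ) (x : ℂ) : ℂ :=
  if l % 2 = 0 then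
    4 / (I * c) ^ 2 * (exp (Real.pi / c * x) * gammaS (2 * x / (I * c) + τ)) else 1

/-- The entire function `pairM / pairDen`. -/
def pairX (c : ℝ) (l : ℕ) (τ : ℤ) (x y : ℂ) : ℂ :=
  if l % 2 = 0 then
    1 / ((I * c) ^ 2 * Real.pi ^ 2) *
      (sin (Real.pi * ((x - y) / (I * c))) * sin (Real.pi * ((x + y) / (I * c))))
  else
    -(τ / ((I * c) ^ 2 * Real.pi)) * (sin (Real.pi * ((x - y) / (I * c))) *
      (gammaS ((x + y) / (I * c) + τ) + gammaS ((x + y) / (I * c))))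


theorem singleM_eq {c : ℝ} (hc : 0 < c) (l : ℕ) {τ : ℤ} (hτ : τ = 1 ∨ τ = -1) (x : ℂ) :
    singleM c l x = singleX c l τ x * singleDen c l τ x := by
  have hc' : (c : ℂ) ≠ 0 := by exact_mod_cast hc.ne'
  have hI := I_ne_zero
  unfold singleM singleX singleDen
  split_ifs
  · have h := gammaS_add_mul (2 * x / (I * c)) hτ
    rw [gammaE_eq_gammaS]
    have e : x * (x + τ * (I * c / 2)) =
        (I * c) ^ 2 / 4 * (2 * x / (I * c)) * (2 * x / (I * c) + τ) := by
      field_simp; ring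
    rw [e]
    generalize 2 * x / (I * c) = s at h ⊢
    have e2 : 4 / (I * c) ^ 2 * (exp (Real.pi / c * x) * gammaS (s + τ)) *
        ((I * c) ^ 2 / 4 * s * (s + τ)) =
        exp (Real.pi / c * x) * s * (gammaS (s + τ) * (s + τ)) := by
      field_simp
    rw [e2, h]; ring
  · simp

theorem pairM_eq {c : ℝ} (hc : 0 < c) (l : ℕ) {τ : ℤ} (hτ : τ = 1 ∨ τ = -1) (x y : ℂ) :
    pairM c l x y = pairX c l τ x y * pairDen c l τ x y := by
  have hc' : (c : ℂ) ≠ 0 := by exact_mod_cast hc.ne'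
  have hI := I_ne_zero
  have hpi : (Real.pi : ℂ) ≠ 0 := by exact_mod_cast Real.pi_ne_zero
  have hτ2 : (τ : ℂ) * τ = 1 := by rcases hτ with rfl | rfl <;> norm_num
  have e1 : x - y = (I * c) * ((x - y) / (I * c)) := by field_simp
  have e2 : x + y = (I * c) * ((x + y) / (I * c)) := by field_simp
  have e3 : x + y + τ * (I * c) = (I * c) * ((x + y) / (I * c) + τ) := by field_simp
  have h := gammaS_add_mul ((x + y) / (I * c)) hτ
  unfold pairM pairX pairDen
  split_ifs
  · rw [gammaE_eq, gammaE_eq]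
    generalize sin (Real.pi * ((x - y) / (I * c))) = A
    generalize sin (Real.pi * ((x + y) / (I * c))) = B
    field_simp
  · rw [gammaE_eq, e3, show (x - y) * (I * c * ((x + y) / (I * c) + τ)) =
      (I * c * ((x - y) / (I * c))) * (I * c * ((x + y) / (I * c) + τ)) by rw [← e1]]
    generalize (x - y) / (I * c) = s
    generalize (x + y) / (I * c) = t at h ⊢
    generalize sin (Real.pi * s) = A
    have e4 : -(τ / ((I * c) ^ 2 * Real.pi)) * (A * (gammaS (t + τ) + gammaS t)) *
        (I * c * s * (I * c * (t + τ))) =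
        -(A * s / Real.pi) * τ * (gammaS (t + τ) * (t + τ) + gammaS t * (t + τ)) := by
      field_simp
    rw [e4, h]
    linear_combination (A * s / Real.pi * gammaS t) * hτ2

theorem singleX_shift {c : ℝ} (hc : 0 < c) (l : ℕ) {τ : ℤ} (x : ℂ) (hτ : τ = 1 ∨ τ = -1) :
    singleX c l τ (x - τ * (I * c)) =
      (if l % 2 = 0 then -1 else 1) * singleX c l (-τ) x := by
  have hc' : (c : ℂ) ≠ 0 := by exact_mod_cast hc.ne'
  have hI := I_ne_zero
  unfold singleX
  split_ifs
  · have e1 : 2 * (x - τ * (I * c)) / (I * c) + τ = 2 * x / (I * c) + ((-τ : ℤ) : ℂ) := by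
      push_cast; field_simp; ring
    have e2 : exp (Real.pi / c * (x - τ * (I * c))) = -exp (Real.pi / c * x) := by
      have : Real.pi / c * (x - τ * (I * c)) = Real.pi / c * x - τ * (Real.pi * I) := by
        field_simp
      rw [this]
      rcases hτ with rfl | rfl
      · push_cast; rw [one_mul, exp_sub_pi_mul_I]
      · push_cast; rw [neg_one_mul, sub_neg_eq_add, exp_add_pi_mul_I]
    rw [e1, e2]; ring
  · simp

theorem pairX_shift {c : ℝ} (hc : 0 < c) (l : ℕ) {τ : ℤ} (x y : ℂ) (hτ : τ = 1 ∨ τ = -1) :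
    pairX c l τ (x - τ * (I * c)) y = pairX c l (-τ) x y := by
  have hc' : (c : ℂ) ≠ 0 := by exact_mod_cast hc.ne'
  have hI := I_ne_zero
  have hτ' : -τ = 1 ∨ -τ = -1 := by omega
  have e1 : (x - τ * (I * c) - y) / (I * c) = (x - y) / (I * c) + ((-τ : ℤ) : ℂ) := by
    push_cast; field_simp; ring
  have e2 : (x - τ * (I * c) + y) / (I * c) = (x + y) / (I * c) + ((-τ : ℤ) : ℂ) := by
    push_cast; field_simp; ring
  unfold pairX
  rw [e1, e2, sin_pi_add _ hτ', sin_pi_add _ hτ']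
  split_ifs
  · ring
  · have : (x + y) / (I * c) + ((-τ : ℤ) : ℂ) + τ = (x + y) / (I * c) := by push_cast; ring
    rw [this]; push_cast; ring

theorem pairM_eq_gammaS {c : ℝ} (hc : 0 < c) (l : ℕ) (x y : ℂ) : pairM c l x y =
    (if l % 2 = 0 then ((x - y) * (x + y)) ^ 2 / (I * c) ^ 4 else -(x - y) ^ 2 / (I * c) ^ 2) *
      (gammaS ((x - y) / (I * c)) * gammaS ((x + y) / (I * c))) := by
  have hc' : (c : ℂ) ≠ 0 := by exact_mod_cast hc.ne'
  have hI := I_ne_zero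
  unfold pairM
  split_ifs
  · rw [gammaE_eq_gammaS, gammaE_eq_gammaS]; field_simp
  · rw [gammaE_eq_gammaS]; field_simp

theorem singleM_eq_gammaS {c : ℝ} (hc : 0 < c) (l : ℕ) (x : ℂ) : singleM c l x =
    if l % 2 = 0 then -(4 * x ^ 2) / (I * c) ^ 2 *
      (exp (Real.pi / c * x) * gammaS (2 * x / (I * c))) else 1 := by
  have hc' : (c : ℂ) ≠ 0 := by exact_mod_cast hc.ne'
  have hI := I_ne_zero
  unfold singleM
  split_ifs
  · rw [gammaE_eq_gammaS]; field_simp; ring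
  · rfl

theorem pairM_comm {c : ℝ} (hc : 0 < c) (l : ℕ) (x y : ℂ) : pairM c l x y = pairM c l y x := by
  have e : (x - y) / (I * c) = -((y - x) / (I * c)) := by rw [← neg_div]; ring
  rw [pairM_eq_gammaS hc, pairM_eq_gammaS hc l y x, add_comm y x, e, gammaS_neg]
  split_ifs <;> ring

theorem pairD_comm {c : ℝ} (l : ℕ) (x y : ℂ) : pairD c l x y = pairD c l y x := by
  unfold pairD; split_ifs <;> ring

theorem singleD_eq {c : ℝ} (l : ℕ) {τ : ℤ} (hτ : τ = 1 ∨ τ = -1) (x : ℂ) :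
    singleD c l x =
      singleDen c l τ x * (if l % 2 = 0 then x - τ * (I * c / 2) else 1) := by
  have hτ2 : (τ : ℂ) ^ 2 = 1 := by rcases hτ with rfl | rfl <;> norm_num
  unfold singleD singleDen
  split_ifs
  · linear_combination (x * I ^ 2 * c ^ 2 / 4) * hτ2 + (x * c ^ 2 / 4) * I_sq
  · simp

theorem pairD_eq {c : ℝ} (l : ℕ) {τ : ℤ} (hτ : τ = 1 ∨ τ = -1) (x y : ℂ) :
    pairD c l x y = pairDen c l τ x y *
      (if l % 2 = 0 then (x - y) * (x + y) else (x - y) * (x + y - τ * (I * c))) := by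
  have hτ2 : (τ : ℂ) ^ 2 = 1 := by rcases hτ with rfl | rfl <;> norm_num
  unfold pairD pairDen
  split_ifs
  · ring
  · linear_combination ((x - y) ^ 2 * I ^ 2 * c ^ 2) * hτ2 + ((x - y) ^ 2 * c ^ 2) * I_sq

theorem im_div_I_mul {c : ℝ} (hc : 0 < c) (x : ℂ) : (x / (I * c)).im = -(x.re / c) := by
  have hc' : (c : ℂ) ≠ 0 := by exact_mod_cast hc.ne'
  have : x / (I * c) = -(x / c * I) := by
    have hI := I_ne_zero
    field_simp
    rw [I_sq]
    ring
  rw [this]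
  simp

theorem norm_sin_div_le {c : ℝ} (hc : 0 < c) (x : ℂ) :
    ‖sin (Real.pi * (x / (I * c)))‖ ≤ Real.exp (Real.pi / c * |x.re|) := by
  refine (norm_sin_pi_le _).trans_eq ?_
  rw [im_div_I_mul hc, abs_neg, abs_div, abs_of_pos hc]
  congr 1; ring

theorem exists_norm_gammaS_div_le {c : ℝ} (hc : 0 < c) : ∃ C : ℝ, 0 < C ∧ ∀ (x : ℂ) (τ : ℝ),
    ‖gammaS (x / (I * c) + τ)‖ ≤ C * Real.exp (Real.pi / c * |x.re|) := by
  obtain ⟨C, hC, h⟩ := exists_norm_gammaS_le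
  refine ⟨C, hC, fun x τ => (h _).trans_eq ?_⟩
  rw [add_im, ofReal_im, add_zero, im_div_I_mul hc, abs_neg, abs_div, abs_of_pos hc]
  congr 2; ring

theorem exists_norm_pairX_le {c : ℝ} (hc : 0 < c) (l : ℕ) (τ : ℤ) : ∃ C : ℝ, ∀ x y : ℂ,
    ‖pairX c l τ x y‖ ≤
      C * Real.exp (Real.pi / c * (|x.re - y.re| + |x.re + y.re|)) := by
  obtain ⟨C, hC, h⟩ := exists_norm_gammaS_div_le hc
  unfold pairX
  split_ifs
  · refine ⟨‖(1 / ((I * c) ^ 2 * Real.pi ^ 2) : ℂ)‖, fun x y => ?_⟩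
    rw [norm_mul, mul_add, Real.exp_add, norm_mul]
    have h1 := norm_sin_div_le hc (x - y)
    have h2 := norm_sin_div_le hc (x + y)
    rw [sub_re] at h1; rw [add_re] at h2
    gcongr
  · refine ⟨‖(-(τ / ((I * c) ^ 2 * Real.pi)) : ℂ)‖ * (C + C), fun x y => ?_⟩
    rw [norm_mul, mul_add (Real.pi / c), Real.exp_add, norm_mul, mul_assoc]
    have h1 := norm_sin_div_le hc (x - y)
    have h2 := h (x + y) τ
    have h3 := h (x + y) 0
    rw [sub_re] at h1; rw [add_re] at h2 h3
    rw [ofReal_zero, add_zero] at h3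
    have h4 : ‖gammaS ((x + y) / (I * c) + τ) + gammaS ((x + y) / (I * c))‖ ≤
        (C + C) * Real.exp (Real.pi / c * |x.re + y.re|) := by
      refine (norm_add_le _ _).trans ?_
      rw [add_mul]
      refine add_le_add ?_ h3
      simpa using h2
    calc _ ≤ ‖(-(τ / ((I * c) ^ 2 * Real.pi)) : ℂ)‖ *
          (Real.exp (Real.pi / c * |x.re - y.re|) *
            ((C + C) * Real.exp (Real.pi / c * |x.re + y.re|))) := by gcongr
      _ = _ := by ring

theorem norm_exp_pi_div (c : ℝ) (x : ℂ) : ‖exp (Real.pi / c * x)‖ = Real.exp (Real.pi / c * x.re) := by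
  rw [norm_exp]
  congr 1
  rw [← ofReal_div, re_ofReal_mul]

theorem exists_norm_exp_gammaS_le {c : ℝ} (hc : 0 < c) : ∃ C : ℝ, 0 < C ∧ ∀ (x : ℂ) (τ : ℝ),
    ‖exp (Real.pi / c * x) * gammaS (2 * x / (I * c) + τ)‖ ≤
      C * Real.exp (Real.pi / c * (x.re + 2 * |x.re|)) := by
  obtain ⟨C, hC, h⟩ := exists_norm_gammaS_div_le hc
  refine ⟨C, hC, fun x τ => ?_⟩
  have h1 := h (2 * x) τ
  have h2 : |(2 * x).re| = 2 * |x.re| := by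
    rw [show (2 * x).re = 2 * x.re by simp, abs_mul]; simp
  rw [h2] at h1
  rw [norm_mul, norm_exp_pi_div c, mul_add (Real.pi / c), Real.exp_add]
  calc _ ≤ Real.exp (Real.pi / c * x.re) * (C * Real.exp (Real.pi / c * (2 * |x.re|))) := by
        gcongr
    _ = _ := by ring

theorem exists_norm_singleX_le {c : ℝ} (hc : 0 < c) (l : ℕ) (τ : ℤ) : ∃ C : ℝ, ∀ x : ℂ,
    ‖singleX c l τ x‖ ≤
      C * Real.exp (Real.pi / c * (if l % 2 = 0 then x.re + 2 * |x.re| else 0)) := by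
  obtain ⟨C, hC, h⟩ := exists_norm_exp_gammaS_le hc
  unfold singleX
  split_ifs
  · refine ⟨‖(4 / (I * c) ^ 2 : ℂ)‖ * C, fun x => ?_⟩
    rw [norm_mul, mul_assoc]
    have := h x τ
    gcongr
    simpa using this
  · exact ⟨1, fun x => by simp⟩

theorem exists_norm_gammaS_pair_le {c : ℝ} (hc : 0 < c) : ∃ C : ℝ, 0 < C ∧ ∀ x y : ℂ,
    ‖gammaS ((x - y) / (I * c)) * gammaS ((x + y) / (I * c))‖ ≤
      C * Real.exp (Real.pi / c * (|x.re - y.re| + |x.re + y.re|)) := by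
  obtain ⟨C, hC, h⟩ := exists_norm_gammaS_div_le hc
  refine ⟨C * C, by positivity, fun x y => ?_⟩
  have h2 := h (x - y) 0
  have h3 := h (x + y) 0
  rw [sub_re, ofReal_zero, add_zero] at h2
  rw [add_re, ofReal_zero, add_zero] at h3
  rw [norm_mul, mul_add, Real.exp_add]
  calc _ ≤ (C * Real.exp (Real.pi / c * |x.re - y.re|)) *
        (C * Real.exp (Real.pi / c * |x.re + y.re|)) := by gcongr
    _ = _ := by ring

theorem exists_norm_pairM_div_le {c : ℝ} (hc : 0 < c) (l : ℕ) : ∃ C : ℝ, ∀ x y : ℂ, x.im = 0 → y.im = 0 →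
    ‖pairM c l x y / pairD c l x y‖ ≤
      C * Real.exp (Real.pi / c * (|x.re - y.re| + |x.re + y.re|)) := by
  obtain ⟨C, hC, h⟩ := exists_norm_gammaS_pair_le hc
  have hc' : (c : ℂ) ≠ 0 := by exact_mod_cast hc.ne'
  have key : ∃ B : ℝ, 0 ≤ B ∧ ∀ x y : ℂ, x.im = 0 → y.im = 0 →
      ‖(if l % 2 = 0 then ((x - y) * (x + y)) ^ 2 / (I * c) ^ 4
        else -(x - y) ^ 2 / (I * c) ^ 2) / pairD c l x y‖ ≤ B := by
    unfold pairD
    split_ifs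
    · refine ⟨1 / c ^ 4, by positivity, fun x y _ _ => ?_⟩
      by_cases h0 : ((x - y) * (x + y)) ^ 2 = 0
      · rw [h0]; simp; positivity
      · rw [div_div_cancel_left' h0]
        simp [abs_of_pos hc]
    · refine ⟨1 / c ^ 4, by positivity, fun x y hx hy => ?_⟩
      have hx' : x = (x.re : ℂ) := Complex.ext (by simp) (by simp [hx])
      have hy' : y = (y.re : ℂ) := Complex.ext (by simp) (by simp [hy])
      have e : (x + y) ^ 2 + (c : ℂ) ^ 2 = (((x.re + y.re) ^ 2 + c ^ 2 : ℝ) : ℂ) := by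
        rw [hx', hy']; push_cast; simp
      by_cases h0 : (x - y) ^ 2 = 0
      · rw [h0]; simp; positivity
      · rw [div_div, neg_div, norm_neg, norm_div, norm_mul, norm_mul, e, Complex.norm_real]
        have h0' : 0 < ‖(x - y) ^ 2‖ := norm_pos_iff.2 h0
        have h1 : ‖(I * (c : ℂ)) ^ 2‖ = c ^ 2 := by simp
        rw [h1, Real.norm_of_nonneg (by positivity), div_le_div_iff₀ (by positivity) (by positivity)]
        have h2 : c ^ 2 ≤ (x.re + y.re) ^ 2 + c ^ 2 := by nlinarith [sq_nonneg (x.re + y.re)]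
        calc _ = ‖(x - y) ^ 2‖ * (c ^ 2 * c ^ 2) := by ring
          _ ≤ ‖(x - y) ^ 2‖ * (c ^ 2 * ((x.re + y.re) ^ 2 + c ^ 2)) := by gcongr
          _ = _ := by ring
  obtain ⟨B, hB, hk⟩ := key
  refine ⟨B * C, fun x y hx hy => ?_⟩
  rw [pairM_eq_gammaS hc, mul_div_right_comm, norm_mul, mul_assoc]
  exact mul_le_mul (hk x y hx hy) (h x y) (norm_nonneg _) hB

theorem exists_norm_singleM_div_le {c : ℝ} (hc : 0 < c) (l : ℕ) : ∃ C : ℝ, ∀ x : ℂ, x.im = 0 →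
    ‖singleM c l x / singleD c l x‖ ≤
      C * Real.exp (Real.pi / c * (if l % 2 = 0 then x.re + 2 * |x.re| else 0)) := by
  obtain ⟨C, hC, h⟩ := exists_norm_exp_gammaS_le hc
  simp only [singleM_eq_gammaS hc, singleD]
  split_ifs
  · refine ⟨4 / c ^ 3 * C, fun x hx => ?_⟩
    have hx' : x = (x.re : ℂ) := Complex.ext (by simp) (by simp [hx])
    have h1 := h x 0
    rw [ofReal_zero, add_zero] at h1
    rw [mul_div_right_comm, norm_mul, mul_assoc]
    refine mul_le_mul ?_ h1 (norm_nonneg _) (by positivity)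
    have e : x ^ 2 + (c : ℂ) ^ 2 / 4 = ((x.re ^ 2 + c ^ 2 / 4 : ℝ) : ℂ) := by
      rw [hx']; push_cast; simp
    have h2 : ‖(I * (c : ℂ)) ^ 2‖ = c ^ 2 := by simp
    by_cases h0 : x = 0
    · rw [h0]; simp; positivity
    · have h0' : 0 < ‖x‖ := norm_pos_iff.2 h0
      have h3 : ‖x‖ = |x.re| := by rw [hx']; simp
      rw [neg_div, neg_div, norm_neg, norm_div, norm_div, norm_mul, norm_mul, norm_pow, h2, e,
        Complex.norm_real, Real.norm_of_nonneg (by positivity)]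
      have h4 : ‖x‖ * c ≤ x.re ^ 2 + c ^ 2 / 4 := by
        rw [h3, ← sq_abs]; nlinarith [sq_nonneg (|x.re| - c / 2)]
      rw [div_div, div_le_div_iff₀ (by positivity) (by positivity)]
      have h5 : ‖(4 : ℂ)‖ = 4 := by simp
      rw [h5]
      calc 4 * ‖x‖ ^ 2 * c ^ 3 = 4 * ‖x‖ * c ^ 2 * (‖x‖ * c) := by ring
        _ ≤ 4 * ‖x‖ * c ^ 2 * (x.re ^ 2 + c ^ 2 / 4) := by gcongr
        _ = _ := by ring
  · exact ⟨1, fun x _ => by simp⟩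


end SoToda

end

noncomputable section

namespace SoToda

/-! ### The levels of the density -/

/-- A product over the entries and the pairs of entries of a row. -/
def rowProd (S : ℂ → ℂ) (P : ℂ → ℂ → ℂ) (k : ℕ) (γ : ℕ → ℂ) : ℂ :=
  (∏ r ∈ Finset.Icc 1 k, S (γ r)) * ∏ r ∈ Finset.Icc 1 k, ∏ s ∈ Finset.Ioc r k, P (γ r) (γ s)

/-- The part of `rowProd` without the factors that contain the entry `j`. -/
def rowRest (S : ℂ → ℂ) (P : ℂ → ℂ → ℂ) (k j : ℕ) (γ : ℕ → ℂ) : ℂ :=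
  (∏ r ∈ (Finset.Icc 1 k).erase j, S (γ r)) *
    ∏ r ∈ (Finset.Icc 1 k).erase j, ∏ s ∈ (Finset.Ioc r k).erase j, P (γ r) (γ s)

theorem rowProd_split (S : ℂ → ℂ) (P : ℂ → ℂ → ℂ) (hP : ∀ x y, P x y = P y x) {k j : ℕ}
    (hj : j ∈ Finset.Icc 1 k) (γ : ℕ → ℂ) :
    rowProd S P k γ =
      S (γ j) * (∏ r ∈ (Finset.Icc 1 k).erase j, P (γ j) (γ r)) * rowRest S P k j γ := by
  rw [rowProd, rowRest, prod_pairs_split k j hj (fun r s => P (γ r) (γ s)) (fun r s => hP _ _),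
    ← Finset.mul_prod_erase _ _ hj]
  ring

variable {n : ℕ}

/-- The factor of the density at level `l`. -/
def lev (c : ℝ) (p : ℕ → ℝ) (l : ℕ) (z : Idx n → ℂ) : ℂ :=
  rowProd (singleM c l) (pairM c l) ((l + 1) / 2) (entry p z l)

/-- A common multiple of the denominators at level `l`. -/
def levD (c : ℝ) (p : ℕ → ℝ) (l : ℕ) (z : Idx n → ℂ) : ℂ :=
  rowProd (singleD c l) (pairD c l) ((l + 1) / 2) (entry p z l)

/-- The denominator of the coefficient of a translation of `γ_{l,j}`, up to a factor `2`. -/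
def den (c : ℝ) (p : ℕ → ℝ) (l j : ℕ) (τ : ℤ) (z : Idx n → ℂ) : ℂ :=
  singleDen c l τ (entry p z l j) *
    ∏ r ∈ (Finset.Icc 1 ((l + 1) / 2)).erase j, pairDen c l τ (entry p z l j) (entry p z l r)

/-- The entire function `lev / den`. -/
def levX (c : ℝ) (p : ℕ → ℝ) (l j : ℕ) (τ : ℤ) (z : Idx n → ℂ) : ℂ :=
  singleX c l τ (entry p z l j) *
    (∏ r ∈ (Finset.Icc 1 ((l + 1) / 2)).erase j, pairX c l τ (entry p z l j) (entry p z l r)) *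
    rowRest (singleM c l) (pairM c l) ((l + 1) / 2) j (entry p z l)

theorem lev_two_mul (c : ℝ) (p : ℕ → ℝ) (k : ℕ) (z : Idx n → ℂ) :
    lev c p (2 * k) z = muEven c (entry p z) k := by
  have hk : (2 * k + 1) / 2 = k := by omega
  have h2 : 2 * k % 2 = 0 := by omega
  unfold lev rowProd muEven singleM pairM
  simp only [hk, h2, if_true]
  rw [prod_Icc_erase_pairs, Finset.prod_mul_distrib, ← exp_sum, ← Finset.mul_sum]
  simp only [Finset.prod_mul_distrib]
  have e1 : ∀ x : ℂ, -2 * x / (I * c) = -(2 * x / (I * c)) := fun x => by ring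
  have e2 : ∀ x y : ℂ, (y - x) / (I * c) = -((x - y) / (I * c)) := fun x y => by ring
  have e3 : ∀ x y : ℂ, (-x - y) / (I * c) = -((x + y) / (I * c)) := fun x y => by ring
  have e4 : ∀ r s : ℕ, (entry p z (2 * k) s - entry p z (2 * k) r) / (I * c) =
    -((entry p z (2 * k) r - entry p z (2 * k) s) / (I * c)) := fun _ _ => e2 _ _
  simp only [gammaE, e1, e3, Finset.prod_mul_distrib]
  have e5 : (∏ r ∈ Finset.Icc 1 k, ∏ s ∈ Finset.Ioc r k,
      (Gamma ((entry p z (2 * k) s - entry p z (2 * k) r) / (I * c)))⁻¹) =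
      ∏ r ∈ Finset.Icc 1 k, ∏ s ∈ Finset.Ioc r k,
      (Gamma (-((entry p z (2 * k) r - entry p z (2 * k) s) / (I * c))))⁻¹ :=
    Finset.prod_congr rfl fun r _ => Finset.prod_congr rfl fun s _ => by rw [e4 r s]
  rw [e5]
  ring

theorem lev_two_mul_add_one (c : ℝ) (p : ℕ → ℝ) (k : ℕ) (z : Idx n → ℂ) :
    lev c p (2 * k + 1) z = muOdd c (entry p z) k := by
  have hk : (2 * k + 1 + 1) / 2 = k + 1 := by omega
  have h2 : ¬ (2 * k + 1) % 2 = 0 := by omega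
  unfold lev rowProd muOdd singleM pairM
  simp only [hk, h2, if_false]
  rw [prod_Icc_erase_pairs, Finset.prod_const_one, one_mul]
  simp only [Finset.prod_mul_distrib]
  have e2 : ∀ x y : ℂ, (y - x) / (I * c) = -((x - y) / (I * c)) := fun x y => by ring
  have e5 : (∏ r ∈ Finset.Icc 1 (k + 1), ∏ s ∈ Finset.Ioc r (k + 1),
      (Gamma ((entry p z (2 * k + 1) s - entry p z (2 * k + 1) r) / (I * c)))⁻¹) =
      ∏ r ∈ Finset.Icc 1 (k + 1), ∏ s ∈ Finset.Ioc r (k + 1),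
      (Gamma (-((entry p z (2 * k + 1) r - entry p z (2 * k + 1) s) / (I * c))))⁻¹ :=
    Finset.prod_congr rfl fun r _ => Finset.prod_congr rfl fun s _ => by rw [e2]
  rw [e5]
  simp only [gammaE, gammaS, Finset.prod_mul_distrib]

@[to_additive]
theorem prod_range_double {M : Type*} [CommMonoid M] (n : ℕ) (F : ℕ → M) :
    ∏ l ∈ Finset.range (2 * n), F l =
      (∏ k ∈ Finset.range n, F (2 * k)) * ∏ k ∈ Finset.range n, F (2 * k + 1) := by
  induction n with
  | zero => simp
  | succ n ih =>
    rw [show 2 * (n + 1) = 2 * n + 1 + 1 by ring, Finset.prod_range_succ, Finset.prod_range_succ,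
      Finset.prod_range_succ, Finset.prod_range_succ, ih, mul_mul_mul_comm, mul_assoc]

@[to_additive]
theorem prod_range_eq_prod_Icc {M : Type*} [CommMonoid M] (n : ℕ) (F : ℕ → M) (h : F 0 = 1) :
    ∏ k ∈ Finset.range n, F k = ∏ k ∈ Finset.Icc 1 (n - 1), F k := by
  rcases n with _ | n
  · simp
  · have h1 : Finset.Icc 1 (n + 1 - 1) = Finset.Ico (0 + 1) (n + 1) := by ext; simp
    rw [Finset.range_eq_Ico, Finset.prod_eq_prod_Ico_succ_bot (by omega), h, one_mul, h1]

theorem mu_eq_prod_lev (c : ℝ) (p : ℕ → ℝ) (z : Idx n → ℂ) :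
    mu n c p z = ∏ l ∈ Finset.range (2 * n), lev c p l z := by
  rw [prod_range_double, prod_range_eq_prod_Icc n (fun k => lev c p (2 * k) z), mu]
  · simp only [lev_two_mul, lev_two_mul_add_one]
  · simp [lev, rowProd]

theorem lev_eq {c : ℝ} (hc : 0 < c) (p : ℕ → ℝ) {l j : ℕ} (hj : j ∈ Finset.Icc 1 ((l + 1) / 2))
    {τ : ℤ} (hτ : τ = 1 ∨ τ = -1) (z : Idx n → ℂ) :
    lev c p l z = levX c p l j τ z * den c p l j τ z := by
  rw [lev, rowProd_split _ _ (pairM_comm hc l) hj, levX, den, singleM_eq hc l hτ]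
  simp only [pairM_eq hc l hτ (entry p z l j), Finset.prod_mul_distrib]
  ring

theorem exists_levD_eq {c : ℝ} (p : ℕ → ℝ) {l j : ℕ}
    (hj : j ∈ Finset.Icc 1 ((l + 1) / 2)) {τ : ℤ} (hτ : τ = 1 ∨ τ = -1) :
    ∃ Q : Fn n, PolyFn Q ∧ ∀ z, levD c p l z = den c p l j τ z * Q z := by
  refine ⟨fun z => (if l % 2 = 0 then entry p z l j - τ * (I * c / 2) else 1) *
    (∏ r ∈ (Finset.Icc 1 ((l + 1) / 2)).erase j,
      (if l % 2 = 0 then (entry p z l j - entry p z l r) * (entry p z l j + entry p z l r)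
      else (entry p z l j - entry p z l r) *
        (entry p z l j + entry p z l r - τ * (I * c)))) *
    rowRest (singleD c l) (pairD c l) ((l + 1) / 2) j (entry p z l), ?_, fun z => ?_⟩
  · have e : ∀ r, PolyFn fun z : Idx n → ℂ => entry p z l r := fun r => .entry p l r
    unfold rowRest singleD pairD
    refine PolyFn.mul (PolyFn.mul ?_ (PolyFn.prod _ _ fun r _ => ?_))
      (PolyFn.mul (PolyFn.prod _ _ fun r _ => ?_) (PolyFn.prod _ _ fun r _ =>
        PolyFn.prod _ _ fun s _ => ?_)) <;> split_ifs
    · exact (e j).sub (.const _)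
    · exact .const _
    · exact ((e j).sub (e r)).mul ((e j).add (e r))
    · exact ((e j).sub (e r)).mul (((e j).add (e r)).sub (.const _))
    · exact (e r).mul (((e r).pow 2).add (.const _))
    · exact .const _
    · exact (((e r).sub (e s)).mul ((e r).add (e s))).pow 2
    · exact (((e r).sub (e s)).pow 2).mul ((((e r).add (e s)).pow 2).add (.const _))
  · rw [levD, rowProd_split _ _ (pairD_comm l) hj, den, singleD_eq l hτ]
    simp only [pairD_eq l hτ (entry p z l j), Finset.prod_mul_distrib]
    ring

theorem PolyFn.levD (c : ℝ) (p : ℕ → ℝ) (l : ℕ) : PolyFn fun z : Idx n → ℂ => levD c p l z := by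
  have e : ∀ r, PolyFn fun z : Idx n → ℂ => SoToda.entry p z l r := fun r => .entry p l r
  unfold SoToda.levD rowProd singleD pairD
  refine (PolyFn.mul (PolyFn.prod _ _ fun r _ => ?_) (PolyFn.prod _ _ fun r _ =>
      PolyFn.prod _ _ fun s _ => ?_)) <;> split_ifs
  · exact (e r).mul (((e r).pow 2).add (.const _))
  · exact .const _
  · exact (((e r).sub (e s)).mul ((e r).add (e s))).pow 2
  · exact (((e r).sub (e s)).pow 2).mul ((((e r).add (e s)).pow 2).add (.const _))

theorem levX_tr {c : ℝ} (hc : 0 < c) (p : ℕ → ℝ) {l j : ℕ} (h : (l, j) ∈ positions n)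
    {τ : ℤ} (hτ : τ = 1 ∨ τ = -1) (z : Idx n → ℂ) :
    levX c p l j τ (tr c z (Pi.single ⟨(l, j), h⟩ (-τ))) =
      (if l % 2 = 0 then -1 else 1) * levX c p l j (-τ) z := by
  have e1 : entry p (tr c z (Pi.single ⟨(l, j), h⟩ (-τ))) l j =
      entry p z l j - τ * (I * c) := by
    rw [entry_tr, entZ_single, if_pos rfl]; push_cast; ring
  have e2 : ∀ r, r ≠ j → entry p (tr c z (Pi.single ⟨(l, j), h⟩ (-τ))) l r = entry p z l r := by
    intro r hr
    rw [entry_tr, entZ_single, if_neg (by simpa using hr)]; simp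
  rw [levX, levX, e1, singleX_shift hc l _ hτ]
  have f1 : ∏ r ∈ (Finset.Icc 1 ((l + 1) / 2)).erase j,
      pairX c l τ (entry p z l j - τ * (I * c))
        (entry p (tr c z (Pi.single ⟨(l, j), h⟩ (-τ))) l r) =
      ∏ r ∈ (Finset.Icc 1 ((l + 1) / 2)).erase j, pairX c l (-τ) (entry p z l j)
        (entry p z l r) :=
    Finset.prod_congr rfl fun r hr => by
      rw [e2 r (Finset.ne_of_mem_erase hr), pairX_shift hc l _ _ hτ]
  have f2 : rowRest (singleM c l) (pairM c l) ((l + 1) / 2) j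
        (entry p (tr c z (Pi.single ⟨(l, j), h⟩ (-τ))) l) =
      rowRest (singleM c l) (pairM c l) ((l + 1) / 2) j (entry p z l) := by
    refine congrArg₂ (· * ·) (Finset.prod_congr rfl fun r hr => ?_)
      (Finset.prod_congr rfl fun r hr => Finset.prod_congr rfl fun s hs => ?_)
    · rw [e2 r (Finset.ne_of_mem_erase hr)]
    · rw [e2 r (Finset.ne_of_mem_erase hr), e2 s (Finset.ne_of_mem_erase hs)]
  rw [f1, f2]; ring

/-! ### Regularity -/

theorem differentiable_entry (p : ℕ → ℝ) (l j : ℕ) :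
    Differentiable ℂ fun z : Idx n → ℂ => entry p z l j :=
  (PolyFn.entry p l j).differentiable

theorem differentiable_gammaS_comp {f : (Idx n → ℂ) → ℂ} (hf : Differentiable ℂ f) :
    Differentiable ℂ fun z => gammaS (f z) :=
  differentiable_gammaS.comp hf

theorem differentiable_finset_prod {ι : Type*} (s : Finset ι) (f : ι → Fn n)
    (hf : ∀ i ∈ s, Differentiable ℂ (f i)) : Differentiable ℂ fun z => ∏ i ∈ s, f i z := by
  classical
  induction s using Finset.induction_on with
  | empty => simp
  | insert i s hi ih =>
    simp only [Finset.prod_insert hi]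
    exact (hf i (Finset.mem_insert_self _ _)).mul
      (ih fun j hj => hf j (Finset.mem_insert_of_mem hj))

theorem differentiable_singleM {c : ℝ} (hc : 0 < c) (l : ℕ) {f : (Idx n → ℂ) → ℂ} (hf : Differentiable ℂ f) :
    Differentiable ℂ fun z => singleM c l (f z) := by
  simp only [singleM_eq_gammaS hc, div_eq_mul_inv]
  have := differentiable_gammaS_comp ((hf.const_mul 2).mul_const (I * (c : ℂ))⁻¹)
  split_ifs <;> fun_prop

theorem differentiable_pairM {c : ℝ} (hc : 0 < c) (l : ℕ) {f g : (Idx n → ℂ) → ℂ}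
    (hf : Differentiable ℂ f) (hg : Differentiable ℂ g) :
    Differentiable ℂ fun z => pairM c l (f z) (g z) := by
  simp only [pairM_eq_gammaS hc, div_eq_mul_inv]
  have h1 := differentiable_gammaS_comp ((hf.sub hg).mul_const (I * (c : ℂ))⁻¹)
  have h2 := differentiable_gammaS_comp ((hf.add hg).mul_const (I * (c : ℂ))⁻¹)
  refine Differentiable.mul ?_ (h1.mul h2)
  split_ifs <;> fun_prop

theorem differentiable_singleX (c : ℝ) (l : ℕ) (τ : ℤ) {f : (Idx n → ℂ) → ℂ} (hf : Differentiable ℂ f) :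
    Differentiable ℂ fun z => singleX c l τ (f z) := by
  unfold singleX
  simp only [div_eq_mul_inv]
  have := differentiable_gammaS_comp
    (((hf.const_mul 2).mul_const (I * (c : ℂ))⁻¹).add_const (τ : ℂ))
  split_ifs <;> fun_prop

theorem differentiable_pairX (c : ℝ) (l : ℕ) (τ : ℤ) {f g : (Idx n → ℂ) → ℂ}
    (hf : Differentiable ℂ f) (hg : Differentiable ℂ g) :
    Differentiable ℂ fun z => pairX c l τ (f z) (g z) := by
  unfold pairX
  simp only [div_eq_mul_inv]
  have h1 := differentiable_gammaS_comp ((hf.add hg).mul_const (I * (c : ℂ))⁻¹)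
  have h2 := differentiable_gammaS_comp
    (((hf.add hg).mul_const (I * (c : ℂ))⁻¹).add_const (τ : ℂ))
  split_ifs
  · fun_prop
  · exact (Differentiable.mul (by fun_prop) (h2.add h1)).const_mul _

theorem differentiable_lev {c : ℝ} (hc : 0 < c) (p : ℕ → ℝ) (l : ℕ) :
    Differentiable ℂ fun z : Idx n → ℂ => lev c p l z :=
  (differentiable_finset_prod _ _ fun _ _ =>
    differentiable_singleM hc l (differentiable_entry p l _)).mul
  (differentiable_finset_prod _ _ fun _ _ => differentiable_finset_prod _ _ fun _ _ =>
    differentiable_pairM hc l (differentiable_entry p l _) (differentiable_entry p l _))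

theorem differentiable_levX {c : ℝ} (hc : 0 < c) (p : ℕ → ℝ) (l j : ℕ) (τ : ℤ) :
    Differentiable ℂ fun z : Idx n → ℂ => levX c p l j τ z :=
  ((differentiable_singleX c l τ (differentiable_entry p l _)).mul
    (differentiable_finset_prod _ _ fun _ _ =>
      differentiable_pairX c l τ (differentiable_entry p l _) (differentiable_entry p l _))).mul
  ((differentiable_finset_prod _ _ fun _ _ =>
    differentiable_singleM hc l (differentiable_entry p l _)).mul
  (differentiable_finset_prod _ _ fun _ _ => differentiable_finset_prod _ _ fun _ _ =>
    differentiable_pairM hc l (differentiable_entry p l _) (differentiable_entry p l _)))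

/-! ### Growth -/

/-- The exponent of the growth of `singleM`. -/
def singleExp (c : ℝ) (l r : ℕ) (x : Idx n → ℝ) : ℝ :=
  Real.pi / c * (if l % 2 = 0 then
    (entry 0 (toC x) l r).re + 2 * |(entry 0 (toC x) l r).re| else 0)

/-- The exponent of the growth of `pairM`. -/
def pairExp (c : ℝ) (l r s : ℕ) (x : Idx n → ℝ) : ℝ :=
  Real.pi / c * (|(entry 0 (toC x) l r).re - (entry 0 (toC x) l s).re| +
    |(entry 0 (toC x) l r).re + (entry 0 (toC x) l s).re|)

/-- The exponent of the growth of `lev`. -/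
def levExp (c : ℝ) (l : ℕ) (x : Idx n → ℝ) : ℝ :=
  (∑ r ∈ Finset.Icc 1 ((l + 1) / 2), singleExp c l r x) +
    ∑ r ∈ Finset.Icc 1 ((l + 1) / 2), ∑ s ∈ Finset.Ioc r ((l + 1) / 2), pairExp c l r s x

theorem sum_levExp (c : ℝ) (x : Idx n → ℝ) :
    ∑ l ∈ Finset.range (2 * n), levExp c l x = Real.pi / c * growth n x := by
  rw [growth, mul_add (Real.pi / c)]
  simp only [levExp, Finset.sum_add_distrib]
  congr 1
  · rw [sum_range_double, sum_range_eq_sum_Icc n _ (by simp)]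
    have h1 : ∀ k, (2 * k + 1) / 2 = k := fun k => by omega
    have h2 : ∀ k, 2 * k % 2 = 0 := fun k => by omega
    have h3 : ∀ k, ¬ (2 * k + 1) % 2 = 0 := fun k => by omega
    simp only [singleExp, h1, h2, h3, if_true, if_false, mul_zero, Finset.sum_const_zero,
      _root_.add_zero, ← Finset.mul_sum, mul_add, Finset.sum_add_distrib]
  · rw [sum_range_eq_sum_Icc (2 * n) _ (by simp)]
    simp only [pairExp, ← Finset.mul_sum, Finset.sum_add_distrib]

theorem entry_re (p : ℕ → ℝ) {l r : ℕ} (h : (l, r) ∈ positions n) (z : Idx n → ℂ) :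
    (entry p z l r).re = (entry 0 (toC (rePart z)) l r).re := by
  rw [entry_of_mem p z h, entry_of_mem 0 _ h]
  simp [toC, rePart]

theorem entry_im (p : ℕ → ℝ) {l r : ℕ} (h : (l, r) ∈ positions n) (z : Idx n → ℂ) :
    (entry p z l r).im = (z ⟨(l, r), h⟩).im := by
  rw [entry_of_mem p z h]

theorem Tempered.of_le {Ω : Set (Idx n → ℂ)} {θ : (Idx n → ℝ) → ℝ} {f : Fn n} (C : ℝ)
    (hf : ∀ z ∈ Ω, ‖f z‖ ≤ C * Real.exp (θ (rePart z))) : Tempered Ω θ f := by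
  refine ⟨max C 0, 0, le_max_right _ _, fun z hz => (hf z hz).trans ?_⟩
  rw [pow_zero, mul_one]
  gcongr
  exact le_max_left _ _

section Growth

variable {Ω : Set (Idx n → ℂ)}

theorem tempered_singleM {c : ℝ} (hc : 0 < c) (p : ℕ → ℝ) {B : ℝ}
    (hΩ : ∀ z ∈ Ω, ∀ q, |(z q).im| ≤ B) {l r : ℕ} (h : (l, r) ∈ positions n) :
    Tempered Ω (singleExp c l r) fun z => singleM c l (entry p z l r) := by
  simp only [singleM_eq_gammaS hc]
  unfold singleExp
  split_ifs
  · obtain ⟨C, hC, hb⟩ := exists_norm_exp_gammaS_le hc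
    have h1 : PolyFn fun z : Idx n → ℂ => -(4 * entry p z l r ^ 2) / (I * c) ^ 2 := by
      have := (PolyFn.const (n := n) (-4 / (I * c) ^ 2)).mul ((PolyFn.entry p l r).pow 2)
      convert this using 2
      ring
    refine ((h1.tempered hΩ).mul (Tempered.of_le (θ := fun x => Real.pi / c *
      ((entry 0 (toC x) l r).re + 2 * |(entry 0 (toC x) l r).re|)) C fun z _ => ?_)).mono
      fun x => by rw [_root_.zero_add]
    have := hb (entry p z l r) 0
    rw [ofReal_zero, _root_.add_zero] at this
    rwa [← entry_re p h z]
  · exact (Tempered.of_bound (f := fun _ => 1) 1 (by simp)).mono fun x => by simp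

theorem tempered_pairM {c : ℝ} (hc : 0 < c) (p : ℕ → ℝ) {B : ℝ}
    (hΩ : ∀ z ∈ Ω, ∀ q, |(z q).im| ≤ B) {l r s : ℕ} (h : (l, r) ∈ positions n)
    (h' : (l, s) ∈ positions n) :
    Tempered Ω (pairExp c l r s) fun z => pairM c l (entry p z l r) (entry p z l s) := by
  simp only [pairM_eq_gammaS hc]
  obtain ⟨C, hC, hb⟩ := exists_norm_gammaS_pair_le hc
  have h1 : PolyFn fun z : Idx n → ℂ => if l % 2 = 0 then
      ((entry p z l r - entry p z l s) * (entry p z l r + entry p z l s)) ^ 2 / (I * c) ^ 4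
      else -(entry p z l r - entry p z l s) ^ 2 / (I * c) ^ 2 := by
    have e : ∀ r, PolyFn fun z : Idx n → ℂ => entry p z l r := fun r => .entry p l r
    split_ifs
    · exact ((((e r).sub (e s)).mul ((e r).add (e s))).pow 2).mul (.const _)
    · have := (PolyFn.const (n := n) (-1 / (I * c) ^ 2)).mul (((e r).sub (e s)).pow 2)
      convert this using 2
      ring
  refine ((h1.tempered hΩ).mul (Tempered.of_le (θ := pairExp c l r s) C fun z _ => ?_)).mono
    fun x => by rw [_root_.zero_add]
  have := hb (entry p z l r) (entry p z l s)
  rwa [pairExp, ← entry_re p h z, ← entry_re p h' z]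

theorem position_of_mem {l r : ℕ} (hl : l ∈ Finset.range (2 * n))
    (hr : r ∈ Finset.Icc 1 ((l + 1) / 2)) : (l, r) ∈ positions n := by
  rw [Finset.mem_range] at hl
  rw [Finset.mem_Icc] at hr
  rw [mem_positions]
  omega

theorem tempered_lev {c : ℝ} (hc : 0 < c) (p : ℕ → ℝ) {B : ℝ}
    (hΩ : ∀ z ∈ Ω, ∀ q, |(z q).im| ≤ B) {l : ℕ} (hl : l ∈ Finset.range (2 * n)) :
    Tempered Ω (levExp c l) fun z => lev c p l z := by
  refine (Tempered.prod _ fun r hr => tempered_singleM hc p hΩ (position_of_mem hl hr)).mul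
    (Tempered.prod _ fun r hr => Tempered.prod _ fun s hs =>
      tempered_pairM hc p hΩ (position_of_mem hl hr) (position_of_mem hl ?_))
  rw [Finset.mem_Ioc] at hs; rw [Finset.mem_Icc] at hr ⊢; omega

theorem tempered_lev_div {c : ℝ} (hc : 0 < c) (p : ℕ → ℝ) {l : ℕ}
    (hl : l ∈ Finset.range (2 * n)) (hΩ : ∀ z ∈ Ω, ∀ q : Idx n, q.1.1 = l → (z q).im = 0) :
    Tempered Ω (levExp c l) fun z => lev c p l z / levD c p l z := by
  simp only [lev, levD, rowProd, mul_div_mul_comm, ← Finset.prod_div_distrib]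
  refine (Tempered.prod _ fun r hr => ?_).mul
    (Tempered.prod _ fun r hr => Tempered.prod _ fun s hs => ?_)
  · have h := position_of_mem hl hr
    obtain ⟨C, hC⟩ := exists_norm_singleM_div_le hc l
    refine Tempered.of_le C fun z hz => ?_
    have := hC (entry p z l r) (by rw [entry_im p h]; exact hΩ z hz _ rfl)
    rwa [singleExp, ← entry_re p h z]
  · have h := position_of_mem hl hr
    have h' : (l, s) ∈ positions n := by
      refine position_of_mem hl ?_
      rw [Finset.mem_Ioc] at hs; rw [Finset.mem_Icc] at hr ⊢; omega
    obtain ⟨C, hC⟩ := exists_norm_pairM_div_le hc l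
    refine Tempered.of_le C fun z hz => ?_
    have := hC (entry p z l r) (entry p z l s) (by rw [entry_im p h]; exact hΩ z hz _ rfl)
      (by rw [entry_im p h']; exact hΩ z hz _ rfl)
    rwa [pairExp, ← entry_re p h z, ← entry_re p h' z]

theorem pairExp_comm (c : ℝ) (l r s : ℕ) (x : Idx n → ℝ) :
    pairExp c l r s x = pairExp c l s r x := by
  unfold pairExp
  rw [abs_sub_comm, add_comm (entry 0 (toC x) l r).re]

theorem tempered_levX {c : ℝ} (hc : 0 < c) (p : ℕ → ℝ) {B : ℝ}
    (hΩ : ∀ z ∈ Ω, ∀ q, |(z q).im| ≤ B) {l j : ℕ} (hl : l ∈ Finset.range (2 * n))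
    (hj : j ∈ Finset.Icc 1 ((l + 1) / 2)) (τ : ℤ) :
    Tempered Ω (levExp c l) fun z => levX c p l j τ z := by
  have hpj := position_of_mem hl hj
  have h1 : Tempered Ω (singleExp c l j) fun z => singleX c l τ (entry p z l j) := by
    obtain ⟨C, hC⟩ := exists_norm_singleX_le hc l τ
    refine Tempered.of_le C fun z hz => ?_
    have := hC (entry p z l j)
    rwa [singleExp, ← entry_re p hpj z]
  have h2 := Tempered.prod (Ω := Ω) ((Finset.Icc 1 ((l + 1) / 2)).erase j)
    (θ := fun r => pairExp c l j r)
    (f := fun r z => pairX c l τ (entry p z l j) (entry p z l r)) fun r hr => by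
      have h := position_of_mem hl (Finset.mem_of_mem_erase hr)
      obtain ⟨C, hC⟩ := exists_norm_pairX_le hc l τ
      refine Tempered.of_le C fun z hz => ?_
      have := hC (entry p z l j) (entry p z l r)
      rwa [pairExp, ← entry_re p hpj z, ← entry_re p h z]
  have h3 : Tempered Ω (fun x => (∑ r ∈ (Finset.Icc 1 ((l + 1) / 2)).erase j, singleExp c l r x) +
      ∑ r ∈ (Finset.Icc 1 ((l + 1) / 2)).erase j, ∑ s ∈ (Finset.Ioc r ((l + 1) / 2)).erase j,
        pairExp c l r s x) fun z =>
      rowRest (singleM c l) (pairM c l) ((l + 1) / 2) j (entry p z l) := by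
    refine (Tempered.prod _ fun r hr => ?_).mul
      (Tempered.prod _ fun r hr => Tempered.prod _ fun s hs => ?_)
    · exact tempered_singleM hc p hΩ (position_of_mem hl (Finset.mem_of_mem_erase hr))
    · refine tempered_pairM hc p hΩ (position_of_mem hl (Finset.mem_of_mem_erase hr))
        (position_of_mem hl ?_)
      have := Finset.mem_of_mem_erase hs
      have hr' := Finset.mem_of_mem_erase hr
      rw [Finset.mem_Ioc] at this; rw [Finset.mem_Icc] at hr' ⊢; omega
  refine ((h1.mul h2).mul h3).mono fun x => le_of_eq ?_
  rw [levExp, sum_pairs_split _ j hj (fun r s => pairExp c l r s x)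
    (fun r s => pairExp_comm c l r s x), ← Finset.add_sum_erase _ _ hj]
  ring

end Growth

end SoToda

end

noncomputable section

namespace SoToda

variable {n : ℕ}

/-! ### The integrand of a pair of terms -/

/-- The segment from the real array `x` in the direction `ic * m`. -/
def line (c : ℝ) (m : Idx n → ℤ) (x : Idx n → ℝ) (t : ℝ) : Idx n → ℂ :=
  fun q => x q + I * c * (t * m q)

/-- The points `line c m x t` with `0 ≤ t ≤ 1`. -/
def strip (c : ℝ) (m : Idx n → ℤ) : Set (Idx n → ℂ) :=
  {z | ∃ x : Idx n → ℝ, ∃ t ∈ Set.Icc (0 : ℝ) 1, z = line c m x t}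

theorem line_zero (c : ℝ) (m : Idx n → ℤ) (x : Idx n → ℝ) : line c m x 0 = pt c x 0 := by
  ext q; simp [line, pt, tr, toC]

theorem rePart_line (c : ℝ) (m : Idx n → ℤ) (x : Idx n → ℝ) (t : ℝ) :
    rePart (line c m x t) = x := by
  ext q; simp [line, rePart]

theorem line_im (c : ℝ) (m : Idx n → ℤ) (x : Idx n → ℝ) (t : ℝ) (q : Idx n) :
    (line c m x t q).im = c * (t * m q) := by
  simp [line]

theorem lform_line {c : ℝ} (hc : 0 < c) (p : ℕ → ℝ) (ε : ℕ → ℤˣ) (u : Link) (m : Idx n → ℤ)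
    (x : Idx n → ℝ) (t : ℝ) :
    lform c p ε u (line c m x t) = lform c p ε u (toC x) + t * (lincr ε u m : ℂ) := by
  have hc' : (c : ℂ) ≠ 0 := by exact_mod_cast hc.ne'
  have hI := I_ne_zero
  have h : ∀ l j, entry p (line c m x t) l j =
      entry p (toC x) l j + I * c * (t * (entZ m (l, j) : ℂ)) := by
    intro l j
    unfold entry entZ
    split_ifs <;> simp [line, toC]
  simp only [lform, lincr, h]
  push_cast
  field_simp
  ring

theorem lform_line_re {c : ℝ} (hc : 0 < c) (p : ℕ → ℝ) (ε : ℕ → ℤˣ) (u : Link) (m : Idx n → ℤ)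
    (x : Idx n → ℝ) (t : ℝ) : (lform c p ε u (line c m x t)).re = t * lincr ε u m := by
  rw [lform_line hc, add_re, lform_toC_re, zero_add, re_ofReal_mul, intCast_re]

/-- The translations `m`, `s`, `s'` move different entries, by at most one step each. -/
structure Compat (m s s' : Idx n → ℤ) : Prop where
  step : IsStep m
  left : ∀ q, |s q| ≤ 1
  right : ∀ q, |s' q| ≤ 1
  disjoint : ∀ q, m q ≠ 0 → s q = 0 ∧ s' q = 0

/-- `f` and `g` are regularized by `φ` and `ψ`, which decay as in `IsAdmissible`. -/
structure RegPair (c : ℝ) (p : ℕ → ℝ) (ε : ℕ → ℤˣ) (R : ℝ) (f g φ ψ : Fn n) : Prop where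
  pos : 0 < c
  lt : c < R
  left : IsRegularized n c p (-ε) R f φ
  right : IsRegularized n c p ε R g ψ
  decay : ∀ M : ℕ, ∃ C : ℝ, ∀ x y y' : Idx n → ℝ, (∀ q, |y q| < R) → (∀ q, |y' q| < R) →
    ‖φ (toC x + I • toC y)‖ * ‖ψ (toC x + I • toC y')‖ *
      Real.exp (Real.pi / c * growth n x) * (1 + ‖x‖) ^ M ≤ C

/-- The contribution of a link and of `g` to the integrand of a pair of terms. -/
def legRight (c : ℝ) (p : ℕ → ℝ) (ε : ℕ → ℤˣ) (m s' : Idx n → ℤ) (u : Link)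
    (z : Idx n → ℂ) : ℂ :=
  (if lincr ε u m = -1 then -1 else 1) *
  (Gamma (lform c p ε u z + 1 / 2 + ((if lincr ε u m = -1 then 1 else 0 : ℤ) : ℂ)) /
    ((I * c) ^ 2 * Gamma (lform c p ε u z + lincr ε u s' + 5 / 2)))

/-- The contribution of a link and of `f` to the integrand of a pair of terms. -/
def legLeft (c : ℝ) (p : ℕ → ℝ) (ε : ℕ → ℤˣ) (m s : Idx n → ℤ) (u : Link)
    (z : Idx n → ℂ) : ℂ :=
  Gamma (-lform c p ε u z + 1 / 2 + ((if lincr ε u m = 1 then 1 else 0 : ℤ) : ℂ)) /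
    ((I * c) ^ 2 * Gamma (-lform c p ε u z + lincr ε u m + lincr ε u s + 5 / 2))

/-- The integrand of a pair of terms, without the density and the denominators. -/
def core (c : ℝ) (p : ℕ → ℝ) (ε : ℕ → ℤˣ) (m s s' : Idx n → ℤ) (Q φ ψ : Fn n)
    (z : Idx n → ℂ) : ℂ :=
  (∏ u ∈ links n, legLeft c p (-ε) m s u z * legRight c p ε m s' u z) * Q z *
    (conj (φ (tr c (cj z) (m + s))) * ψ (tr c z s'))

theorem regularized_eq {c : ℝ} (hc : 0 < c) (p : ℕ → ℝ) (ε : ℕ → ℤˣ) {R : ℝ} (hR : c < R)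
    {f φ : Fn n} (hf : IsRegularized n c p ε R f φ) (x : Idx n → ℝ) (m s : Idx n → ℤ)
    (hms : ∀ q, |(m + s) q| ≤ 1) :
    gauge c p ε (pt c x m) / gauge c p ε (pt c x (m + s)) * f (pt c x (m + s)) =
      (∏ u ∈ links n, Gamma (lform c p ε u (pt c x m) + 1 / 2) /
        ((I * c) ^ 2 * Gamma (lform c p ε u (pt c x m) + lincr ε u s + 5 / 2))) *
        φ (pt c x (m + s)) := by
  have hc' : (c : ℂ) ≠ 0 := by exact_mod_cast hc.ne'
  have hI := I_ne_zero
  have htube : pt c x (m + s) ∈ tube n R := by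
    intro q
    have h1 : (pt c x (m + s) q).im = c * ((m + s) q : ℝ) := by simp [pt, tr, toC]
    have h2 : |((m + s) q : ℝ)| ≤ 1 := by exact_mod_cast hms q
    rw [h1, abs_mul, abs_of_pos hc]
    nlinarith
  have hP := poleForm_pt_ne_zero hc p ε x (m + s)
  rw [hf.2 _ htube hP, ← mul_assoc]
  congr 1
  rw [gauge, gauge, poleForm_eq hc, ← Finset.prod_div_distrib, ← Finset.prod_mul_distrib]
  refine Finset.prod_congr rfl fun u _ => ?_
  have g0 := Gamma_ne_zero_pt hc p ε u x (m + s) 0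
  have h0 := lform_pt_ne hc p ε u x (m + s) 0
  have h1 := lform_pt_ne hc p ε u x (m + s) 1
  rw [← tr_pt, lform_tr hc] at g0 h0 h1 ⊢
  generalize lform c p ε u (pt c x m) = w at *
  push_cast at g0 h0 h1
  rw [add_zero] at g0 h0
  have h1' : w + lincr ε u s + 1 / 2 + 1 ≠ 0 := h1
  have e1 : w + lincr ε u s + 5 / 2 = w + lincr ε u s + 1 / 2 + 1 + 1 := by ring
  have e2 : w + lincr ε u s + 3 / 2 = w + lincr ε u s + 1 / 2 + 1 := by ring
  rw [e1, Gamma_add_one _ h1', Gamma_add_one _ h0, e2]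
  generalize Gamma (w + 1 / 2) = a
  generalize w + lincr ε u s + 1 / 2 = v at *
  field_simp

theorem legRight_eq {c : ℝ} (hc : 0 < c) (p : ℕ → ℝ) (ε : ℕ → ℤˣ) (m₀ s' : Idx n → ℤ)
    (u : Link) (x : Idx n → ℝ) (m : Idx n → ℤ) :
    conj (cancel c p ε m₀ u (pt c x (-m))) *
      (Gamma (lform c p ε u (pt c x m) + 1 / 2) /
        ((I * c) ^ 2 * Gamma (lform c p ε u (pt c x m) + lincr ε u s' + 5 / 2))) =
      legRight c p ε m₀ s' u (pt c x m) := by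
  have h0 := lform_pt_ne hc p ε u x m 0
  unfold cancel legRight
  split_ifs
  · rw [map_sub, conj_lform, cj_pt, neg_neg]
    push_cast at h0 ⊢
    rw [add_zero] at h0
    rw [Gamma_add_one _ h0, map_div₀, map_one, map_ofNat]
    ring
  · simp

theorem legLeft_eq {c : ℝ} (hc : 0 < c) (p : ℕ → ℝ) (ε : ℕ → ℤˣ) {m₀ : Idx n → ℤ}
    (hm₀ : IsStep m₀) (s : Idx n → ℤ) {u : Link} (hu : u ∈ links n) (x : Idx n → ℝ)
    (m : Idx n → ℤ) :
    conj (cancel c p ε m₀ u (pt c x (-m)) *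
      (Gamma (lform c p ε u (pt c x (m₀ - m)) + 1 / 2) /
        ((I * c) ^ 2 * Gamma (lform c p ε u (pt c x (m₀ - m)) + lincr ε u s + 5 / 2)))) =
      legLeft c p ε m₀ s u (pt c x m) := by
  have h1 := lform_pt_ne hc p ε u x (-m) (-1)
  have h2 := abs_le.1 (hm₀.abs_lincr_le ε hu)
  have e1 : lform c p ε u (pt c x (m₀ - m)) = lform c p ε u (pt c x (-m)) + lincr ε u m₀ := by
    rw [← lform_tr hc, tr_pt, sub_eq_neg_add]
  have e2 : lform c p ε u (pt c x (-m)) = conj (-lform c p ε u (pt c x m)) := by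
    rw [map_neg, conj_lform, cj_pt, neg_neg]
  have e3 : ∀ a : ℂ, conj (a + 1 / 2) = conj a + 1 / 2 := by
    intro a; rw [map_add, map_div₀, map_one, map_ofNat]
  have e4 : ∀ a : ℂ, conj (a + 5 / 2) = conj a + 5 / 2 := by
    intro a; rw [map_add, map_div₀, map_ofNat, map_ofNat]
  have e5 : conj ((I * c : ℂ) ^ 2) = (I * c) ^ 2 := by simp
  rw [e1, map_mul, map_div₀, map_mul, ← Gamma_conj, ← Gamma_conj, e3, e4, e5, map_add, map_add,
    map_add, map_intCast, map_intCast, e2, conj_conj]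
  have h1' : -lform c p ε u (pt c x m) - 1 / 2 ≠ 0 := by
    intro h
    apply h1
    have := congrArg conj h
    rw [map_sub, ← e2, map_zero, map_div₀, map_one, map_ofNat] at this
    push_cast
    linear_combination this
  unfold cancel legLeft
  rcases (by omega : lincr ε u m₀ = -1 ∨ lincr ε u m₀ = 0 ∨ lincr ε u m₀ = 1) with h | h | h
  · rw [if_pos h, if_neg (by omega), h, e2, map_sub, conj_conj, map_div₀, map_one, map_ofNat]
    generalize -lform c p ε u (pt c x m) = w at *
    push_cast
    have e6 : w + -1 + 1 / 2 = w - 1 / 2 := by ring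
    have e7 : w + 1 / 2 + 0 = w - 1 / 2 + 1 := by ring
    rw [e6, e7, Gamma_add_one _ h1']
    ring
  · rw [if_neg (by omega), if_neg (by omega), h]
    simp
  · rw [if_neg (by omega), if_pos h, h]
    generalize -lform c p ε u (pt c x m) = w at *
    have e6 : w + 1 / 2 + ((1 : ℤ) : ℂ) = w + ((1 : ℤ) : ℂ) + 1 / 2 := by ring
    rw [e6]
    simp

theorem core_eq {c : ℝ} {p : ℕ → ℝ} {ε : ℕ → ℤˣ} {R : ℝ} {f g φ ψ : Fn n}
    (h : RegPair c p ε R f g φ ψ) {m₀ s s' : Idx n → ℤ} (hs : Compat m₀ s s')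
    (qf qg : Fn n) (x : Idx n → ℝ) {m : Idx n → ℤ} (hm : m = 0 ∨ m = m₀) :
    conj ((∏ u ∈ links n, (cancel c p ε m₀ u (pt c x (-m)) *
        cancel c p (-ε) m₀ u (pt c x (-m)))) *
      (qf (pt c x (m₀ - m)) * (gauge c p (-ε) (pt c x (m₀ - m)) /
        gauge c p (-ε) (pt c x (m₀ - m + s)) * f (pt c x (m₀ - m + s))))) *
      (qg (pt c x m) * (gauge c p ε (pt c x m) / gauge c p ε (pt c x (m + s')) *
        g (pt c x (m + s')))) =
    core c p ε m₀ s s' (fun z => conj (qf (tr c (cj z) m₀)) * qg z) φ ψ (pt c x m) := by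
  have hc := h.pos
  have hb : ∀ q, |(m₀ - m + s) q| ≤ 1 ∧ |(m + s') q| ≤ 1 := by
    intro q
    have h1 := abs_le.1 (hs.step.1 q)
    have h2 := abs_le.1 (hs.left q)
    have h3 := abs_le.1 (hs.right q)
    have h4 := hs.disjoint q
    rcases hm with hm | hm <;>
      simp only [hm, Pi.add_apply, Pi.sub_apply, Pi.zero_apply, abs_le] <;>
      by_cases h0 : m₀ q = 0
    · omega
    · have := h4 h0; omega
    · omega
    · have := h4 h0; omega
  rw [regularized_eq hc p _ h.lt h.left x _ _ fun q => (hb q).1,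
    regularized_eq hc p _ h.lt h.right x _ _ fun q => (hb q).2, core]
  have e1 : pt c x (m₀ - m) = tr c (cj (pt c x m)) m₀ := by
    rw [cj_pt, tr_pt, sub_eq_neg_add]
  have e2 : pt c x (m₀ - m + s) = tr c (cj (pt c x m)) (m₀ + s) := by
    rw [cj_pt, tr_pt, sub_eq_neg_add, add_assoc]
  have e3 : pt c x (m + s') = tr c (pt c x m) s' := by rw [tr_pt]
  have e4 : ∏ u ∈ links n, legLeft c p (-ε) m₀ s u (pt c x m) *
      legRight c p ε m₀ s' u (pt c x m) =
      conj (∏ u ∈ links n, (cancel c p ε m₀ u (pt c x (-m)) *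
        cancel c p (-ε) m₀ u (pt c x (-m)))) *
      conj (∏ u ∈ links n, Gamma (lform c p (-ε) u (pt c x (m₀ - m)) + 1 / 2) /
        ((I * c) ^ 2 * Gamma (lform c p (-ε) u (pt c x (m₀ - m)) + lincr (-ε) u s + 5 / 2))) *
      ∏ u ∈ links n, Gamma (lform c p ε u (pt c x m) + 1 / 2) /
        ((I * c) ^ 2 * Gamma (lform c p ε u (pt c x m) + lincr ε u s' + 5 / 2)) := by
    rw [map_prod, map_prod, ← Finset.prod_mul_distrib, ← Finset.prod_mul_distrib]
    refine Finset.prod_congr rfl fun u hu => ?_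
    rw [← legLeft_eq hc p (-ε) hs.step s hu x m, ← legRight_eq hc p ε m₀ s' u x m, map_mul,
      map_mul]
    ring
  rw [e4, ← e1, ← e2, ← e3]
  simp only [map_mul]
  ring

theorem Gamma_div_shift_le (s : ℂ) (hs : 1 / 2 ≤ s.re) (k : ℤ) (hk : 0 ≤ k) :
    ‖Gamma s / Gamma (s + k)‖ ≤ 2 ^ k.toNat := by
  obtain ⟨k, rfl⟩ := Int.eq_ofNat_of_zero_le hk
  simpa using norm_Gamma_div_le s hs k

theorem entZ_disjoint {m s : Idx n → ℤ} (h : ∀ q, m q ≠ 0 → s q = 0) (q : ℕ × ℕ) :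
    entZ m q ≠ 0 → entZ s q = 0 := by
  unfold entZ; split_ifs
  · exact h _
  · simp

theorem IsStep.lincr_bounds {m s : Idx n → ℤ} (hm : IsStep m) (hs : ∀ q, |s q| ≤ 1)
    (h : ∀ q, m q ≠ 0 → s q = 0) (ε : ℕ → ℤˣ) {u : Link} (hu : u ∈ links n) :
    |lincr ε u s| ≤ 2 ∧ (lincr ε u m ≠ 0 → |lincr ε u s| ≤ 1) := by
  have h1 := abs_le.1 (abs_entZ_le hs u.oddEnd)
  have h2 := abs_le.1 (abs_entZ_le hs u.evenEnd)
  have h3 := entZ_disjoint h u.oddEnd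
  have h4 := entZ_disjoint h u.evenEnd
  unfold lincr
  rw [abs_le, abs_le]
  rcases hm.2 u hu with h' | h' <;> rw [h'] <;> rcases unit_cases (ε u.level) with h5 | h5 <;>
    rcases u.sgn_cases with h6 | h6 <;> rw [h5, h6] <;> refine ⟨by omega, fun h7 => ?_⟩
  all_goals first
    | (have h8 := h4 (by omega); omega)
    | (have h8 := h3 (by omega); omega)

theorem exists_norm_legRight_le {c : ℝ} (hc : 0 < c) (p : ℕ → ℝ) (ε : ℕ → ℤˣ)
    {m s s' : Idx n → ℤ} (hs : Compat m s s') {u : Link} (hu : u ∈ links n) :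
    (∀ z ∈ strip c m, 1 / 2 ≤
      (lform c p ε u z + 1 / 2 + ((if lincr ε u m = -1 then 1 else 0 : ℤ) : ℂ)).re) ∧
    ∃ C : ℝ, ∀ z ∈ strip c m, ‖legRight c p ε m s' u z‖ ≤ C := by
  have h1 := abs_le.1 (hs.step.abs_lincr_le ε hu)
  obtain ⟨h2, h3⟩ := hs.step.lincr_bounds hs.right (fun q hq => (hs.disjoint q hq).2) ε hu
  have hre : ∀ z ∈ strip c m, 1 / 2 ≤
      (lform c p ε u z + 1 / 2 + ((if lincr ε u m = -1 then 1 else 0 : ℤ) : ℂ)).re := by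
    rintro z ⟨x, t, ht, rfl⟩
    rw [add_re, add_re, lform_line_re hc, intCast_re]
    have : (1 / 2 : ℂ).re = 1 / 2 := by norm_num
    rw [this]
    obtain ⟨ht0, ht1⟩ := ht
    rcases (by omega : lincr ε u m = -1 ∨ lincr ε u m = 0 ∨ lincr ε u m = 1) with h | h | h <;>
      rw [h] <;> norm_num <;> linarith
  refine ⟨hre, ?_⟩
  rw [abs_le] at h2
  set a : ℤ := if lincr ε u m = -1 then 1 else 0 with ha
  have hk : 0 ≤ 2 + lincr ε u s' - a := by
    by_cases h : lincr ε u m = -1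
    · have := abs_le.1 (h3 (by omega))
      rw [ha, if_pos h]; omega
    · rw [ha, if_neg h]; omega
  refine ⟨2 ^ (2 + lincr ε u s' - a).toNat / c ^ 2, fun z hz => ?_⟩
  have h5 := Gamma_div_shift_le _ (hre z hz) _ hk
  have e : lform c p ε u z + 1 / 2 + (a : ℂ) + ((2 + lincr ε u s' - a : ℤ) : ℂ) =
      lform c p ε u z + lincr ε u s' + 5 / 2 := by push_cast; ring
  rw [e] at h5
  have e2 : ‖(I * c : ℂ) ^ 2‖ = c ^ 2 := by simp
  have e3 : ‖(if lincr ε u m = -1 then -1 else 1 : ℂ)‖ = 1 := by split_ifs <;> simp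
  rw [legRight, norm_mul, e3, one_mul, mul_comm, ← div_div, norm_div, e2]
  gcongr

theorem exists_norm_legLeft_le {c : ℝ} (hc : 0 < c) (p : ℕ → ℝ) (ε : ℕ → ℤˣ)
    {m s s' : Idx n → ℤ} (hs : Compat m s s') {u : Link} (hu : u ∈ links n) :
    (∀ z ∈ strip c m, 1 / 2 ≤
      (-lform c p ε u z + 1 / 2 + ((if lincr ε u m = 1 then 1 else 0 : ℤ) : ℂ)).re) ∧
    ∃ C : ℝ, ∀ z ∈ strip c m, ‖legLeft c p ε m s u z‖ ≤ C := by
  have h1 := abs_le.1 (hs.step.abs_lincr_le ε hu)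
  obtain ⟨h2, h3⟩ := hs.step.lincr_bounds hs.left (fun q hq => (hs.disjoint q hq).1) ε hu
  have hre : ∀ z ∈ strip c m, 1 / 2 ≤
      (-lform c p ε u z + 1 / 2 + ((if lincr ε u m = 1 then 1 else 0 : ℤ) : ℂ)).re := by
    rintro z ⟨x, t, ht, rfl⟩
    rw [add_re, add_re, neg_re, lform_line_re hc, intCast_re]
    have : (1 / 2 : ℂ).re = 1 / 2 := by norm_num
    rw [this]
    obtain ⟨ht0, ht1⟩ := ht
    rcases (by omega : lincr ε u m = -1 ∨ lincr ε u m = 0 ∨ lincr ε u m = 1) with h | h | h <;>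
      rw [h] <;> norm_num <;> linarith
  refine ⟨hre, ?_⟩
  rw [abs_le] at h2
  set a : ℤ := if lincr ε u m = 1 then 1 else 0 with ha
  have hk : 0 ≤ 2 + lincr ε u m + lincr ε u s - a := by
    by_cases h : lincr ε u m = 0
    · rw [ha, if_neg (by omega)]; omega
    · have := abs_le.1 (h3 h)
      rw [ha]; split_ifs <;> omega
  refine ⟨2 ^ (2 + lincr ε u m + lincr ε u s - a).toNat / c ^ 2, fun z hz => ?_⟩
  have h5 := Gamma_div_shift_le _ (hre z hz) _ hk
  have e : -lform c p ε u z + 1 / 2 + (a : ℂ) + ((2 + lincr ε u m + lincr ε u s - a : ℤ) : ℂ) =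
      -lform c p ε u z + lincr ε u m + lincr ε u s + 5 / 2 := by push_cast; ring
  rw [e] at h5
  have e2 : ‖(I * c : ℂ) ^ 2‖ = c ^ 2 := by simp
  rw [legLeft, mul_comm, ← div_div, norm_div, e2]
  gcongr

theorem strip_im_le {c : ℝ} (hc : 0 < c) {m : Idx n → ℤ} (hm : ∀ q, |m q| ≤ 1) :
    ∀ z ∈ strip c m, ∀ q, |(z q).im| ≤ c := by
  rintro z ⟨x, t, ⟨ht0, ht1⟩, rfl⟩ q
  have h2 : |(m q : ℝ)| ≤ 1 := by exact_mod_cast hm q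
  rw [line_im, abs_mul, abs_mul, abs_of_pos hc, abs_of_nonneg ht0]
  have := mul_le_one₀ ht1 (abs_nonneg _) h2
  nlinarith

/-- The imaginary parts of the arguments of `φ` and `ψ` in `core`. -/
theorem core_args {c : ℝ} (m s s' : Idx n → ℤ) (x : Idx n → ℝ) (t : ℝ) :
    tr c (cj (line c m x t)) (m + s) =
        toC x + I • toC (fun q => c * ((1 - t) * m q + s q)) ∧
      tr c (line c m x t) s' = toC x + I • toC (fun q => c * (t * m q + s' q)) := by
  constructor <;> ext q <;> simp [tr, cj, line, toC] <;> ring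

theorem core_args_lt {c R : ℝ} (hc : 0 < c) (hR : c < R) {m s s' : Idx n → ℤ}
    (hs : Compat m s s') {t : ℝ} (ht : t ∈ Set.Icc (0 : ℝ) 1) (q : Idx n) :
    |c * ((1 - t) * m q + s q)| < R ∧ |c * (t * m q + s' q)| < R := by
  obtain ⟨ht0, ht1⟩ := ht
  have h1 : |(m q : ℝ)| ≤ 1 := by exact_mod_cast hs.step.1 q
  have h2 : |(s q : ℝ)| ≤ 1 := by exact_mod_cast hs.left q
  have h3 : |(s' q : ℝ)| ≤ 1 := by exact_mod_cast hs.right q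
  have key : ∀ a : ℝ, |a| ≤ 1 → |c * a| < R := by
    intro a ha
    rw [abs_mul, abs_of_pos hc]; nlinarith
  by_cases h0 : m q = 0
  · rw [h0]; simp only [Int.cast_zero, mul_zero, zero_add]
    exact ⟨key _ h2, key _ h3⟩
  · obtain ⟨h4, h5⟩ := hs.disjoint q h0
    rw [h4, h5]; simp only [Int.cast_zero, add_zero]
    refine ⟨key _ ?_, key _ ?_⟩ <;> rw [abs_mul]
    · rw [abs_of_nonneg (by linarith)]; exact mul_le_one₀ (by linarith) (abs_nonneg _) h1
    · rw [abs_of_nonneg ht0]; exact mul_le_one₀ ht1 (abs_nonneg _) h1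

theorem mem_tube_of_im_lt {R : ℝ} (x y : Idx n → ℝ) (hy : ∀ q, |y q| < R) :
    toC x + I • toC y ∈ tube n R := by
  intro q
  have : ((toC x + I • toC y) q).im = y q := by simp [toC]
  rw [this]
  exact hy q

theorem core_decay {c : ℝ} {p : ℕ → ℝ} {ε : ℕ → ℤˣ} {R : ℝ} {f g φ ψ : Fn n}
    (h : RegPair c p ε R f g φ ψ) {m s s' : Idx n → ℤ} (hs : Compat m s s') {Q : Fn n}
    (hQ : PolyFn Q) {G : Fn n}
    (hG : Tempered (strip c m) (fun x => Real.pi / c * growth n x) G) (M : ℕ) :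
    ∃ C : ℝ, ∀ z ∈ strip c m,
      (1 + ‖rePart z‖) ^ M * ‖core c p ε m s s' Q φ ψ z * G z‖ ≤ C := by
  have hc := h.pos
  have h1 : Tempered (strip c m) (fun x => ∑ u ∈ links n, (0 + 0)) fun z =>
      ∏ u ∈ links n, legLeft c p (-ε) m s u z * legRight c p ε m s' u z := by
    refine Tempered.prod _ fun u hu => ?_
    obtain ⟨C, hC⟩ := (exists_norm_legLeft_le hc p (-ε) hs hu).2
    obtain ⟨C', hC'⟩ := (exists_norm_legRight_le hc p ε hs hu).2
    exact (Tempered.of_bound C hC).mul (Tempered.of_bound C' hC')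
  obtain ⟨C, K, hC, hb⟩ := (h1.mul (hQ.tempered (strip_im_le hc hs.step.1))).mul hG
  obtain ⟨C', hC'⟩ := h.decay (M + K)
  refine ⟨C * C', fun z hz => ?_⟩
  have hz' := hz
  obtain ⟨x, t, ht, rfl⟩ := hz'
  have hb' := hb _ hz
  have hd := hC' x _ _ (fun q => (core_args_lt hc h.lt hs ht q).1)
    (fun q => (core_args_lt hc h.lt hs ht q).2)
  rw [← (core_args m s s' x t).1, ← (core_args m s s' x t).2] at hd
  rw [rePart_line] at hb' ⊢
  simp only [add_zero, Finset.sum_const_zero, zero_add] at hb'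
  rw [core]
  set A := (∏ u ∈ links n, legLeft c p (-ε) m s u (line c m x t) *
    legRight c p ε m s' u (line c m x t)) * Q (line c m x t)
  rw [norm_mul] at hb'
  rw [norm_mul, norm_mul A, norm_mul (conj _), RCLike.norm_conj]
  set a := ‖φ (tr c (cj (line c m x t)) (m + s))‖
  set b := ‖ψ (tr c (line c m x t) s')‖
  calc (1 + ‖x‖) ^ M * (‖A‖ * (a * b) * ‖G (line c m x t)‖)
      = (1 + ‖x‖) ^ M * (a * b) * (‖A‖ * ‖G (line c m x t)‖) := by ring
    _ ≤ (1 + ‖x‖) ^ M * (a * b) *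
        (C * (1 + ‖x‖) ^ K * Real.exp (Real.pi / c * growth n x)) := by gcongr
    _ = C * (a * b * Real.exp (Real.pi / c * growth n x) * (1 + ‖x‖) ^ (M + K)) := by
      rw [pow_add]; ring
    _ ≤ C * C' := by gcongr

theorem tube_isOpen (R : ℝ) : IsOpen (tube n R) := by
  have : tube n R = ⋂ q, {z : Idx n → ℂ | |(z q).im| < R} := by ext z; simp [tube]
  rw [this]
  exact isOpen_iInter_of_finite fun q => isOpen_lt (by fun_prop) continuous_const

theorem differentiableAt_Gamma_of_re {s : ℂ} (hs : 1 / 2 ≤ s.re) : DifferentiableAt ℂ Gamma s :=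
  differentiableAt_Gamma s fun m h => by
    rw [h] at hs
    have : (0 : ℝ) ≤ m := Nat.cast_nonneg m
    simp at hs
    linarith

theorem core_differentiableAt {c : ℝ} {p : ℕ → ℝ} {ε : ℕ → ℤˣ} {R : ℝ} {f g φ ψ : Fn n}
    (h : RegPair c p ε R f g φ ψ) {m s s' : Idx n → ℤ} (hs : Compat m s s') {Q : Fn n}
    (hQ : PolyFn Q) {Z : ℂ → Idx n → ℂ} (hZ : Differentiable ℂ Z) {ζ : ℂ}
    (hζ : Z ζ ∈ strip c m) :
    DifferentiableAt ℂ (fun ζ => core c p ε m s s' Q φ ψ (Z ζ)) ζ := by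
  have hc := h.pos
  have hinv : ∀ F : ℂ → ℂ, DifferentiableAt ℂ F ζ →
      DifferentiableAt ℂ (fun ζ => (Gamma (F ζ))⁻¹) ζ := fun F hF =>
    (differentiable_one_div_Gamma (F ζ)).comp ζ hF
  have hlf : ∀ ε' : ℕ → ℤˣ, ∀ u, DifferentiableAt ℂ (fun ζ => lform c p ε' u (Z ζ)) ζ :=
    fun ε' u => ((PolyFn.lform c p ε' u).differentiable (Z ζ)).comp ζ (hZ ζ)
  have hlegs : DifferentiableAt ℂ (fun ζ => ∏ u ∈ links n,
      legLeft c p (-ε) m s u (Z ζ) * legRight c p ε m s' u (Z ζ)) ζ := by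
    refine DifferentiableAt.fun_finsetProd fun u hu => ?_
    have h1 := (exists_norm_legLeft_le hc p (-ε) hs hu).1 _ hζ
    have h2 := (exists_norm_legRight_le hc p ε hs hu).1 _ hζ
    simp only [legLeft, legRight, div_eq_mul_inv, mul_inv]
    refine DifferentiableAt.mul (DifferentiableAt.mul ?_ (DifferentiableAt.mul
      (differentiableAt_const _) (hinv _ ?_)))
      (DifferentiableAt.mul (differentiableAt_const _) (DifferentiableAt.mul ?_
        (DifferentiableAt.mul (differentiableAt_const _) (hinv _ ?_))))
    · rw [one_div] at h1
      exact DifferentiableAt.comp ζ (g := Gamma) (differentiableAt_Gamma_of_re (by simpa using h1))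
        ((((hlf _ u).neg).add_const _).add_const _)
    · exact ((((hlf _ u).neg).add_const _).add_const _).add_const _
    · rw [one_div] at h2
      exact DifferentiableAt.comp ζ (g := Gamma) (differentiableAt_Gamma_of_re (by simpa using h2))
        (((hlf _ u).add_const _).add_const _)
    · exact ((hlf _ u).add_const _).add_const _
  obtain ⟨x, t, ht, hx⟩ := hζ
  have hargs := core_args (c := c) m s s' x t
  have hlt := core_args_lt hc h.lt hs ht
  have hcoord : ∀ q, Differentiable ℂ fun ζ => Z ζ q := fun q => differentiable_pi.1 hZ q
  have hφ : DifferentiableAt ℂ (fun ζ => conj (φ (tr c (cj (Z ζ)) (m + s)))) ζ := by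
    have hin : Differentiable ℂ fun ζ => tr c (cj (Z (conj ζ))) (m + s) := by
      refine differentiable_pi.2 fun q => ?_
      have h1 : Differentiable ℂ fun ζ => conj (Z (conj ζ) q) := fun w => by
        have := (hcoord q (conj w)).conj_conj
        rw [conj_conj] at this
        exact this
      exact h1.add_const _
    have hout : DifferentiableAt ℂ (fun ζ => φ (tr c (cj (Z (conj ζ))) (m + s))) (conj ζ) := by
      refine DifferentiableAt.comp (conj ζ) (g := φ) ?_ (hin (conj ζ))
      refine (h.left.1 _ ?_).differentiableAt ((tube_isOpen R).mem_nhds ?_) <;>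
      · rw [conj_conj, hx, hargs.1]
        exact mem_tube_of_im_lt _ _ fun q => (hlt q).1
    have := hout.conj_conj
    rw [conj_conj] at this
    refine this.congr_of_eventuallyEq (Filter.Eventually.of_forall fun w => ?_)
    simp only [Function.comp_apply, conj_conj]
  have hψ : DifferentiableAt ℂ (fun ζ => ψ (tr c (Z ζ) s')) ζ := by
    refine DifferentiableAt.comp ζ (g := ψ) ?_
      (differentiable_pi.2 (fun q => (hcoord q).add_const _) ζ)
    refine (h.right.1 _ ?_).differentiableAt ((tube_isOpen R).mem_nhds ?_) <;>
    · rw [hx, hargs.2]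
      exact mem_tube_of_im_lt _ _ fun q => (hlt q).2
  exact (hlegs.mul ((hQ.differentiable (Z ζ)).comp ζ (hZ ζ))).mul (hφ.mul hψ)

theorem core_measurable {c : ℝ} {p : ℕ → ℝ} {ε : ℕ → ℤˣ} {R : ℝ} {f g φ ψ : Fn n}
    (h : RegPair c p ε R f g φ ψ) {m s s' : Idx n → ℤ} (hs : Compat m s s') {Q : Fn n}
    (hQ : PolyFn Q) {t : ℝ} (ht : t ∈ Set.Icc (0 : ℝ) 1) :
    Measurable fun x : Idx n → ℝ => core c p ε m s s' Q φ ψ (line c m x t) := by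
  have hc := h.pos
  have hline : Continuous fun x : Idx n → ℝ => line c m x t := by unfold line; fun_prop
  have hlt := core_args_lt hc h.lt hs ht
  have hlf : ∀ ε' : ℕ → ℤˣ, ∀ u, Measurable fun x : Idx n → ℝ => lform c p ε' u (line c m x t) :=
    fun ε' u => ((PolyFn.lform c p ε' u).differentiable.continuous.comp hline).measurable
  have hφ : Continuous fun x : Idx n → ℝ => φ (tr c (cj (line c m x t)) (m + s)) := by
    refine h.left.1.continuousOn.comp_continuous ?_ fun x => ?_
    · unfold tr cj; fun_prop
    · rw [(core_args m s s' x t).1]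
      exact mem_tube_of_im_lt _ _ fun q => (hlt q).1
  have hψ : Continuous fun x : Idx n → ℝ => ψ (tr c (line c m x t) s') := by
    refine h.right.1.continuousOn.comp_continuous ?_ fun x => ?_
    · unfold tr; fun_prop
    · rw [(core_args m s s' x t).2]
      exact mem_tube_of_im_lt _ _ fun q => (hlt q).2
  unfold core
  refine ((Finset.measurable_fun_prod _ fun u _ => ?_).mul
    (hQ.differentiable.continuous.comp hline).measurable).mul
    ((continuous_conj.comp hφ).mul hψ).measurable
  unfold legLeft legRight
  refine Measurable.mul (Measurable.div (measurable_Gamma.comp ?_) (Measurable.const_mul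
    (measurable_Gamma.comp ?_) _)) (Measurable.const_mul (Measurable.div (measurable_Gamma.comp ?_)
    (Measurable.const_mul (measurable_Gamma.comp ?_) _)) _)
  · exact ((hlf _ u).neg.add_const _).add_const _
  · exact (((hlf _ u).neg.add_const _).add_const _).add_const _
  · exact ((hlf _ u).add_const _).add_const _
  · exact ((hlf _ u).add_const _).add_const _

end SoToda

end

noncomputable section

namespace SoToda

variable {n : ℕ}

/-! ### Denominators -/

theorem levD_tr (c : ℝ) (p : ℕ → ℝ) (l : ℕ) (z : Idx n → ℂ) (m : Idx n → ℤ)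
    (hm : ∀ q, q.1.1 = l → m q = 0) : levD c p l (tr c z m) = levD c p l z := by
  have h : ∀ j, entry p (tr c z m) l j = entry p z l j := by
    intro j
    rw [entry_tr]
    unfold entZ
    split_ifs with h
    · rw [hm _ rfl]; simp
    · simp
  unfold levD
  rw [funext h]

theorem conj_levD (c : ℝ) (p : ℕ → ℝ) (l : ℕ) (z : Idx n → ℂ) :
    conj (levD c p l z) = levD c p l (cj z) := by
  have h1 : ∀ x, conj (singleD c l x) = singleD c l (conj x) := by
    intro x; unfold singleD; split_ifs <;> simp [map_div₀, map_ofNat]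
  have h2 : ∀ x y, conj (pairD c l x y) = pairD c l (conj x) (conj y) := by
    intro x y; unfold pairD; split_ifs <;> simp
  simp only [levD, rowProd, map_mul, map_prod, h1, h2, conj_entry]

theorem conj_den (c : ℝ) (p : ℕ → ℝ) (l j : ℕ) (τ : ℤ) (z : Idx n → ℂ) :
    conj (den c p l j τ z) = den c p l j (-τ) (cj z) := by
  have h1 : ∀ x, conj (singleDen c l τ x) = singleDen c l (-τ) (conj x) := by
    intro x; unfold singleDen; split_ifs <;> simp [map_div₀, map_ofNat]; left; ring
  have h2 : ∀ x y, conj (pairDen c l τ x y) = pairDen c l (-τ) (conj x) (conj y) := by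
    intro x y; unfold pairDen; split_ifs <;> simp
  simp only [den, map_mul, map_prod, h1, h2, conj_entry]

theorem entry_pt_re (c : ℝ) (p : ℕ → ℝ) {l j : ℕ} (h : (l, j) ∈ positions n) (x : Idx n → ℝ)
    (m : Idx n → ℤ) : (entry p (pt c x m) l j).re = x ⟨(l, j), h⟩ := by
  rw [entry_of_mem p _ h]; simp [pt, tr, toC]

theorem den_ne_zero (c : ℝ) (p : ℕ → ℝ) {l j : ℕ} (hl : l ∈ Finset.range (2 * n))
    (hj : j ∈ Finset.Icc 1 ((l + 1) / 2)) (τ : ℤ) {x : Idx n → ℝ} (hx : Generic x)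
    (m : Idx n → ℤ) : den c p l j τ (pt c x m) ≠ 0 := by
  have hpj := position_of_mem hl hj
  have key : ∀ w : ℂ, w.re ≠ 0 → w ≠ 0 := fun w h h' => h (by rw [h']; rfl)
  unfold den
  refine mul_ne_zero ?_ (Finset.prod_ne_zero_iff.2 fun r hr => ?_)
  · unfold singleDen
    split_ifs
    · refine mul_ne_zero (key _ ?_) (key _ ?_)
      · rw [entry_pt_re c p hpj]; exact hx.1 _
      · have : ((τ : ℂ) * (I * c / 2)).re = 0 := by simp
        rw [add_re, this, add_zero, entry_pt_re c p hpj]; exact hx.1 _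
    · exact one_ne_zero
  · have hpr := position_of_mem hl (Finset.mem_of_mem_erase hr)
    have hne := hx.2 ⟨(l, j), hpj⟩ ⟨(l, r), hpr⟩ (by
      intro h
      simp only [Subtype.mk.injEq, Prod.mk.injEq, true_and] at h
      exact Finset.ne_of_mem_erase hr h.symm)
    have h1 : (entry p (pt c x m) l j - entry p (pt c x m) l r).re ≠ 0 := by
      rw [sub_re, entry_pt_re c p hpj, entry_pt_re c p hpr]
      exact sub_ne_zero.2 hne.1
    have h2 : (entry p (pt c x m) l j + entry p (pt c x m) l r).re ≠ 0 := by
      rw [add_re, entry_pt_re c p hpj, entry_pt_re c p hpr]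
      intro h; exact hne.2 (by linarith)
    unfold pairDen
    split_ifs
    · exact mul_ne_zero (key _ h1) (key _ h2)
    · refine mul_ne_zero (key _ h1) (key _ ?_)
      have : ((τ : ℂ) * (I * c)).re = 0 := by simp
      rwa [add_re, this, add_zero]

theorem levD_toC_ne_zero {c : ℝ} (hc : 0 < c) (p : ℕ → ℝ) {l : ℕ}
    (hl : l ∈ Finset.range (2 * n)) {x : Idx n → ℝ} (hx : Generic x) :
    levD c p l (toC x) ≠ 0 := by
  have he : ∀ j (h : (l, j) ∈ positions n), entry p (toC x) l j = (x ⟨(l, j), h⟩ : ℂ) :=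
    fun j h => entry_of_mem p _ h
  unfold levD rowProd
  refine mul_ne_zero (Finset.prod_ne_zero_iff.2 fun r hr => ?_)
    (Finset.prod_ne_zero_iff.2 fun r hr => Finset.prod_ne_zero_iff.2 fun s hs => ?_)
  · rw [he r (position_of_mem hl hr)]
    unfold singleD
    split_ifs
    · have h0 := hx.1 ⟨(l, r), position_of_mem hl hr⟩
      generalize x ⟨(l, r), position_of_mem hl hr⟩ = a at h0
      have : a * (a ^ 2 + c ^ 2 / 4) ≠ 0 := mul_ne_zero h0 (by positivity)
      exact_mod_cast this
    · exact one_ne_zero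
  · have hs' : s ∈ Finset.Icc 1 ((l + 1) / 2) := by
      rw [Finset.mem_Ioc] at hs; rw [Finset.mem_Icc] at hr ⊢; omega
    rw [he r (position_of_mem hl hr), he s (position_of_mem hl hs')]
    have hne := hx.2 ⟨(l, r), position_of_mem hl hr⟩ ⟨(l, s), position_of_mem hl hs'⟩ (by
      intro h
      simp only [Subtype.mk.injEq, Prod.mk.injEq, true_and] at h
      rw [Finset.mem_Ioc] at hs; omega)
    generalize x ⟨(l, r), position_of_mem hl hr⟩ = a at hne
    generalize x ⟨(l, s), position_of_mem hl hs'⟩ = b at hne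
    have h1 : a - b ≠ 0 := sub_ne_zero.2 hne.1
    have h2 : a + b ≠ 0 := fun h => hne.2 (by linarith)
    unfold pairD
    split_ifs
    · have : ((a - b) * (a + b)) ^ 2 ≠ 0 := pow_ne_zero 2 (mul_ne_zero h1 h2)
      exact_mod_cast this
    · have : (a - b) ^ 2 * ((a + b) ^ 2 + c ^ 2) ≠ 0 :=
        mul_ne_zero (pow_ne_zero 2 h1) (by positivity)
      exact_mod_cast this

/-- The product of the denominators of the levels in `S`. -/
def prodD (c : ℝ) (p : ℕ → ℝ) (S : Finset ℕ) (z : Idx n → ℂ) : ℂ := ∏ l ∈ S, levD c p l z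

theorem prodD_tr (c : ℝ) (p : ℕ → ℝ) (S : Finset ℕ) (z : Idx n → ℂ) (m : Idx n → ℤ)
    (hm : ∀ q, q.1.1 ∈ S → m q = 0) : prodD c p S (tr c z m) = prodD c p S z :=
  Finset.prod_congr rfl fun _ hl => levD_tr c p _ z m fun q hq => hm q (hq ▸ hl)

theorem conj_prodD (c : ℝ) (p : ℕ → ℝ) (S : Finset ℕ) (z : Idx n → ℂ) :
    conj (prodD c p S z) = prodD c p S (cj z) := by
  simp only [prodD, map_prod, conj_levD]

/-- The density at level `l`, divided by the denominator if `l ∈ T`. -/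
def levQ (c : ℝ) (p : ℕ → ℝ) (T : Finset ℕ) (l : ℕ) (z : Idx n → ℂ) : ℂ :=
  lev c p l z / if l ∈ T then levD c p l z else 1

theorem mu_div_prodD (c : ℝ) (p : ℕ → ℝ) {S S' : Finset ℕ} (hd : Disjoint S S')
    (hS : S ∪ S' ⊆ Finset.range (2 * n)) (z : Idx n → ℂ) :
    mu n c p z / (prodD c p S z * prodD c p S' z) =
      ∏ l ∈ Finset.range (2 * n), levQ c p (S ∪ S') l z := by
  simp only [levQ, Finset.prod_div_distrib]
  rw [mu_eq_prod_lev, prodD, prodD, ← Finset.prod_union hd, Finset.prod_ite_mem,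
    Finset.inter_eq_right.2 hS]

theorem tempered_levQ {c : ℝ} (hc : 0 < c) (p : ℕ → ℝ) {Ω : Set (Idx n → ℂ)} {B : ℝ}
    (hΩ : ∀ z ∈ Ω, ∀ q, |(z q).im| ≤ B) {l : ℕ} (hl : l ∈ Finset.range (2 * n)) (T : Finset ℕ)
    (hT : l ∈ T → ∀ z ∈ Ω, ∀ q : Idx n, q.1.1 = l → (z q).im = 0) :
    Tempered Ω (levExp c l) fun z => levQ c p T l z := by
  unfold levQ
  split_ifs with h
  · exact tempered_lev_div hc p hl (hT h)
  · simpa using tempered_lev hc p hΩ hl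

theorem measurable_levQ {c : ℝ} (hc : 0 < c) (p : ℕ → ℝ) (T : Finset ℕ) (l : ℕ) :
    Measurable fun z : Idx n → ℂ => levQ c p T l z := by
  unfold levQ
  refine (differentiable_lev hc p l).continuous.measurable.div ?_
  split_ifs
  · exact (PolyFn.levD c p l).differentiable.continuous.measurable
  · exact measurable_const

/-! ### Functions obtained by applying operators -/

/-- `F` is obtained from `f` by operators of the levels in `S`: at the lattice points that are real
in the levels of `S`, it is a sum of terms with poles only on the denominators of these levels. -/
inductive Rep (c : ℝ) (p : ℕ → ℝ) (ε : ℕ → ℤˣ) (S : Finset ℕ) (f : Fn n) : Fn n → Prop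
  | term (q : Fn n) (hq : PolyFn q) (s : Idx n → ℤ) (hs : ∀ i, |s i| ≤ 1)
      (hsS : ∀ i : Idx n, i.1.1 ∉ S → s i = 0) (F : Fn n)
      (hF : ∀ x, Generic x → ∀ m : Idx n → ℤ, (∀ i, i.1.1 ∈ S → m i = 0) →
        F (pt c x m) = q (pt c x m) / prodD c p S (pt c x m) *
          (gauge c p ε (pt c x m) / gauge c p ε (pt c x (m + s)) * f (pt c x (m + s)))) :
      Rep c p ε S f F
  | add (F₁ F₂ F : Fn n) (h₁ : Rep c p ε S f F₁) (h₂ : Rep c p ε S f F₂)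
      (hF : ∀ x, Generic x → ∀ m : Idx n → ℤ, (∀ i, i.1.1 ∈ S → m i = 0) →
        F (pt c x m) = F₁ (pt c x m) + F₂ (pt c x m)) : Rep c p ε S f F

theorem Rep.self {c : ℝ} (hc : 0 < c) (p : ℕ → ℝ) (ε : ℕ → ℤˣ) (f : Fn n) :
    Rep c p ε ∅ f f := by
  refine .term (fun _ => 1) (.const 1) 0 (by simp) (fun _ _ => rfl) f fun x _ m _ => ?_
  rw [add_zero, div_self (gauge_pt_ne_zero hc p ε x m), prodD, Finset.prod_empty]
  simp

theorem Rep.zero (c : ℝ) (p : ℕ → ℝ) (ε : ℕ → ℤˣ) (S : Finset ℕ) (f : Fn n) :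
    Rep c p ε S f fun _ => 0 :=
  .term (fun _ => 0) (.const 0) 0 (by simp) (fun _ _ => rfl) _ fun x _ m _ => by simp

theorem Rep.const_mul {c : ℝ} {p : ℕ → ℝ} {ε : ℕ → ℤˣ} {S : Finset ℕ} {f F : Fn n}
    (h : Rep c p ε S f F) (a : ℂ) : Rep c p ε S f fun z => a * F z := by
  induction h with
  | term q hq s hs hsS F hF =>
    exact .term (fun z => a * q z) ((PolyFn.const a).mul hq) s hs hsS _ fun x hx m hm => by
      rw [hF x hx m hm]; ring
  | add F₁ F₂ F _ _ hF h1 h2 =>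
    exact .add _ _ _ h1 h2 fun x hx m hm => by rw [hF x hx m hm]; ring

theorem Rep.sub {c : ℝ} {p : ℕ → ℝ} {ε : ℕ → ℤˣ} {S : Finset ℕ} {f F G : Fn n}
    (h : Rep c p ε S f F) (h' : Rep c p ε S f G) : Rep c p ε S f fun z => F z - G z :=
  .add _ _ _ h (h'.const_mul (-1)) fun x _ m _ => by ring

/-- The coefficients `a` of the translation by `m₀` in an operator of level `l`. -/
structure IsCoeff (c : ℝ) (p : ℕ → ℝ) (l : ℕ) (m₀ : Idx n → ℤ) (a : Fn n) : Prop where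
  abs_le : ∀ q, |m₀ q| ≤ 1
  supp : ∀ q : Idx n, q.1.1 ≠ l → m₀ q = 0
  rat : ∀ ε : ℕ → ℤˣ, ∃ Q : Fn n, PolyFn Q ∧ ∀ x, Generic x → ∀ m : Idx n → ℤ,
    (∀ i, i.1.1 = l → m i = 0) → a (pt c x m) * gauge c p ε (pt c x (m + m₀)) =
      Q (pt c x m) / levD c p l (pt c x m) * gauge c p ε (pt c x m)

theorem Rep.comp {c : ℝ} (hc : 0 < c) {p : ℕ → ℝ} {ε : ℕ → ℤˣ} {S : Finset ℕ} {f F : Fn n}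
    (h : Rep c p ε S f F) {l : ℕ} (hl : l ∉ S) {m₀ : Idx n → ℤ} {a : Fn n}
    (ha : IsCoeff c p l m₀ a) : Rep c p ε (insert l S) f fun z => a z * F (tr c z m₀) := by
  have hm₀S : ∀ i : Idx n, i.1.1 ∈ S → m₀ i = 0 := fun i hi =>
    ha.supp i fun h => hl (h ▸ hi)
  have hgood : ∀ m : Idx n → ℤ, (∀ i, i.1.1 ∈ insert l S → m i = 0) →
      ∀ i : Idx n, i.1.1 ∈ S → (m + m₀) i = 0 := by
    intro m hm i hi
    rw [Pi.add_apply, hm i (Finset.mem_insert_of_mem hi), hm₀S i hi, add_zero]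
  induction h with
  | term q hq s hs hsS F hF =>
    obtain ⟨Q, hQ, hQa⟩ := ha.rat ε
    refine .term (fun z => Q z * q (tr c z m₀)) (hQ.mul (hq.tr c m₀)) (m₀ + s) ?_ ?_ _ ?_
    · intro i
      by_cases hi : i.1.1 = l
      · rw [Pi.add_apply, hsS i (hi ▸ hl), add_zero]; exact ha.abs_le i
      · rw [Pi.add_apply, ha.supp i hi, zero_add]; exact hs i
    · intro i hi
      rw [Finset.mem_insert, not_or] at hi
      rw [Pi.add_apply, ha.supp i hi.1, hsS i hi.2, add_zero]
    · intro x hx m hm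
      have e := hQa x hx m fun i hi => hm i (by rw [hi]; exact Finset.mem_insert_self _ _)
      rw [tr_pt, hF x hx (m + m₀) (hgood m hm), ← tr_pt c x m m₀,
        prodD_tr c p S _ m₀ hm₀S, tr_pt, add_assoc]
      have e2 : prodD c p (insert l S) (pt c x m) =
          levD c p l (pt c x m) * prodD c p S (pt c x m) := Finset.prod_insert hl
      rw [e2]
      have h1 := gauge_pt_ne_zero hc p ε x (m + (m₀ + s))
      calc _ = (a (pt c x m) * gauge c p ε (pt c x (m + m₀))) *
            (q (pt c x (m + m₀)) / prodD c p S (pt c x m) *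
              (f (pt c x (m + (m₀ + s))) / gauge c p ε (pt c x (m + (m₀ + s))))) := by ring
        _ = _ := by rw [e]; ring
  | add F₁ F₂ F _ _ hF h1 h2 =>
    exact .add _ _ _ h1 h2 fun x hx m hm => by
      rw [tr_pt, hF x hx _ (hgood m hm)]; ring

/-! ### Convergence of the pairing -/

theorem Rep.integrable {c : ℝ} {p : ℕ → ℝ} {ε : ℕ → ℤˣ} {R : ℝ} {f g φ ψ : Fn n}
    (h : RegPair c p ε R f g φ ψ) {S S' : Finset ℕ} (hd : Disjoint S S')
    (hS : S ∪ S' ⊆ Finset.range (2 * n)) {F G : Fn n} (hF : Rep c p (-ε) S f F)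
    (hG : Rep c p ε S' g G) : Integrable (integrand n c p F G) := by
  have hc := h.pos
  have hadd : ∀ A B D : (Idx n → ℝ) → ℂ, Integrable A → Integrable B →
      (∀ x, Generic x → D x = A x + B x) → Integrable D := fun A B D hA hB hD =>
    (hA.add hB).congr (ae_generic.mono fun x hx => (hD x hx).symm)
  induction hF with
  | add F₁ F₂ F _ _ hF h1 h2 =>
    refine hadd _ _ _ h1 h2 fun x hx => ?_
    have := hF x hx 0 fun _ _ => rfl
    rw [pt_zero] at this
    rw [integrand, integrand, integrand, this, map_add]; ring
  | term q hq s hs hsS F hF =>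
    induction hG with
    | add G₁ G₂ G _ _ hG h1 h2 =>
      refine hadd _ _ _ h1 h2 fun x hx => ?_
      have := hG x hx 0 fun _ _ => rfl
      rw [pt_zero] at this
      rw [integrand, integrand, integrand, this]; ring
    | term q' hq' s' hs' hsS' G hG =>
      have hcomp : Compat (0 : Idx n → ℤ) s s' := ⟨isStep_zero, hs, hs', by simp⟩
      have him : ∀ z ∈ strip c (0 : Idx n → ℤ), ∀ q, (z q).im = 0 := by
        rintro z ⟨x, t, -, rfl⟩ q
        rw [line_im]; simp
      have hQ : PolyFn fun z => conj (q (tr c (cj z) 0)) * q' z := by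
        simp only [tr_zero]; exact hq.star.mul hq'
      have hL : Tempered (strip c (0 : Idx n → ℤ)) (fun x => Real.pi / c * growth n x)
          fun z => ∏ l ∈ Finset.range (2 * n), levQ c p (S ∪ S') l z := by
        refine (Tempered.prod _ fun l hl => tempered_levQ hc p (B := 0)
          (fun z hz q => by rw [him z hz q]; simp) hl _ fun _ z hz q _ => him z hz q).mono
          fun x => (sum_levExp c x).le
      obtain ⟨C, hC⟩ := core_decay h hcomp hQ hL (Fintype.card (Idx n) + 1)
      have hm : Measurable fun x : Idx n → ℝ =>
          core c p ε 0 s s' (fun z => conj (q (tr c (cj z) 0)) * q' z) φ ψ (line c 0 x 0) *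
          ∏ l ∈ Finset.range (2 * n), levQ c p (S ∪ S') l (line c 0 x 0) := by
        refine (core_measurable h hcomp hQ (by simp)).mul
          (Finset.measurable_fun_prod _ fun l _ => (measurable_levQ hc p _ l).comp ?_)
        have : Continuous fun x : Idx n → ℝ => line c 0 x 0 := by unfold line; fun_prop
        exact this.measurable
      refine (integrable_of_rapid_decay _ hm.aestronglyMeasurable C
        (Filter.Eventually.of_forall fun x => ?_)).congr (ae_generic.mono fun x hx => ?_)
      · have := hC (line c 0 x 0) ⟨x, 0, by simp, rfl⟩
        rwa [rePart_line] at this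
      · have e1 := hF x hx 0 fun _ _ => rfl
        have e2 := hG x hx 0 fun _ _ => rfl
        have e3 := core_eq h hcomp q q' x (m := 0) (Or.inl rfl)
        have e4 : ∀ ε' : ℕ → ℤˣ, ∀ u, ∀ z : Idx n → ℂ, cancel c p ε' 0 u z = 1 := by
          intro ε' u z; simp [cancel, lincr_zero]
        simp only [e4, mul_one, Finset.prod_const_one, one_mul, sub_zero] at e3
        change core c p ε 0 s s' (fun z => conj (q (tr c (cj z) 0)) * q' z) φ ψ (line c 0 x 0) *
          ∏ l ∈ Finset.range (2 * n), levQ c p (S ∪ S') l (line c 0 x 0) =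
          conj (F (toC x)) * G (toC x) * mu n c p (toC x)
        rw [line_zero, ← e3, ← mu_div_prodD c p hd hS, ← pt_zero c x, e1, e2]
        simp only [map_mul, map_div₀, conj_prodD, cj_pt, neg_zero]
        ring

theorem pairing_congr_add_left (c : ℝ) (p : ℕ → ℝ) {F F₁ F₂ G : Fn n}
    (h₁ : Integrable (integrand n c p F₁ G)) (h₂ : Integrable (integrand n c p F₂ G))
    (h : ∀ x, Generic x → F (toC x) = F₁ (toC x) + F₂ (toC x)) :
    pairing n c p F G = pairing n c p F₁ G + pairing n c p F₂ G := by
  rw [pairing, pairing, pairing, ← integral_add h₁ h₂]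
  refine integral_congr_ae (ae_generic.mono fun x hx => ?_)
  simp only [integrand, h x hx, map_add]; ring

theorem pairing_congr_add_right (c : ℝ) (p : ℕ → ℝ) {F G G₁ G₂ : Fn n}
    (h₁ : Integrable (integrand n c p F G₁)) (h₂ : Integrable (integrand n c p F G₂))
    (h : ∀ x, Generic x → G (toC x) = G₁ (toC x) + G₂ (toC x)) :
    pairing n c p F G = pairing n c p F G₁ + pairing n c p F G₂ := by
  rw [pairing, pairing, pairing, ← integral_add h₁ h₂]
  refine integral_congr_ae (ae_generic.mono fun x hx => ?_)
  simp only [integrand, h x hx]; ring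

theorem pairing_const_mul_left (c : ℝ) (p : ℕ → ℝ) (a : ℂ) (F G : Fn n) :
    pairing n c p (fun z => a * F z) G = conj a * pairing n c p F G := by
  rw [pairing, pairing, ← integral_const_mul]
  congr 1; ext x; simp only [integrand, map_mul]; ring

theorem pairing_const_mul_right (c : ℝ) (p : ℕ → ℝ) (a : ℂ) (F G : Fn n) :
    pairing n c p F (fun z => a * G z) = a * pairing n c p F G := by
  rw [pairing, pairing, ← integral_const_mul]
  congr 1; ext x; simp only [integrand]; ring

end SoToda

end

noncomputable section

namespace SoToda

variable {n : ℕ}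

/-! ### Translations of one entry -/

/-- `a` is the coefficient of the translation `γ_{l,j} ↦ γ_{l,j} + σ ic` in a skew-adjoint
operator. -/
structure IsShiftCoeff (c : ℝ) (p : ℕ → ℝ) (q : Idx n) (σ : ℤ) (a : Fn n) : Prop where
  sign : σ = 1 ∨ σ = -1
  exists_eq : ∀ ε : ℕ → ℤˣ, ∃ K : ℂ, ∀ z, a z = K * (∏ t ∈ links n,
    (cancel c p ε (Pi.single q σ) t z * cancel c p (-ε) (Pi.single q σ) t z)) /
      den c p q.1.1 q.1.2 σ z
  adjoint : ∀ x, Generic x → conj (a (pt c x (-Pi.single q σ))) * mu n c p (pt c x (Pi.single q σ)) =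
    -(a (toC x) * mu n c p (toC x))

theorem Idx.level_mem (q : Idx n) : q.1.1 ∈ Finset.range (2 * n) := by
  obtain ⟨⟨l, j⟩, h⟩ := q
  have := mem_positions.1 h
  rw [Finset.mem_range]; dsimp only; omega

theorem Idx.index_mem (q : Idx n) : q.1.2 ∈ Finset.Icc 1 ((q.1.1 + 1) / 2) := by
  obtain ⟨⟨l, j⟩, h⟩ := q
  have := mem_positions.1 h
  rw [Finset.mem_Icc]; dsimp only; omega

theorem levD_pt_ne_zero {c : ℝ} (hc : 0 < c) (p : ℕ → ℝ) {l : ℕ}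
    (hl : l ∈ Finset.range (2 * n)) {x : Idx n → ℝ} (hx : Generic x) {m : Idx n → ℤ}
    (hm : ∀ i, i.1.1 = l → m i = 0) : levD c p l (pt c x m) ≠ 0 := by
  rw [pt, levD_tr c p l _ m hm]
  exact levD_toC_ne_zero hc p hl hx

theorem PolyFn.cancel (c : ℝ) (p : ℕ → ℝ) (ε : ℕ → ℤˣ) (m : Idx n → ℤ) (t : Link) :
    PolyFn fun z => cancel c p ε m t z := by
  unfold SoToda.cancel
  split_ifs
  · exact (PolyFn.lform c p ε t).sub (.const _)
  · exact .const _

theorem IsShiftCoeff.isCoeff {c : ℝ} (hc : 0 < c) {p : ℕ → ℝ} {q : Idx n} {σ : ℤ} {a : Fn n}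
    (h : IsShiftCoeff c p q σ a) : IsCoeff c p q.1.1 (Pi.single q σ) a := by
  have hσ : |σ| ≤ 1 := by rcases h.sign with h | h <;> simp [h]
  have hstep := isStep_single q hσ
  refine ⟨hstep.1, fun q' hq' => ?_, fun ε => ?_⟩
  · rw [Pi.single_eq_of_ne]; rintro rfl; exact hq' rfl
  · obtain ⟨K, hK⟩ := h.exists_eq ε
    obtain ⟨Qd, hQd, hd⟩ := exists_levD_eq (n := n) (c := c) p q.index_mem h.sign
    refine ⟨fun z => K * (∏ t ∈ links n, SoToda.cancel c p (-ε) (Pi.single q σ) t z) *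
      (∏ t ∈ links n, if lincr ε t (Pi.single q σ) = 1 then lform c p ε t z + 1 / 2 else 1) *
      Qd z, ?_, fun x hx m hm => ?_⟩
    · refine (((PolyFn.const K).mul (PolyFn.prod _ _ fun t _ => .cancel c p _ _ t)).mul
        (PolyFn.prod _ _ fun t _ => ?_)).mul hQd
      split_ifs
      · exact (PolyFn.lform c p ε t).add (.const _)
      · exact .const _
    · have e := cancel_mul_gauge hc p ε hstep x m
      have hne := levD_pt_ne_zero hc p q.level_mem hx hm
      rw [hd] at hne ⊢
      have h1 := left_ne_zero_of_mul hne
      have h2 := right_ne_zero_of_mul hne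
      rw [hK, Finset.prod_mul_distrib]
      rw [div_mul_eq_mul_div, div_mul_eq_mul_div, div_eq_div_iff h1 hne]
      linear_combination (K * (∏ t ∈ links n,
        SoToda.cancel c p (-ε) (Pi.single q σ) t (pt c x m)) *
        (den c p q.1.1 q.1.2 σ (pt c x m) * Qd (pt c x m))) * e

theorem levQ_congr (c : ℝ) (p : ℕ → ℝ) (T : Finset ℕ) (l : ℕ) {z z' : Idx n → ℂ}
    (h : ∀ q : Idx n, q.1.1 = l → z q = z' q) : levQ c p T l z = levQ c p T l z' := by
  have h1 : ∀ j, entry p z l j = entry p z' l j := by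
    intro j
    unfold entry
    split_ifs with h2
    · exact h _ rfl
    · rfl
    · rfl
  unfold levQ lev levD
  rw [funext h1]

theorem update_eq_line {c : ℝ} (hc : 0 < c) {σ : ℤ} (hσ : σ = 1 ∨ σ = -1) (q : Idx n)
    (x : Idx n → ℝ) (ζ : ℂ) : Function.update (toC x) q ζ =
      line c (Pi.single q σ) (Function.update x q ζ.re) (σ * ζ.im / c) := by
  have hc' : (c : ℂ) ≠ 0 := by exact_mod_cast hc.ne'
  have hσ' : (σ : ℂ) * σ = 1 := by rcases hσ with rfl | rfl <;> norm_num
  ext i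
  by_cases hi : i = q
  · subst hi
    simp only [Function.update_self, line, Pi.single_eq_same]
    push_cast
    have : I * (c : ℂ) * (σ * ζ.im / c * σ) = (σ * σ) * (ζ.im * I) := by field_simp
    rw [this, hσ', one_mul, re_add_im]
  · simp [line, hi, toC]

theorem mem_Icc_of_mem_uIcc {c : ℝ} (hc : 0 < c) {σ : ℤ} (hσ : σ = 1 ∨ σ = -1) {y : ℝ}
    (hy : y ∈ Set.uIcc 0 (σ * c)) : σ * y / c ∈ Set.Icc (0 : ℝ) 1 := by
  rw [Set.mem_uIcc] at hy
  rw [Set.mem_Icc, div_le_one hc, le_div_iff₀ hc]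
  rcases hσ with rfl | rfl <;> push_cast at hy ⊢ <;>
    rcases hy with ⟨h1, h2⟩ | ⟨h1, h2⟩ <;> constructor <;> linarith

theorem levX_tr_single {c : ℝ} (hc : 0 < c) (p : ℕ → ℝ) (q : Idx n) {σ : ℤ}
    (hσ : σ = 1 ∨ σ = -1) (z : Idx n → ℂ) :
    levX c p q.1.1 q.1.2 (-σ) (tr c z (Pi.single q σ)) =
      (if q.1.1 % 2 = 0 then -1 else 1) * levX c p q.1.1 q.1.2 σ z := by
  have := levX_tr hc p q.2 (τ := -σ) (by omega) z
  rwa [neg_neg] at this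

theorem lev_tr_of_ne (c : ℝ) (p : ℕ → ℝ) (q : Idx n) (σ : ℤ) {l : ℕ} (hl : l ≠ q.1.1)
    (z : Idx n → ℂ) : lev c p l (tr c z (Pi.single q σ)) = lev c p l z := by
  have h := levQ_congr c p ∅ l (z := tr c z (Pi.single q σ)) (z' := z) fun q' hq' => by
    rw [tr, Pi.single_eq_of_ne (by rintro rfl; exact hl hq'.symm)]; simp
  simpa [levQ] using h

/-- The density satisfies the difference equation of the adjoint coefficient. -/
theorem isShiftCoeff_of_num {c : ℝ} (hc : 0 < c) {p : ℕ → ℝ} {q : Idx n} {σ : ℤ}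
    (hσ : σ = 1 ∨ σ = -1) (b : ℂ) (hb : conj b * (if q.1.1 % 2 = 0 then -1 else 1) = -b)
    (num : Fn n)
    (hnum : ∀ ε : ℕ → ℤˣ, ∃ K : ℂ, ∀ z, num z = K * ∏ t ∈ links n,
      (cancel c p ε (Pi.single q σ) t z * cancel c p (-ε) (Pi.single q σ) t z))
    (hadj : ∀ x, conj (num (pt c x (-Pi.single q σ))) = num (toC x)) :
    IsShiftCoeff c p q σ fun z => b * num z / den c p q.1.1 q.1.2 σ z := by
  refine ⟨hσ, fun ε => ?_, fun x hx => ?_⟩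
  · obtain ⟨K, hK⟩ := hnum ε
    exact ⟨b * K, fun z => by rw [hK]; ring⟩
  · have hσ' : -σ = 1 ∨ -σ = -1 := by omega
    rw [mu_eq_prod_lev, mu_eq_prod_lev, ← Finset.mul_prod_erase _ _ q.level_mem,
      ← Finset.mul_prod_erase (Finset.range (2 * n)) (fun l => lev c p l (toC x)) q.level_mem,
      lev_eq hc p q.index_mem hσ', lev_eq hc p q.index_mem hσ (toC x)]
    have e1 : levX c p q.1.1 q.1.2 (-σ) (pt c x (Pi.single q σ)) = _ :=
      levX_tr_single hc p q hσ (toC x)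
    have e2 : ∏ l ∈ (Finset.range (2 * n)).erase q.1.1, lev c p l (pt c x (Pi.single q σ)) =
        ∏ l ∈ (Finset.range (2 * n)).erase q.1.1, lev c p l (toC x) :=
      Finset.prod_congr rfl fun l hl => lev_tr_of_ne c p q σ (Finset.ne_of_mem_erase hl) _
    have h1 := den_ne_zero c p q.level_mem q.index_mem (-σ) hx (Pi.single q σ)
    have h2 := den_ne_zero c p q.level_mem q.index_mem σ hx 0
    rw [pt_zero] at h2
    rw [map_div₀, map_mul, conj_den, cj_pt, neg_neg, hadj, e1, e2]
    rw [div_mul_eq_mul_div, div_mul_eq_mul_div, ← neg_div, div_eq_div_iff h1 h2]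
    generalize ∏ l ∈ (Finset.range (2 * n)).erase q.1.1, lev c p l (toC x) = P
    linear_combination (num (toC x) * levX c p q.1.1 q.1.2 σ (toC x) * P *
      den c p q.1.1 q.1.2 (-σ) (pt c x (Pi.single q σ)) * den c p q.1.1 q.1.2 σ (toC x)) * hb

/-- Skew-adjointness of a translation on single terms, by a shift of the contour. -/
theorem pairing_shift_term {c : ℝ} {p : ℕ → ℝ} {ε : ℕ → ℤˣ} {R : ℝ} {f g φ ψ : Fn n}
    (h : RegPair c p ε R f g φ ψ) {q : Idx n} {σ : ℤ} {a : Fn n}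
    (ha : IsShiftCoeff c p q σ a) {S S' : Finset ℕ} (hd : Disjoint S S')
    (hS : S ∪ S' ⊆ Finset.range (2 * n)) (hqS : q.1.1 ∉ S) (hqS' : q.1.1 ∉ S')
    {qf qg : Fn n} (hqf : PolyFn qf) (hqg : PolyFn qg) {s s' : Idx n → ℤ} (hs : ∀ i, |s i| ≤ 1)
    (hs' : ∀ i, |s' i| ≤ 1) (hsS : ∀ i : Idx n, i.1.1 ∉ S → s i = 0)
    (hsS' : ∀ i : Idx n, i.1.1 ∉ S' → s' i = 0) {F G : Fn n}
    (hF : ∀ x, Generic x → ∀ m : Idx n → ℤ, (∀ i, i.1.1 ∈ S → m i = 0) →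
        F (pt c x m) = qf (pt c x m) / prodD c p S (pt c x m) *
          (gauge c p (-ε) (pt c x m) / gauge c p (-ε) (pt c x (m + s)) * f (pt c x (m + s))))
    (hG : ∀ x, Generic x → ∀ m : Idx n → ℤ, (∀ i, i.1.1 ∈ S' → m i = 0) →
        G (pt c x m) = qg (pt c x m) / prodD c p S' (pt c x m) *
          (gauge c p ε (pt c x m) / gauge c p ε (pt c x (m + s')) * g (pt c x (m + s')))) :
    pairing n c p (fun z => a z * F (tr c z (Pi.single q σ))) G =
      -pairing n c p F fun z => a z * G (tr c z (Pi.single q σ)) := by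
  have hc := h.pos
  have hσ := ha.sign
  have hσ' : -σ = 1 ∨ -σ = -1 := by omega
  set m₀ : Idx n → ℤ := Pi.single q σ with hm₀
  have hstep : IsStep m₀ := isStep_single q (by rcases hσ with h | h <;> simp [h])
  have hm₀q : ∀ i : Idx n, i.1.1 ≠ q.1.1 → m₀ i = 0 := fun i hi => by
    rw [hm₀, Pi.single_eq_of_ne]; rintro rfl; exact hi rfl
  have hm₀S : ∀ i : Idx n, i.1.1 ∈ S → m₀ i = 0 := fun i hi =>
    hm₀q i fun h' => hqS (h' ▸ hi)
  have hm₀S' : ∀ i : Idx n, i.1.1 ∈ S' → m₀ i = 0 := fun i hi =>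
    hm₀q i fun h' => hqS' (h' ▸ hi)
  have hcomp : Compat m₀ s s' := by
    refine ⟨hstep, hs, hs', fun i hi => ?_⟩
    have : i.1.1 = q.1.1 := by by_contra h'; exact hi (hm₀q i h')
    exact ⟨hsS i (this ▸ hqS), hsS' i (this ▸ hqS')⟩
  obtain ⟨K, hK⟩ := ha.exists_eq ε
  set Q : Fn n := fun z => conj (qf (tr c (cj z) m₀)) * qg z with hQdef
  have hQ : PolyFn Q := (hqf.tr c m₀).star.mul hqg
  set E : Fn n := fun z => levX c p q.1.1 q.1.2 (-σ) z *
    ∏ l ∈ (Finset.range (2 * n)).erase q.1.1, levQ c p (S ∪ S') l z with hE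
  set H : Fn n := fun z => conj K * (core c p ε m₀ s s' Q φ ψ z * E z) with hH
  have key : ∀ x, Generic x → ∀ m : Idx n → ℤ, (m = 0 ∨ m = m₀) →
      H (pt c x m) = conj (a (pt c x (-m)) * F (pt c x (m₀ - m))) * G (pt c x m) *
        mu n c p (pt c x m) := by
    intro x hx m hm
    have z1 : ∀ i : Idx n, i.1.1 ∈ S → (m₀ - m) i = 0 := by
      intro i hi
      have := hm₀S i hi
      rcases hm with rfl | rfl <;> simp [this]
    have z2 : ∀ i : Idx n, i.1.1 ∈ S' → m i = 0 := by
      intro i hi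
      have := hm₀S' i hi
      rcases hm with rfl | rfl <;> simp [this]
    have e1 := core_eq h hcomp qf qg x hm
    have e2 : conj (prodD c p S (pt c x (m₀ - m))) = prodD c p S (pt c x m) := by
      rw [conj_prodD, cj_pt, show -(m₀ - m) = m + -m₀ by abel, ← tr_pt]
      exact prodD_tr c p S _ _ fun i hi => by simp [hm₀S i hi]
    have e3 := mu_div_prodD c p hd hS (pt c x m)
    rw [← Finset.mul_prod_erase _ _ q.level_mem] at e3
    have e4 : levQ c p (S ∪ S') q.1.1 (pt c x m) = levX c p q.1.1 q.1.2 (-σ) (pt c x m) *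
        den c p q.1.1 q.1.2 (-σ) (pt c x m) := by
      rw [levQ, if_neg (by simp [hqS, hqS']), div_one, lev_eq hc p q.index_mem hσ']
    have h1 := den_ne_zero c p q.level_mem q.index_mem (-σ) hx m
    have e5 : E (pt c x m) = mu n c p (pt c x m) / (prodD c p S (pt c x m) *
        prodD c p S' (pt c x m)) / den c p q.1.1 q.1.2 (-σ) (pt c x m) := by
      rw [e3, e4, hE]; field_simp
    have e6 : conj (a (pt c x (-m))) = conj K * conj (∏ t ∈ links n,
        (cancel c p ε m₀ t (pt c x (-m)) * cancel c p (-ε) m₀ t (pt c x (-m)))) /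
        den c p q.1.1 q.1.2 (-σ) (pt c x m) := by
      rw [hK, map_div₀, map_mul, conj_den, cj_pt, neg_neg]
    rw [hF x hx _ z1, hG x hx _ z2, map_mul, e6, hH]
    simp only []
    rw [← e1, e5]
    simp only [map_mul, map_div₀, e2]
    ring
  have hzero : ∀ x : Idx n → ℝ, H (fun i => (x i : ℂ)) = H (pt c x 0) := by
    intro x; rw [pt_zero]; rfl
  have hone : ∀ x : Idx n → ℝ, H (Function.update (fun i => (x i : ℂ)) q
      (x q + ((σ * c : ℝ) : ℂ) * I)) = H (pt c x m₀) := by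
    intro x
    congr 1
    ext i
    by_cases hi : i = q
    · subst hi; simp [pt, tr, toC, hm₀]; ring
    · simp [pt, tr, toC, hm₀, hi]
  have hT : Tempered (strip c m₀) (fun x => Real.pi / c * growth n x) E := by
    have him := strip_im_le hc hstep.1
    refine ((tempered_levX hc p him q.level_mem q.index_mem (-σ)).mul
      (Tempered.prod _ fun l hl => tempered_levQ hc p him (Finset.mem_of_mem_erase hl) _ ?_)).mono
        fun x => ?_
    · rintro - z ⟨x, t, -, rfl⟩ i hi
      rw [line_im, hm₀q i (hi ▸ Finset.ne_of_mem_erase hl)]; simp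
    · rw [← sum_levExp, ← Finset.add_sum_erase _ _ q.level_mem]
  obtain ⟨C, hC⟩ := core_decay h hcomp hQ hT (Fintype.card (Idx n) + 1)
  have hline : ∀ (x : Idx n → ℝ) (y : ℝ),
      Function.update (fun i => (x i : ℂ)) q (x q + y * I) = line c m₀ x (σ * y / c) := by
    intro x y
    have := update_eq_line hc hσ q x (x q + y * I)
    have e : ((x q : ℂ) + y * I).re = x q := by simp
    have e' : ((x q : ℂ) + y * I).im = y := by simp
    rw [e, e', Function.update_eq_self] at this
    exact this
  have hcontour := integral_eq_integral_shift q (σ * c) (‖conj K‖ * C) H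
    (fun x ζ hζ => ?_) (fun x y hy => ?_) (fun y hy => ?_)
  · simp only [hzero, hone] at hcontour
    rw [pairing, pairing, ← integral_neg]
    refine Eq.trans (Eq.trans (integral_congr_ae (ae_generic.mono fun x hx => ?_)) hcontour)
      (integral_congr_ae (ae_generic.mono fun x hx => ?_))
    · have := key x hx 0 (Or.inl rfl)
      rw [neg_zero, sub_zero] at this
      change integrand n c p (fun z => a z * F (tr c z m₀)) G x = H (pt c x 0)
      rw [this, pt_zero]
      rfl
    · have := key x hx m₀ (Or.inr rfl)
      rw [sub_self] at this
      simp only [this, integrand, pt_zero, map_mul]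
      have := ha.adjoint x hx
      change _ = -(conj (F (toC x)) * (a (toC x) * G (pt c x m₀)) * mu n c p (toC x))
      linear_combination (conj (F (toC x)) * G (pt c x m₀)) * this
  · have hZ : Differentiable ℂ fun ζ : ℂ => Function.update (fun i => (x i : ℂ)) q ζ := by
      refine differentiable_pi.2 fun i => ?_
      by_cases hi : i = q
      · subst hi; simp
      · simp [hi]
    have hmem : Function.update (fun i => (x i : ℂ)) q ζ ∈ strip c m₀ :=
      ⟨_, _, mem_Icc_of_mem_uIcc hc hσ hζ, update_eq_line hc hσ q x ζ⟩
    have hconst : ∀ w : ℂ, ∏ l ∈ (Finset.range (2 * n)).erase q.1.1,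
        levQ c p (S ∪ S') l (Function.update (fun i => (x i : ℂ)) q w) =
        ∏ l ∈ (Finset.range (2 * n)).erase q.1.1, levQ c p (S ∪ S') l (toC x) := fun w =>
      Finset.prod_congr rfl fun l hl => levQ_congr c p _ l fun i hi => by
        rw [Function.update_of_ne]
        · rfl
        · rintro rfl; exact Finset.ne_of_mem_erase hl hi.symm
    simp only [hH, hE, hconst]
    refine ((core_differentiableAt h hcomp hQ hZ hmem).mul
      (DifferentiableAt.mul_const ?_ _)).const_mul _
    exact ((differentiable_levX hc p _ _ _) _).comp ζ (hZ ζ)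
  · rw [hline]
    have hmem : line c m₀ x (σ * y / c) ∈ strip c m₀ := ⟨x, _, mem_Icc_of_mem_uIcc hc hσ hy, rfl⟩
    have := hC _ hmem
    rw [rePart_line] at this
    simp only [hH]
    rw [norm_mul, mul_left_comm]
    gcongr
  · simp only [hline]
    have hl : Continuous fun x : Idx n → ℝ => line c m₀ x (σ * y / c) := by unfold line; fun_prop
    refine Measurable.aestronglyMeasurable (Measurable.const_mul
      ((core_measurable h hcomp hQ (mem_Icc_of_mem_uIcc hc hσ hy)).mul (Measurable.mul ?_ ?_)) _)
    · exact ((differentiable_levX hc p _ _ _).continuous.comp hl).measurable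
    · exact Finset.measurable_fun_prod _ fun l _ => (measurable_levQ hc p _ l).comp hl.measurable

theorem pairing_shift {c : ℝ} {p : ℕ → ℝ} {ε : ℕ → ℤˣ} {R : ℝ} {f g φ ψ : Fn n}
    (h : RegPair c p ε R f g φ ψ) {q : Idx n} {σ : ℤ} {a : Fn n}
    (ha : IsShiftCoeff c p q σ a) {S S' : Finset ℕ} (hd : Disjoint S S')
    (hS : S ∪ S' ⊆ Finset.range (2 * n)) (hqS : q.1.1 ∉ S) (hqS' : q.1.1 ∉ S')
    {F G : Fn n} (hF : Rep c p (-ε) S f F) (hG : Rep c p ε S' g G) :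
    pairing n c p (fun z => a z * F (tr c z (Pi.single q σ))) G =
      -pairing n c p F fun z => a z * G (tr c z (Pi.single q σ)) := by
  have hc := h.pos
  have hco := ha.isCoeff hc
  have hd1 : Disjoint (insert q.1.1 S) S' := Finset.disjoint_insert_left.2 ⟨hqS', hd⟩
  have hd2 : Disjoint S (insert q.1.1 S') := Finset.disjoint_insert_right.2 ⟨hqS, hd⟩
  have hS1 : insert q.1.1 S ∪ S' ⊆ Finset.range (2 * n) := by
    rw [Finset.insert_union]; exact Finset.insert_subset q.level_mem hS
  have hS2 : S ∪ insert q.1.1 S' ⊆ Finset.range (2 * n) := by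
    rw [Finset.union_insert]; exact Finset.insert_subset q.level_mem hS
  have hm₀ : ∀ T : Finset ℕ, q.1.1 ∉ T → ∀ i : Idx n, i.1.1 ∈ T →
      (Pi.single q σ : Idx n → ℤ) i = 0 := fun T hT i hi =>
    hco.supp i fun h' => hT (h' ▸ hi)
  induction hF with
  | add F₁ F₂ F r1 r2 hF h1 h2 =>
    have e1 := pairing_congr_add_left c p (F := fun z => a z * F (tr c z (Pi.single q σ)))
      (Rep.integrable h hd1 hS1 (r1.comp hc hqS hco) hG)
      (Rep.integrable h hd1 hS1 (r2.comp hc hqS hco) hG) fun x hx => by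
        have := hF x hx _ (hm₀ S hqS)
        rw [pt] at this
        rw [this]; ring
    have e2 := pairing_congr_add_left c p (F := F)
      (Rep.integrable h hd2 hS2 r1 (hG.comp hc hqS' hco))
      (Rep.integrable h hd2 hS2 r2 (hG.comp hc hqS' hco)) fun x hx => by
        have := hF x hx 0 fun _ _ => rfl
        rwa [pt_zero] at this
    rw [e1, e2, h1, h2]; ring
  | term qf hqf s hs hsS F hF =>
    induction hG with
    | add G₁ G₂ G r1 r2 hG h1 h2 =>
      have rF : Rep c p (-ε) S f F := .term qf hqf s hs hsS F hF
      have e1 := pairing_congr_add_right c p (G := fun z => a z * G (tr c z (Pi.single q σ)))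
        (Rep.integrable h hd2 hS2 rF (r1.comp hc hqS' hco))
        (Rep.integrable h hd2 hS2 rF (r2.comp hc hqS' hco)) fun x hx => by
          have := hG x hx _ (hm₀ S' hqS')
          rw [pt] at this
          rw [this]; ring
      have e2 := pairing_congr_add_right c p (G := G)
        (Rep.integrable h hd1 hS1 (rF.comp hc hqS hco) r1)
        (Rep.integrable h hd1 hS1 (rF.comp hc hqS hco) r2) fun x hx => by
          have := hG x hx 0 fun _ _ => rfl
          rwa [pt_zero] at this
      rw [e1, e2, h1, h2]; ring
    | term qg hqg s' hs' hsS' G hG =>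
      exact pairing_shift_term h ha hd hS hqS hqS' hqf hqg hs hs' hsS hsS' hF hG

end SoToda

end

noncomputable section

namespace SoToda

variable {n : ℕ}

/-! ### Skew-adjoint operators -/

/-- `A` is an operator of the levels in `L` with `(A F, G) = s (F, A G)`. -/
structure SkewOp (n : ℕ) (c : ℝ) (p : ℕ → ℝ) (L : Finset ℕ) (s : ℂ) (A : Fn n → Fn n) : Prop where
  sub : L ⊆ Finset.range (2 * n)
  rep : ∀ (ε : ℕ → ℤˣ) (f F : Fn n) (S : Finset ℕ), Rep c p ε S f F → Disjoint L S →
    Rep c p ε (L ∪ S) f (A F)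
  skew : ∀ (ε : ℕ → ℤˣ) (R : ℝ) (f g φ ψ : Fn n), RegPair c p ε R f g φ ψ →
    ∀ (S S' : Finset ℕ) (F G : Fn n), Rep c p (-ε) S f F → Rep c p ε S' g G →
      Disjoint L S → Disjoint L S' → Disjoint S S' → S ∪ S' ⊆ Finset.range (2 * n) →
        pairing n c p (A F) G = s * pairing n c p F (A G)

variable {c : ℝ} {p : ℕ → ℝ}

theorem SkewOp.integrable_left {L : Finset ℕ} {s : ℂ} {A : Fn n → Fn n} (hA : SkewOp n c p L s A)
    {ε : ℕ → ℤˣ} {R : ℝ} {f g φ ψ : Fn n} (h : RegPair c p ε R f g φ ψ) {S S' : Finset ℕ}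
    {F G : Fn n} (hF : Rep c p (-ε) S f F) (hG : Rep c p ε S' g G) (h1 : Disjoint L S)
    (h2 : Disjoint L S') (h3 : Disjoint S S') (h4 : S ∪ S' ⊆ Finset.range (2 * n)) :
    Integrable (integrand n c p (A F) G) :=
  Rep.integrable h (Finset.disjoint_union_left.2 ⟨h2, h3⟩)
    (by rw [Finset.union_assoc]; exact Finset.union_subset hA.sub h4) (hA.rep _ _ _ _ hF h1) hG

theorem SkewOp.integrable_right {L : Finset ℕ} {s : ℂ} {A : Fn n → Fn n} (hA : SkewOp n c p L s A)
    {ε : ℕ → ℤˣ} {R : ℝ} {f g φ ψ : Fn n} (h : RegPair c p ε R f g φ ψ) {S S' : Finset ℕ}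
    {F G : Fn n} (hF : Rep c p (-ε) S f F) (hG : Rep c p ε S' g G) (h1 : Disjoint L S)
    (h2 : Disjoint L S') (h3 : Disjoint S S') (h4 : S ∪ S' ⊆ Finset.range (2 * n)) :
    Integrable (integrand n c p F (A G)) :=
  Rep.integrable h (Finset.disjoint_union_right.2 ⟨h1.symm, h3⟩)
    (by rw [Finset.union_left_comm]; exact Finset.union_subset hA.sub h4) hF
    (hA.rep _ _ _ _ hG h2)

theorem SkewOp.congr {L : Finset ℕ} {s : ℂ} {A B : Fn n → Fn n} (hA : SkewOp n c p L s A)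
    (h : ∀ f, B f = A f) : SkewOp n c p L s B := by
  rwa [show B = A from funext h]

theorem SkewOp.zero {L : Finset ℕ} (hL : L ⊆ Finset.range (2 * n)) (s : ℂ) :
    SkewOp n c p L s fun _ _ => 0 :=
  ⟨hL, fun ε f _ _ _ _ => Rep.zero c p ε _ f, fun ε R f g φ ψ h S S' F G _ _ _ _ _ _ => by
    simp [pairing, integrand]⟩

theorem SkewOp.add {L : Finset ℕ} {s : ℂ} {A B : Fn n → Fn n} (hA : SkewOp n c p L s A)
    (hB : SkewOp n c p L s B) : SkewOp n c p L s fun f z => A f z + B f z := by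
  refine ⟨hA.sub, fun ε f F S hF hd => .add _ _ _ (hA.rep _ _ _ _ hF hd) (hB.rep _ _ _ _ hF hd)
    fun _ _ _ _ => rfl, fun ε R f g φ ψ h S S' F G hF hG h1 h2 h3 h4 => ?_⟩
  rw [pairing_congr_add_left c p (hA.integrable_left h hF hG h1 h2 h3 h4)
      (hB.integrable_left h hF hG h1 h2 h3 h4) fun _ _ => rfl,
    pairing_congr_add_right c p (hA.integrable_right h hF hG h1 h2 h3 h4)
      (hB.integrable_right h hF hG h1 h2 h3 h4) fun _ _ => rfl,
    hA.skew _ _ _ _ _ _ h _ _ _ _ hF hG h1 h2 h3 h4,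
    hB.skew _ _ _ _ _ _ h _ _ _ _ hF hG h1 h2 h3 h4]
  ring

theorem SkewOp.sum {L : Finset ℕ} (hL : L ⊆ Finset.range (2 * n)) {s : ℂ} {ι : Type*}
    (T : Finset ι) (A : ι → Fn n → Fn n) (hA : ∀ i ∈ T, SkewOp n c p L s (A i)) :
    SkewOp n c p L s fun f z => ∑ i ∈ T, A i f z := by
  classical
  induction T using Finset.induction_on with
  | empty => simpa using SkewOp.zero hL s
  | insert i T hi ih =>
    simp only [Finset.sum_insert hi]
    exact (hA i (Finset.mem_insert_self _ _)).add
      (ih fun j hj => hA j (Finset.mem_insert_of_mem hj))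

theorem SkewOp.const_mul {L : Finset ℕ} {s s' : ℂ} {A : Fn n → Fn n} (hA : SkewOp n c p L s A)
    (a : ℂ) (ha : conj a * s = s' * a) : SkewOp n c p L s' fun f z => a * A f z := by
  refine ⟨hA.sub, fun ε f F S hF hd => (hA.rep _ _ _ _ hF hd).const_mul a,
    fun ε R f g φ ψ h S S' F G hF hG h1 h2 h3 h4 => ?_⟩
  rw [pairing_const_mul_left, pairing_const_mul_right,
    hA.skew _ _ _ _ _ _ h _ _ _ _ hF hG h1 h2 h3 h4]
  linear_combination pairing n c p F (A G) * ha

theorem SkewOp.commutator {L L' : Finset ℕ} {s s' : ℂ} {A B : Fn n → Fn n}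
    (hA : SkewOp n c p L s A) (hB : SkewOp n c p L' s' B) (hL : Disjoint L L') :
    SkewOp n c p (L ∪ L') (-(s * s')) fun f z => A (B f) z - B (A f) z := by
  have hAB : ∀ (ε : ℕ → ℤˣ) (f F : Fn n) (S : Finset ℕ), Rep c p ε S f F →
      Disjoint (L ∪ L') S →
      Rep c p ε (L ∪ L' ∪ S) f (A (B F)) ∧ Rep c p ε (L ∪ L' ∪ S) f (B (A F)) := by
    intro ε f F S hF hd
    rw [Finset.disjoint_union_left] at hd
    have h1 := hA.rep _ _ _ _ (hB.rep _ _ _ _ hF hd.2) (Finset.disjoint_union_right.2 ⟨hL, hd.1⟩)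
    have h2 := hB.rep _ _ _ _ (hA.rep _ _ _ _ hF hd.1)
      (Finset.disjoint_union_right.2 ⟨hL.symm, hd.2⟩)
    rw [Finset.union_left_comm] at h2
    rw [Finset.union_assoc]
    exact ⟨h1, h2⟩
  have hsub := Finset.union_subset hA.sub hB.sub
  refine ⟨hsub, fun ε f F S hF hd => (hAB ε f F S hF hd).1.sub (hAB ε f F S hF hd).2,
    fun ε R f g φ ψ h S S' F G hF hG h1 h2 h3 h4 => ?_⟩
  obtain ⟨rF1, rF2⟩ := hAB _ _ _ _ hF h1
  obtain ⟨rG1, rG2⟩ := hAB _ _ _ _ hG h2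
  have d1 : Disjoint (L ∪ L' ∪ S) S' := Finset.disjoint_union_left.2 ⟨h2, h3⟩
  have d2 : Disjoint S (L ∪ L' ∪ S') := Finset.disjoint_union_right.2 ⟨h1.symm, h3⟩
  have s1 : L ∪ L' ∪ S ∪ S' ⊆ Finset.range (2 * n) := by
    rw [Finset.union_assoc]; exact Finset.union_subset hsub h4
  have s2 : S ∪ (L ∪ L' ∪ S') ⊆ Finset.range (2 * n) := by
    rw [Finset.union_left_comm]; exact Finset.union_subset hsub h4
  have e1 := pairing_congr_add_left c p (F := fun z => A (B F) z - B (A F) z)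
    (Rep.integrable h d1 s1 rF1 hG) (Rep.integrable h d1 s1 (rF2.const_mul (-1)) hG)
    fun x _ => by ring
  have e2 := pairing_congr_add_right c p (G := fun z => A (B G) z - B (A G) z)
    (Rep.integrable h d2 s2 hF rG1) (Rep.integrable h d2 s2 hF (rG2.const_mul (-1)))
    fun x _ => by ring
  rw [Finset.disjoint_union_left] at h1 h2
  obtain ⟨hS, hS'⟩ := Finset.union_subset_iff.1 h4
  have k1 := hA.skew _ _ _ _ _ _ h _ _ _ _ (hB.rep _ _ _ _ hF h1.2) hG
    (Finset.disjoint_union_right.2 ⟨hL, h1.1⟩) h2.1 (Finset.disjoint_union_left.2 ⟨h2.2, h3⟩)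
    (Finset.union_subset (Finset.union_subset hB.sub hS) hS')
  have k2 := hB.skew _ _ _ _ _ _ h _ _ _ _ hF (hA.rep _ _ _ _ hG h2.1) h1.2
    (Finset.disjoint_union_right.2 ⟨hL.symm, h2.2⟩) (Finset.disjoint_union_right.2 ⟨h1.1.symm, h3⟩)
    (Finset.union_subset hS (Finset.union_subset hA.sub hS'))
  have k3 := hB.skew _ _ _ _ _ _ h _ _ _ _ (hA.rep _ _ _ _ hF h1.1) hG
    (Finset.disjoint_union_right.2 ⟨hL.symm, h1.2⟩) h2.2
    (Finset.disjoint_union_left.2 ⟨h2.1, h3⟩)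
    (Finset.union_subset (Finset.union_subset hA.sub hS) hS')
  have k4 := hA.skew _ _ _ _ _ _ h _ _ _ _ hF (hB.rep _ _ _ _ hG h2.2) h1.1
    (Finset.disjoint_union_right.2 ⟨hL, h2.1⟩) (Finset.disjoint_union_right.2 ⟨h1.2.symm, h3⟩)
    (Finset.union_subset hS (Finset.union_subset hB.sub hS'))
  rw [e1, e2, pairing_const_mul_left, pairing_const_mul_right, k1, k2, k3, k4, map_neg, map_one]
  ring

theorem SkewOp.isSkewFor {L : Finset ℕ} {A : Fn n → Fn n} (hc : 0 < c)
    (hA : SkewOp n c p L (-1) A) {ε : ℕ → ℤˣ} {R : ℝ} {f g φ ψ : Fn n}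
    (h : RegPair c p ε R f g φ ψ) : IsSkewFor n c p A f g := by
  have h1 := Rep.self hc p (-ε) f
  have h2 := Rep.self hc p ε g
  refine ⟨hA.integrable_left h h1 h2 ?_ ?_ ?_ ?_, hA.integrable_right h h1 h2 ?_ ?_ ?_ ?_, ?_⟩
  any_goals simp
  rw [hA.skew _ _ _ _ _ _ h _ _ _ _ h1 h2 (by simp) (by simp) (by simp) (by simp)]
  ring

theorem IsShiftCoeff.skewOp (hc : 0 < c) {q : Idx n} {σ : ℤ} {a : Fn n}
    (ha : IsShiftCoeff c p q σ a) :
    SkewOp n c p {q.1.1} (-1) fun f z => a z * f (tr c z (Pi.single q σ)) := by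
  refine ⟨Finset.singleton_subset_iff.2 q.level_mem, fun ε f F S hF hd => ?_,
    fun ε R f g φ ψ h S S' F G hF hG h1 h2 h3 h4 => ?_⟩
  · rw [← Finset.insert_eq]
    exact hF.comp hc (Finset.disjoint_singleton_left.1 hd) (ha.isCoeff hc)
  · rw [pairing_shift h ha h3 h4 (Finset.disjoint_singleton_left.1 h1)
      (Finset.disjoint_singleton_left.1 h2) hF hG]
    ring

theorem skewOp_mul (hc : 0 < c) {l : ℕ} (hl : l ∈ Finset.range (2 * n)) {a : Fn n}
    (ha : IsCoeff c p l 0 a) (hconj : ∀ x, conj (a (toC x)) = -a (toC x)) :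
    SkewOp n c p {l} (-1) fun f z => a z * f z := by
  refine ⟨Finset.singleton_subset_iff.2 hl, fun ε f F S hF hd => ?_,
    fun ε R f g φ ψ h S S' F G hF hG h1 h2 h3 h4 => ?_⟩
  · rw [← Finset.insert_eq]
    have := hF.comp hc (Finset.disjoint_singleton_left.1 hd) ha
    simpa only [tr_zero] using this
  · rw [pairing, pairing, ← integral_const_mul]
    congr 1; ext x
    simp only [integrand, map_mul, hconj]; ring

/-! ### The generators -/

theorem conj_numOdd (c : ℝ) (p : ℕ → ℝ) {k j : ℕ} (h : (2 * k - 1, j) ∈ positions n) {σ : ℤ}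
    (x : Idx n → ℝ) : conj (numOdd c p k j σ (pt c x (-Pi.single ⟨_, h⟩ σ))) =
      numOdd c p k j σ (toC x) := by
  have hm := mem_positions.1 h
  have e0 : ∀ l r, entry p (pt c x (Pi.single ⟨_, h⟩ σ)) l r =
      entry p (toC x) l r + I * c * ((if (l, r) = (2 * k - 1, j) then σ else 0 : ℤ) : ℂ) := by
    intro l r; rw [pt, entry_tr, entZ_single]
  have e2 : conj (2 : ℂ) = 2 := map_ofNat _ 2
  have n1 : ∀ r, ¬ (2 * k - 2, r) = (2 * k - 1, j) := fun r h' => by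
    have := congrArg Prod.fst h'; simp only at this; omega
  have n2 : ∀ r, ¬ (2 * k, r) = (2 * k - 1, j) := fun r h' => by
    have := congrArg Prod.fst h'; simp only at this; omega
  unfold numOdd
  simp only [map_mul, map_prod, map_add, map_sub, map_div₀, map_intCast, conj_I, conj_ofReal, e2,
    conj_entry, cj_pt, neg_neg, e0, n1, n2, if_true, if_false]
  congr 1 <;> refine Finset.prod_congr rfl fun r _ => ?_ <;> push_cast <;> ring

theorem conj_numEven (c : ℝ) (p : ℕ → ℝ) {k j : ℕ} (h : (2 * k, j) ∈ positions n) {σ : ℤ}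
    (x : Idx n → ℝ) : conj (numEven c p k j σ (pt c x (-Pi.single ⟨_, h⟩ σ))) =
      numEven c p k j σ (toC x) := by
  have hm := mem_positions.1 h
  have e0 : ∀ l r, entry p (pt c x (Pi.single ⟨_, h⟩ σ)) l r =
      entry p (toC x) l r + I * c * ((if (l, r) = (2 * k, j) then σ else 0 : ℤ) : ℂ) := by
    intro l r; rw [pt, entry_tr, entZ_single]
  have e2 : conj (2 : ℂ) = 2 := map_ofNat _ 2
  have n1 : ∀ r, ¬ (2 * k - 1, r) = (2 * k, j) := fun r h' => by
    have := congrArg Prod.fst h'; simp only at this; omega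
  have n2 : ∀ r, ¬ (2 * k + 1, r) = (2 * k, j) := fun r h' => by
    have := congrArg Prod.fst h'; simp only at this; omega
  unfold numEven
  split_ifs <;>
  simp only [map_mul, map_prod, map_add, map_sub, map_div₀, map_pow, map_intCast, conj_I,
    conj_ofReal, e2, conj_entry, cj_pt, neg_neg, e0, n1, n2, if_true, if_false] <;>
  refine Finset.prod_congr rfl fun r _ => ?_ <;> push_cast <;> ring

theorem skewOp_shiftOdd (hc : 0 < c) {k j : ℕ} (hk : k ∈ Finset.Icc 1 n)
    (hj : j ∈ Finset.Icc 1 k) {σ : ℤ} (hσ : σ = 1 ∨ σ = -1) :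
    SkewOp n c p {2 * k - 1} (-1) fun f z => -(1 / (I * c)) / 2 * numOdd c p k j σ z /
      den c p (2 * k - 1) j σ z * f (shift z (2 * k - 1) j (σ * (I * c))) := by
  have h : (2 * k - 1, j) ∈ positions n := by
    rw [mem_positions]; rw [Finset.mem_Icc] at hk hj; omega
  have e2 : conj (2 : ℂ) = 2 := map_ofNat _ 2
  have h2 : ¬ (2 * k - 1) % 2 = 0 := by rw [Finset.mem_Icc] at hk; omega
  simp only [shift_eq_tr c _ h]
  refine (isShiftCoeff_of_num (q := ⟨_, h⟩) hc hσ _ ?_ _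
    (fun ε => numOdd_eq hc p ε hk hj h hσ) fun x => conj_numOdd c p h x).skewOp hc
  simp only [h2, if_false, map_div₀, map_neg, map_one, map_mul, conj_I, conj_ofReal, e2]
  have hc' : (c : ℂ) ≠ 0 := by exact_mod_cast hc.ne'
  have hI := I_ne_zero
  field_simp

theorem skewOp_shiftEven (hc : 0 < c) {k j : ℕ} (hk : k ∈ Finset.Icc 1 (n - 1))
    (hj : j ∈ Finset.Icc 1 k) {σ : ℤ} (hσ : σ = 1 ∨ σ = -1) :
    SkewOp n c p {2 * k} (-1) fun f z => 1 / (c : ℂ) / 2 * numEven c p k j σ z /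
      den c p (2 * k) j σ z * f (shift z (2 * k) j (σ * (I * c))) := by
  have h : (2 * k, j) ∈ positions n := by
    rw [mem_positions]; rw [Finset.mem_Icc] at hk hj; omega
  have e2 : conj (2 : ℂ) = 2 := map_ofNat _ 2
  have h2 : (2 * k) % 2 = 0 := by omega
  simp only [shift_eq_tr c _ h]
  refine (isShiftCoeff_of_num (q := ⟨_, h⟩) hc hσ _ ?_ _
    (fun ε => numEven_eq hc p ε hk hj h hσ) fun x => conj_numEven c p h x).skewOp hc
  simp only [h2, if_true, map_div₀, map_one, conj_ofReal, e2]
  ring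

theorem den_odd (c : ℝ) (p : ℕ → ℝ) {k : ℕ} (hk : 1 ≤ k) (j : ℕ) (τ : ℤ) (z : Idx n → ℂ) :
    den c p (2 * k - 1) j τ z = ∏ r ∈ (Finset.Icc 1 k).erase j,
      ((entry p z (2 * k - 1) j - entry p z (2 * k - 1) r) *
        (entry p z (2 * k - 1) j + entry p z (2 * k - 1) r + τ * (I * c))) := by
  have h1 : (2 * k - 1 + 1) / 2 = k := by omega
  have h2 : ¬ (2 * k - 1) % 2 = 0 := by omega
  simp only [den, singleDen, pairDen, h1, h2, if_false, one_mul]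

theorem den_even (c : ℝ) (p : ℕ → ℝ) (k j : ℕ) (τ : ℤ) (z : Idx n → ℂ) :
    den c p (2 * k) j τ z = entry p z (2 * k) j * (entry p z (2 * k) j + τ * (I * c / 2)) *
      ∏ r ∈ (Finset.Icc 1 k).erase j, (entry p z (2 * k) j ^ 2 - entry p z (2 * k) r ^ 2) := by
  have h1 : (2 * k + 1) / 2 = k := by omega
  have h2 : (2 * k) % 2 = 0 := by omega
  simp only [den, singleDen, pairDen, h1, h2, if_true]
  congr 1
  exact Finset.prod_congr rfl fun r _ => by ring

theorem skewOp_opOdd (hc : 0 < c) {k : ℕ} (hk : k ∈ Finset.Icc 1 n) :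
    SkewOp n c p {2 * k - 1} (-1) (opOdd n c p k) := by
  have hk' := Finset.mem_Icc.1 hk
  have hL : ({2 * k - 1} : Finset ℕ) ⊆ Finset.range (2 * n) := by
    rw [Finset.singleton_subset_iff, Finset.mem_range]; omega
  refine ((SkewOp.sum hL (Finset.Icc 1 k) _ fun j hj =>
    skewOp_shiftOdd hc hk hj (σ := 1) (Or.inl rfl)).add
    (SkewOp.sum hL (Finset.Icc 1 k) _ fun j hj =>
      skewOp_shiftOdd hc hk hj (σ := -1) (Or.inr rfl))).congr fun f => ?_
  ext z
  simp only [opOdd]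
  rw [sub_eq_add_neg, ← neg_mul (1 / (I * (c : ℂ))), Finset.mul_sum, Finset.mul_sum]
  congr 1 <;> refine Finset.sum_congr rfl fun j _ => ?_ <;> rw [den_odd c p hk'.1]
  · have e1 : ((1 : ℤ) : ℂ) * (I * c) = I * c := by simp
    have e2 : numOdd c p k j 1 z = (∏ r ∈ Finset.Icc 1 (k - 1),
        (entry p z (2 * k - 2) r + entry p z (2 * k - 1) j + I * c / 2)) *
        ∏ r ∈ Finset.Icc 1 k, (entry p z (2 * k - 1) j - entry p z (2 * k) r + I * c / 2) := by
      unfold numOdd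
      congr 1 <;> refine Finset.prod_congr rfl fun r _ => ?_ <;> push_cast <;> ring
    rw [e1, e2]
    ring
  · have e1 : ((-1 : ℤ) : ℂ) * (I * c) = -(I * c) := by simp
    have e2 : numOdd c p k j (-1) z = (∏ r ∈ Finset.Icc 1 (k - 1),
        (entry p z (2 * k - 1) j - entry p z (2 * k - 2) r - I * c / 2)) *
        ∏ r ∈ Finset.Icc 1 k, (entry p z (2 * k) r + entry p z (2 * k - 1) j - I * c / 2) := by
      unfold numOdd
      congr 1 <;> refine Finset.prod_congr rfl fun r _ => ?_ <;> push_cast <;> ring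
    rw [e1, e2]
    simp only [← sub_eq_add_neg]
    ring

theorem isCoeff_even (hc : 0 < c) {k : ℕ} (hk : k + 1 ≤ n) :
    IsCoeff (n := n) c p (2 * k) 0 fun z => -(1 / (I * c)) *
      (((∏ r ∈ Finset.Icc 1 k, entry p z (2 * k - 1) r) *
        ∏ r ∈ Finset.Icc 1 (k + 1), entry p z (2 * k + 1) r) /
        ∏ r ∈ Finset.Icc 1 k, ((entry p z (2 * k) r + I * c / 2) *
          (entry p z (2 * k) r - I * c / 2))) := by
  refine ⟨by simp, fun _ _ => rfl, fun ε => ?_⟩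
  have e : ∀ l r, PolyFn fun z : Idx n → ℂ => entry p z l r := fun l r => .entry p l r
  have h1 : (2 * k + 1) / 2 = k := by omega
  have h2 : (2 * k) % 2 = 0 := by omega
  have hl : 2 * k ∈ Finset.range (2 * n) := by rw [Finset.mem_range]; omega
  refine ⟨fun z => -(1 / (I * c)) * ((∏ r ∈ Finset.Icc 1 k, entry p z (2 * k - 1) r) *
    ∏ r ∈ Finset.Icc 1 (k + 1), entry p z (2 * k + 1) r) *
    ((∏ r ∈ Finset.Icc 1 k, entry p z (2 * k) r) * ∏ r ∈ Finset.Icc 1 k, ∏ s ∈ Finset.Ioc r k,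
      pairD c (2 * k) (entry p z (2 * k) r) (entry p z (2 * k) s)), ?_, fun x hx m hm => ?_⟩
  · refine ((PolyFn.const _).mul ((PolyFn.prod _ _ fun r _ => e _ r).mul
      (PolyFn.prod _ _ fun r _ => e _ r))).mul ((PolyFn.prod _ _ fun r _ => e _ r).mul
      (PolyFn.prod _ _ fun r _ => PolyFn.prod _ _ fun s _ => ?_))
    simp only [pairD, h2, if_true]
    exact (((e _ r).sub (e _ s)).mul ((e _ r).add (e _ s))).pow 2
  · have hne := levD_pt_ne_zero hc p hl hx hm
    have e3 : levD c p (2 * k) (pt c x m) =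
        (∏ r ∈ Finset.Icc 1 k, ((entry p (pt c x m) (2 * k) r + I * c / 2) *
          (entry p (pt c x m) (2 * k) r - I * c / 2))) *
        ((∏ r ∈ Finset.Icc 1 k, entry p (pt c x m) (2 * k) r) *
          ∏ r ∈ Finset.Icc 1 k, ∏ s ∈ Finset.Ioc r k,
            pairD c (2 * k) (entry p (pt c x m) (2 * k) r) (entry p (pt c x m) (2 * k) s)) := by
      simp only [levD, rowProd, singleD, h1, h2, if_true]
      rw [← mul_assoc]
      congr 1
      rw [← Finset.prod_mul_distrib]
      refine Finset.prod_congr rfl fun r _ => ?_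
      linear_combination (entry p (pt c x m) (2 * k) r * c ^ 2 / 4) * I_sq
    rw [e3] at hne ⊢
    have n1 := left_ne_zero_of_mul hne
    have n2 := right_ne_zero_of_mul hne
    rw [add_zero]
    congr 1
    rw [mul_div_mul_right _ _ n2, mul_div_assoc (-(1 / (I * (c : ℂ))))]

theorem skewOp_iOpEven (hc : 0 < c) {k : ℕ} (hk : k + 1 ≤ n) :
    SkewOp n c p {2 * k} (-1) (iOpEven n c p k) := by
  have hl : 2 * k ∈ Finset.range (2 * n) := by rw [Finset.mem_range]; omega
  have hL := Finset.singleton_subset_iff.2 hl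
  have hk' : ∀ j ∈ Finset.Icc 1 k, k ∈ Finset.Icc 1 (n - 1) := fun j hj => by
    rw [Finset.mem_Icc] at hj ⊢; omega
  refine (((SkewOp.sum hL (Finset.Icc 1 k) _ fun j hj =>
    skewOp_shiftEven hc (hk' j hj) hj (σ := 1) (Or.inl rfl)).add
    (SkewOp.sum hL (Finset.Icc 1 k) _ fun j hj =>
      skewOp_shiftEven hc (hk' j hj) hj (σ := -1) (Or.inr rfl))).add
    (skewOp_mul hc hl (isCoeff_even hc hk) fun x => ?_)).congr fun f => ?_
  · have e2 : conj (2 : ℂ) = 2 := map_ofNat _ 2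
    have e3 : ∏ r ∈ Finset.Icc 1 k, ((entry p (toC x) (2 * k) r + -I * c / 2) *
        (entry p (toC x) (2 * k) r - -I * c / 2)) =
        ∏ r ∈ Finset.Icc 1 k, ((entry p (toC x) (2 * k) r + I * c / 2) *
        (entry p (toC x) (2 * k) r - I * c / 2)) :=
      Finset.prod_congr rfl fun r _ => by ring
    simp only [map_mul, map_prod, map_div₀, map_neg, map_one, map_add, map_sub, conj_I,
      conj_ofReal, e2, conj_entry, cj_toC, e3]
    rw [show 1 / (-I * (c : ℂ)) = -(1 / (I * c)) by rw [neg_mul, div_neg], neg_mul, neg_mul]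
  · ext z
    simp only [iOpEven]
    rw [sub_eq_add_neg, ← neg_mul (1 / (I * (c : ℂ)) * _), ← neg_mul (1 / (I * (c : ℂ))),
      Finset.mul_sum, Finset.mul_sum]
    have e4 : ∀ x N a b P y : ℂ, x * (N / (2 * a * b * P) * y) = x / 2 * N / (a * b * P) * y := by
      intro x N a b P y
      rw [mul_assoc (2 * a), mul_assoc 2, mul_assoc a]
      generalize a * (b * P) = D
      ring
    congr 1
    congr 1 <;> refine Finset.sum_congr rfl fun j _ => ?_ <;> rw [den_even, numEven]
    · have e1 : ((1 : ℤ) : ℂ) * (I * c) = I * c := by simp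
      have e3 : ((1 : ℤ) : ℂ) * (I * c / 2) = I * c / 2 := by simp
      rw [if_pos rfl, e1, e3]
      exact e4 _ _ _ _ _ _
    · have e1 : ((-1 : ℤ) : ℂ) * (I * c) = -(I * c) := by simp
      have e3 : ((-1 : ℤ) : ℂ) * (I * c / 2) = -(I * c / 2) := by simp
      rw [if_neg (by norm_num), e1, e3]
      simp only [← sub_eq_add_neg]
      exact e4 _ _ _ _ _ _

/-! ### The Lie algebra -/

/-- The sign under which the coordinates along `e_a` of the basis `f_k` are conjugated. -/
def parity (a : ℕ) : ℂ := (-1) ^ (a / 2)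

theorem parity_mul_self (a : ℕ) : parity a * parity a = 1 := by
  rw [parity, ← mul_pow]; simp

theorem skewOp_opSimple (hc : 0 < c) {m : ℕ} (hm : m ∈ Finset.Icc 1 (2 * n)) :
    SkewOp n c p {m - 1} (-(parity (m + 1) * parity m)) (opSimple n c p m) := by
  rw [Finset.mem_Icc] at hm
  rcases Nat.even_or_odd' m with ⟨k, rfl | rfl⟩
  · have h1 : parity (2 * k + 1) * parity (2 * k) = 1 := by
      have : parity (2 * k + 1) = parity (2 * k) := by unfold parity; congr 1; omega
      rw [this, parity_mul_self]
    rw [h1]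
    refine (skewOp_opOdd hc (k := k) (by rw [Finset.mem_Icc]; omega)).congr fun f => ?_
    rw [opSimple, if_pos (by omega), show 2 * k / 2 = k by omega]
  · have h1 : parity (2 * k + 1 + 1) * parity (2 * k + 1) = -1 := by
      have : parity (2 * k + 1 + 1) = -parity (2 * k + 1) := by
        unfold parity
        rw [show (2 * k + 1 + 1) / 2 = (2 * k + 1) / 2 + 1 by omega, pow_succ]; ring
      rw [this, neg_mul, parity_mul_self]
    rw [h1, Nat.add_sub_cancel]
    refine ((skewOp_iOpEven hc (k := k) (by omega)).const_mul (-I) ?_).congr fun f => ?_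
    · simp
    · rw [opSimple, if_neg (by omega), show (2 * k + 1) / 2 = k by omega]

theorem skewOp_opI (hc : 0 < c) {b : ℕ} (hb : 1 ≤ b) (d : ℕ) (hd : b + d ≤ 2 * n) :
    SkewOp n c p (Finset.Ico (b - 1) (b + d)) (-(parity (b + d + 1) * parity b))
      (opI n c p b d) := by
  induction d with
  | zero =>
    have h := skewOp_opSimple (n := n) (p := p) hc (m := b) (by rw [Finset.mem_Icc]; omega)
    have h1 : Finset.Ico (b - 1) (b + 0) = {b - 1} := by
      ext a; rw [Finset.mem_Ico, Finset.mem_singleton]; omega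
    rw [h1]
    exact h
  | succ d ih =>
    have h := skewOp_opSimple (n := n) (p := p) hc (m := b + d + 1)
      (by rw [Finset.mem_Icc]; omega)
    have h1 : Finset.Ico (b - 1) (b + (d + 1)) = {b + d + 1 - 1} ∪ Finset.Ico (b - 1) (b + d) := by
      ext a; rw [Finset.mem_union, Finset.mem_Ico, Finset.mem_Ico, Finset.mem_singleton]; omega
    have h2 := h.commutator (ih (by omega)) (by
      rw [Finset.disjoint_singleton_left, Finset.mem_Ico]; omega)
    have h3 : -(-(parity (b + d + 1 + 1) * parity (b + d + 1)) *
        -(parity (b + d + 1) * parity b)) = -(parity (b + (d + 1) + 1) * parity b) := by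
      rw [show b + (d + 1) + 1 = b + d + 1 + 1 by ring]
      linear_combination (-(parity (b + d + 1 + 1) * parity b)) * parity_mul_self (b + d + 1)
    rw [h1, ← h3]
    exact h2

theorem conj_I_pow (k : ℕ) : conj (I ^ k) = (-1) ^ k * I ^ k := by
  rw [map_pow, conj_I, neg_pow]

theorem conj_neg_I_pow (k : ℕ) : conj ((-I) ^ k) = (-1) ^ k * (-I) ^ k := by
  rw [map_pow, map_neg, conj_I, neg_neg, ← mul_pow]; simp

theorem conj_fVec (N k a : ℕ) (hk : 1 ≤ k) (hkN : k ≤ N) :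
    conj (fVec N k a) = parity a * fVec N k a := by
  unfold fVec parity
  split_ifs with h1 h2 h3 h4 h5 h6 h7
  · obtain ⟨k, rfl⟩ := Nat.exists_eq_add_of_le' hk
    rw [h2, show (2 * (k + 1) - 1) / 2 = k by omega, map_div₀, map_mul, conj_I_pow, conj_I,
      conj_ofReal, pow_succ (-1 : ℂ)]
    ring
  · rw [h3, show 2 * k / 2 = k by omega, map_div₀, conj_I_pow, conj_ofReal]
    ring
  · simp
  · obtain ⟨j, hj⟩ := Nat.exists_eq_add_of_le' (show 1 ≤ N + 1 - k by omega)
    rw [h5, hj, show (2 * (j + 1) - 1) / 2 = j by omega, map_div₀, map_mul, conj_neg_I_pow,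
      map_neg, conj_I, conj_ofReal, pow_succ (-1 : ℂ)]
    ring
  · rw [h6, show 2 * (N + 1 - k) / 2 = N + 1 - k by omega, map_div₀, conj_neg_I_pow, conj_ofReal]
    ring
  · simp
  · rw [h7, map_neg, conj_I_pow]; ring
  · simp

theorem conj_fDual (N l a : ℕ) (hl : 1 ≤ l) (hlN : l ≤ N) :
    conj (fDual N l a) = parity a * fDual N l a := by
  unfold fDual
  split_ifs with h1 h2
  · rw [h2, map_neg, conj_neg_I_pow, parity]; ring
  · simp
  · exact conj_fVec N _ a (by omega) (by omega)

theorem IsSkewFor.sum {ι : Type*} (T : Finset ι) (A : ι → Fn n → Fn n) {f g : Fn n}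
    (h : ∀ i ∈ T, IsSkewFor n c p (A i) f g) :
    IsSkewFor n c p (fun f z => ∑ i ∈ T, A i f z) f g := by
  have e1 : integrand n c p (fun z => ∑ i ∈ T, A i f z) g =
      fun x => ∑ i ∈ T, integrand n c p (A i f) g x := by
    ext x; simp only [integrand, map_sum, Finset.sum_mul]
  have e2 : integrand n c p f (fun z => ∑ i ∈ T, A i g z) =
      fun x => ∑ i ∈ T, integrand n c p f (A i g) x := by
    ext x; simp only [integrand, Finset.sum_mul, Finset.mul_sum]
  refine ⟨?_, ?_, ?_⟩
  · rw [e1]; exact integrable_finsetSum _ fun i hi => (h i hi).1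
  · rw [e2]; exact integrable_finsetSum _ fun i hi => (h i hi).2.1
  · rw [pairing, pairing, e1, e2, integral_finsetSum _ fun i hi => (h i hi).1,
      integral_finsetSum _ fun i hi => (h i hi).2.1, ← Finset.sum_neg_distrib]
    exact Finset.sum_congr rfl fun i hi => (h i hi).2.2

end SoToda

end

theorem lemma2 (n : ℕ) (c : ℝ) (hc : 0 < c) (p : ℕ → ℝ) (ε : ℕ → ℤˣ) (f g : SoToda.Fn n)
    (hfg : SoToda.IsAdmissible n c p ε f g) :
    (∀ k : ℕ, 1 ≤ k → k ≤ n → SoToda.IsSkewFor n c p (SoToda.opOdd n c p k) f g) ∧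
    (∀ k : ℕ, k + 1 ≤ n → SoToda.IsSkewFor n c p (SoToda.iOpEven n c p k) f g) ∧
    (∀ N k l : ℕ, N ≤ 2 * n + 1 → 1 ≤ k → k ≤ N → 1 ≤ l → l ≤ N →
      SoToda.IsSkewFor n c p (SoToda.opF n c p N k l) f g) := by
  obtain ⟨R, hR, φ, ψ, hφ, hψ, hdecay⟩ := hfg
  have h : SoToda.RegPair c p ε R f g φ ψ := ⟨hc, hR, hφ, hψ, hdecay⟩
  refine ⟨fun k hk hkn => ?_, fun k hk => ?_, fun N k l hN hk hkN hl hlN => ?_⟩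
  · exact (SoToda.skewOp_opOdd hc (Finset.mem_Icc.2 ⟨hk, hkn⟩)).isSkewFor hc h
  · exact (SoToda.skewOp_iOpEven hc hk).isSkewFor hc h
  · refine SoToda.IsSkewFor.sum _ (fun a f z => ∑ b ∈ Finset.Icc 1 (a - 1),
      (SoToda.fVec N k a * SoToda.fDual N l b - SoToda.fDual N l a * SoToda.fVec N k b) *
        SoToda.opI n c p b (a - b - 1) f z) fun a ha => SoToda.IsSkewFor.sum _ (fun b f z =>
      (SoToda.fVec N k a * SoToda.fDual N l b - SoToda.fDual N l a * SoToda.fVec N k b) *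
        SoToda.opI n c p b (a - b - 1) f z) fun b hb => ?_
    rw [Finset.mem_Icc] at ha hb
    have hI := SoToda.skewOp_opI (n := n) (p := p) hc hb.1 (a - b - 1) (by omega)
    rw [show b + (a - b - 1) + 1 = a by omega] at hI
    refine (hI.const_mul _ ?_).isSkewFor hc h
    simp only [map_sub, map_mul, SoToda.conj_fVec N k _ hk hkN, SoToda.conj_fDual N l _ hl hlN]
    linear_combination (-(SoToda.fVec N k a * SoToda.fDual N l b -
      SoToda.fDual N l a * SoToda.fVec N k b)) *
      (SoToda.parity_mul_self a * (SoToda.parity b * SoToda.parity b) +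
        SoToda.parity_mul_self b)
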